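/- All bornological vector spaces are complex, convex and complete and have the approximation property (the identity is approximated, uniformly on bornologically compact sets, by bounded finite rank operators); $\otimes$ of such spaces is the completed bornological tensor product. A *bornological quantum group* $\mathbb{G}$ is given by an essential bornological $*$-algebra $\mathcal{A}=\mathcal{A}(\mathbb{G})$, with involution $a\mapsto\overline{a}$, together with - a coproduct: an essential bounded $*$-homomorphism $\Delta:\mathcal{A}\to\mathcal{M}(\mathcal{A}\otimes\mathcal{A})$ into the multiplier algebra which is coassociative and for which $a\otimes b\mapsto\Delta(a)(b\otimes1)$ and $a\otimes b\mapsto(1\otimes a)\Delta(b)$ are bounded linear maps $\mathcal{A}\otimes\mathcal{A}\to\mathcal{A}\otimes\mathcal{A}$; - a positive, faithful, left invariant bounded linear functional $\phi:\mathcal{A}\to\mathbb{C}$, that is, $\phi(\overline{a}a)\ge0$, $\phi(\overline{a}a)=0\Rightarrow a=0$, and $(\iota\otimes\phi)(\Delta(a))=\phi(a)1$; - a counit: an essential bounded homomorphism $\epsilon:\mathcal{A}\to\mathbb{C}$ with $(\epsilon\otimes\iota)(\Delta(a))=a=(\iota\otimes\epsilon)(\Delta(a))$; - an antipode: a bornological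 isomorphism $S:\mathcal{A}\to\mathcal{A}$, antimultiplicative and anticomultiplicative, with $\mathrm{m}(S\otimes\iota)(\Delta(a)(1\otimes b))=\epsilon(a)b$ and $\mathrm{m}(\iota\otimes S)((a\otimes1)\Delta(b))=\epsilon(b)a$, where $\mathrm{m}$ is the multiplication. Assume that the scaling constant of $\mathbb{G}$ is $1$, that is, $\phi(S^2(a))=\phi(a)$ for all $a\in\mathcal{A}$. Let $(L^2(\mathbb{G}),\Lambda)$ be a GNS pair for $\phi$: a Hilbert space and a linear map $\Lambda:\mathcal{A}\to L^2(\mathbb{G})$ with dense range and $\langle\Lambda(f),\Lambda(g)\rangle=\phi(\overline{f}g)$. Then the following hold. 1. There is a multiplier $\delta$ of $\mathcal{A}$ (the modular element) with $(\phi\otimes\iota)(\Delta(a))=\phi(a)\delta$ for all $a$; the operators $\Lambda(g)\mapsto\Lambda(fg)$ extend to bounded operators $m(f)$ on $L^2(\mathbb{G})$; and there is a unitary $W$ on $L^2(\mathbb{G})\otimes L^2(\mathbb{G})$ with $W(\Lambda\otimes\Lambda)(\Delta(g)(f\otimes1))=\Lambda(f)\otimes\Lambda(g)$ for all $f,g\in\mathcal{A}$.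 Let $L^\infty(\mathbb{G})=m(\mathcal{A})''$, with coproduct $\Delta(x)=W^*(1\otimes x)W$ and with antipode $S$ the ultraweakly closed (in general unbounded) operator that has the span of the elements $(\iota\otimes\omega)(W)$ as a core and maps $(\iota\otimes\omega)(W)$ to $(\iota\otimes\omega)(W^*)$, where $\omega$ runs through the vector functionals $\langle\xi,\,\cdot\,\eta\rangle$. Let $L^1(\mathbb{G})=L^\infty(\mathbb{G})_*$ be the Banach space of ultraweakly continuous linear functionals on $L^\infty(\mathbb{G})$, with the convolution product $\omega_1\omega_2=(\omega_1\otimes\omega_2)\circ\Delta$ and the partially defined involution given by $\omega^*(x)=\overline{\omega(S(x)^*)}$ for $x$ in the domain of $S$. Let $\mathcal{D}(\mathbb{G})$ be the bornological vector space $\mathcal{A}$ with the convolution product $f*g=(\iota\otimes\phi)((1\otimes S^{-1}(g))\Delta(f))$ and the involution $f^*=\overline{S(f)}\,\delta$. 2. For every $x\in\mathcal{D}(\mathbb{G})$ there is exactly one $\hat{x}\in L^1(\mathbb{G})$ with $\hat{x}(m(a))=\phi(ax)$ for all $a\in\mathcal{A}$. 3. The map $\mathcal{D}(\mathbb{G})\to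 L^1(\mathbb{G})$, $x\mapsto\hat{x}$, is linear and bounded (it maps bounded sets to norm bounded sets) and is a $*$-homomorphism: $\widehat{x*y}=\hat{x}\,\hat{y}$ for all $x,y$, and for every $x$ the functional $\hat{x}$ lies in the domain of the involution of $L^1(\mathbb{G})$, with $(\hat{x})^*=\widehat{x^*}$. Its range is dense in $L^1(\mathbb{G})$ in norm. -/

import Mathlib

open scoped Pointwise TensorProduct InnerProductSpace
open Bornology Filter Topology

namespace BornQG

universe u

/-! ## Complete convex bornological vector spaces -/

section Bornological

variable {V : Type*} [AddCommGroup V] [Module ℂ V]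

/-- A completant disk: a balanced convex set whose gauge is a complete norm on its linear span. -/
structure IsCompletantDisk (D : Set V) : Prop where
  balanced : Balanced ℂ D
  convex : Convex ℝ D
  eq_zero : ∀ x ∈ Submodule.span ℂ D, gauge D x = 0 → x = 0
  complete : ∀ s : ℕ → V, (∀ n, s n ∈ Submodule.span ℂ D) →
    (∀ ε > 0, ∃ N, ∀ m ≥ N, ∀ n ≥ N, gauge D (s m - s n) < ε) →
    ∃ x ∈ Submodule.span ℂ D, Tendsto (fun n => gauge D (s n - x)) atTop (𝓝 0)

/-- Complete convex bornological vector spaces over `ℂ`. -/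
class CompleteBornological (V : Type*) [AddCommGroup V] [Module ℂ V] [Bornology V] : Prop where
  isBounded_add : ∀ s t : Set V, IsBounded s → IsBounded t → IsBounded (s + t)
  isBounded_smul : ∀ (c : ℂ) (s : Set V), IsBounded s → IsBounded (c • s)
  isBounded_hull : ∀ s : Set V, IsBounded s → IsBounded (convexHull ℝ (balancedHull ℂ s))
  exists_disk : ∀ s : Set V, IsBounded s → ∃ D, s ⊆ D ∧ IsBounded D ∧ IsCompletantDisk D

/-- A map that sends bounded sets to bounded sets. -/
def IsBoundedMap {X Y : Type*} [Bornology X] [Bornology Y] (f : X → Y) : Prop :=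
  ∀ s, IsBounded s → IsBounded (f '' s)

/-- A map of two variables that sends pairs of bounded sets to bounded sets. -/
def IsBoundedMap₂ {X Y Z : Type*} [Bornology X] [Bornology Y] [Bornology Z]
    (f : X → Y → Z) : Prop :=
  ∀ s t, IsBounded s → IsBounded t → IsBounded (Set.image2 f s t)

/-- A bornologically compact set: a norm compact subset of the Banach space spanned by some
bounded completant disk. -/
def IsBornCompact [Bornology V] (K : Set V) : Prop :=
  ∃ D : Set V, IsBounded D ∧ IsCompletantDisk D ∧ K ⊆ Submodule.span ℂ D ∧
    ∀ s : ℕ → V, (∀ n, s n ∈ K) → ∃ x ∈ K, ∃ k : ℕ → ℕ, StrictMono k ∧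
      Tendsto (fun n => gauge D (s (k n) - x)) atTop (𝓝 0)

/-- The approximation property: the identity can be approximated uniformly on compact sets by
bounded operators of finite rank. -/
def HasApproximationProperty (V : Type*) [AddCommGroup V] [Module ℂ V] [Bornology V] : Prop :=
  ∀ K : Set V, IsBornCompact K → ∃ B : Set V, IsBounded B ∧ ∀ ε : ℝ, 0 < ε →
    ∃ F : V →ₗ[ℂ] V, IsBoundedMap F ∧ FiniteDimensional ℂ (LinearMap.range F) ∧
      ∀ x ∈ K, F x - x ∈ ε • B

end Bornological

/-! ## The completed bornological tensor product

`CTensor V W` consists of the classes of the absolutely convergent series `∑ c (v, w) • v ⊗ w` with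
`(v, w)` running through the product of a bounded subset of `V` and a bounded subset of `W`; the
space of formal series is divided by the bornological closure of the bilinearity relations. -/

section TensorProduct

variable (V : Type*) (W : Type*) [AddCommGroup V] [Module ℂ V] [Bornology V]
  [AddCommGroup W] [Module ℂ W] [Bornology W]

variable {V W} in
/-- The function `c` is supported in `s ×ˢ t`. -/
def SuppIn (s : Set V) (t : Set W) (c : V × W → ℂ) : Prop :=
  ∀ p, c p ≠ 0 → p.1 ∈ s ∧ p.2 ∈ t

/-- Absolutely summable formal series supported in a product of bounded sets. -/
def preTensor : Submodule ℂ (V × W → ℂ) where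
  carrier := {c | Summable (fun p => ‖c p‖) ∧
    ∃ s t, IsBounded s ∧ IsBounded t ∧ SuppIn s t c}
  zero_mem' := by
    refine ⟨by simp, ∅, ∅, isBounded_empty, isBounded_empty, ?_⟩
    intro p hp
    exact absurd rfl hp
  add_mem' := by
    rintro c d ⟨hc, s, t, hs, ht, hst⟩ ⟨hd, s', t', hs', ht', hst'⟩
    refine ⟨Summable.of_nonneg_of_le (fun _ => norm_nonneg _) (fun p => norm_add_le _ _)
      (hc.add hd), s ∪ s', t ∪ t', hs.union hs', ht.union ht', ?_⟩
    intro p hp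
    by_cases h : c p = 0
    · have h' : d p ≠ 0 := by
        intro h'
        exact hp (by simp [h, h'])
      exact ⟨Or.inr (hst' p h').1, Or.inr (hst' p h').2⟩
    · exact ⟨Or.inl (hst p h).1, Or.inl (hst p h).2⟩
  smul_mem' := by
    rintro z c ⟨hc, s, t, hs, ht, hst⟩
    refine ⟨by simpa [norm_mul] using hc.mul_left ‖z‖, s, t, hs, ht, ?_⟩
    intro p hp
    refine hst p ?_
    intro h
    exact hp (by simp [h])

variable {V W} in
/-- The `ℓ¹` norm of a formal series. -/
noncomputable def l1norm (c : preTensor V W) : ℝ := ∑' p, ‖c.1 p‖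

variable {V W} in
open Classical in
/-- The formal elementary tensor of `v` and `w`. -/
noncomputable def preTmul (v : V) (w : W) : preTensor V W :=
  ⟨Pi.single (v, w) 1, by
    refine ⟨summable_of_ne_finset_zero (s := {(v, w)}) ?_, {v}, {w}, isBounded_singleton,
      isBounded_singleton, ?_⟩
    · intro p hp
      have : p ≠ (v, w) := by simpa using hp
      simp [Pi.single_eq_of_ne this]
    · intro p hp
      have : p = (v, w) := by
        by_contra h
        exact hp (by simp [Pi.single_eq_of_ne h])
      simp [this]⟩

/-- The bilinearity relations. -/
def tensorRel : Set (preTensor V W) :=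
  {c | (∃ v v' w, c = preTmul (v + v') w - preTmul v w - preTmul v' w) ∨
    (∃ v w w', c = preTmul v (w + w') - preTmul v w - preTmul v w') ∨
    (∃ (z : ℂ) (v : V) (w : W), c = preTmul (z • v) w - z • preTmul v w) ∨
    (∃ (z : ℂ) (v : V) (w : W), c = preTmul v (z • w) - z • preTmul v w)}

variable {V W} in
/-- Closedness of a subspace under bornological convergence of sequences of formal series:
uniformly bounded supports, and convergence in `ℓ¹` norm. -/
def IsBornClosed (N : Submodule ℂ (preTensor V W)) : Prop :=
  ∀ (c : ℕ → preTensor V W) (d : preTensor V W) (s : Set V) (t : Set W),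
    IsBounded s → IsBounded t → (∀ n, c n ∈ N) → (∀ n, SuppIn s t (c n).1) → SuppIn s t d.1 →
    Tendsto (fun n => l1norm (c n - d)) atTop (𝓝 0) → d ∈ N

/-- The smallest bornologically closed subspace containing the bilinearity relations. -/
def tensorKer : Submodule ℂ (preTensor V W) :=
  sInf {N | tensorRel V W ⊆ N ∧ IsBornClosed N}

/-- The completed bornological tensor product. -/
def CTensor : Type _ := preTensor V W ⧸ tensorKer V W

noncomputable instance : AddCommGroup (CTensor V W) :=
  inferInstanceAs (AddCommGroup (preTensor V W ⧸ tensorKer V W))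

noncomputable instance : Module ℂ (CTensor V W) :=
  inferInstanceAs (Module ℂ (preTensor V W ⧸ tensorKer V W))

/-- The class of a formal series. -/
noncomputable def CTensor.mkQ : preTensor V W →ₗ[ℂ] CTensor V W := (tensorKer V W).mkQ

variable {V W} in
/-- The elementary tensor `v ⊗ w`. -/
noncomputable def ctmul (v : V) (w : W) : CTensor V W := CTensor.mkQ V W (preTmul v w)

variable {V W} in
/-- The image in `CTensor V W` of the series supported in `s ×ˢ t` of `ℓ¹` norm at most `r`. -/
def tensorDisk (s : Set V) (t : Set W) (r : ℝ) : Set (CTensor V W) :=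
  CTensor.mkQ V W '' {c | SuppIn s t c.1 ∧ l1norm c ≤ r}

lemma SuppIn.mono {V W : Type*} {s s' : Set V} {t t' : Set W} {c : V × W → ℂ}
    (h : SuppIn s t c) (hs : s ⊆ s') (ht : t ⊆ t') : SuppIn s' t' c :=
  fun p hp => ⟨hs (h p hp).1, ht (h p hp).2⟩

/-- Bounded sets are the subsets of the sets `tensorDisk s t r` with `s` and `t` bounded. -/
noncomputable instance : Bornology (CTensor V W) :=
  Bornology.ofBounded {B | ∃ s t r, IsBounded s ∧ IsBounded t ∧ B ⊆ tensorDisk s t r}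
    ⟨∅, ∅, 0, isBounded_empty, isBounded_empty, Set.empty_subset _⟩
    (by
      rintro B ⟨s, t, r, hs, ht, h⟩ B' hB
      exact ⟨s, t, r, hs, ht, hB.trans h⟩)
    (by
      rintro B ⟨s, t, r, hs, ht, h⟩ B' ⟨s', t', r', hs', ht', h'⟩
      refine ⟨s ∪ s', t ∪ t', max r r', hs.union hs', ht.union ht', Set.union_subset ?_ ?_⟩
      · refine h.trans (Set.image_mono ?_)
        rintro c ⟨hc, hc'⟩
        exact ⟨hc.mono Set.subset_union_left Set.subset_union_left, hc'.trans (le_max_left _ _)⟩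
      · refine h'.trans (Set.image_mono ?_)
        rintro c ⟨hc, hc'⟩
        exact ⟨hc.mono Set.subset_union_right Set.subset_union_right,
          hc'.trans (le_max_right _ _)⟩)
    (by
      intro x
      obtain ⟨c, rfl⟩ := Submodule.mkQ_surjective _ x
      obtain ⟨-, s, t, hs, ht, hst⟩ := c.2
      refine ⟨s, t, l1norm c, hs, ht, ?_⟩
      rintro _ rfl
      exact ⟨c, ⟨hst, le_rfl⟩, rfl⟩)

lemma CTensor.isBounded_iff {B : Set (CTensor V W)} :
    IsBounded B ↔ ∃ s t r, IsBounded s ∧ IsBounded t ∧ B ⊆ tensorDisk s t r := by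
  rw [Bornology.isBounded_ofBounded_iff]
  rfl

end TensorProduct

section Completant

variable {X : Type*} [AddCommGroup X] [Module ℂ X]

/-- The span of a completant disk, as a Banach space. -/
lemma IsCompletantDisk.exists_banach {D : Set X} (hD : IsCompletantDisk D) (h0 : D.Nonempty) :
    ∃ (p : Seminorm ℂ (Submodule.span ℂ D)), (∀ x, p x = gauge D (x : X)) := by
  classical
  set P := Submodule.span ℂ D
  let D' : Set P := (fun x : P => (x : X)) ⁻¹' D
  have hbal : Balanced ℂ D' := by
    intro a ha x hx
    obtain ⟨y, hy, rfl⟩ := hx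
    exact hD.balanced a ha ⟨y, hy, rfl⟩
  have hconv : Convex ℝ D' := by
    intro x hx y hy a b ha hb hab
    exact hD.convex hx hy ha hb hab
  have hzero : (0 : X) ∈ D := hD.balanced.zero_mem h0
  have hspan : ∀ x ∈ P, ∃ r : ℝ, 0 < r ∧ x ∈ r • D := by
    intro x hx
    induction hx using Submodule.span_induction with
    | mem x hx => exact ⟨1, one_pos, by simpa using hx⟩
    | zero => exact ⟨1, one_pos, by simpa using hzero⟩
    | add x y _ _ hx hy =>
      obtain ⟨r, hr, hx⟩ := hx
      obtain ⟨s, hs, hy⟩ := hy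
      refine ⟨r + s, by positivity, ?_⟩
      rw [hD.convex.add_smul hr.le hs.le]
      exact Set.add_mem_add hx hy
    | smul a x _ hx =>
      obtain ⟨r, hr, y, hy, rfl⟩ := hx
      refine ⟨(‖a‖ + 1) * r, by positivity, ?_⟩
      have hn : ((‖a‖ + 1 : ℝ) : ℂ) ≠ 0 := by
        have : (‖a‖ + 1 : ℝ) ≠ 0 := by positivity
        exact_mod_cast this
      refine ⟨(a / ((‖a‖ + 1 : ℝ) : ℂ)) • y, ?_, ?_⟩
      · refine hD.balanced.smul_mem ?_ hy
        rw [norm_div, Complex.norm_real, Real.norm_of_nonneg (by positivity)]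
        rw [div_le_one (by positivity)]
        linarith
      · change ((‖a‖ + 1) * r) • (a / ((‖a‖ + 1 : ℝ) : ℂ)) • y = a • r • y
        rw [← Complex.coe_smul ((‖a‖ + 1) * r), ← Complex.coe_smul r, smul_smul, smul_smul]
        congr 1
        push_cast at hn ⊢
        field_simp
  have habs : Absorbent ℝ D' := by
    intro x
    rw [absorbs_iff_norm]
    obtain ⟨r, hr, y, hy, hxy⟩ := hspan x x.2
    refine ⟨r, fun c hc => ?_⟩
    have hc0 : c ≠ 0 := by
      rintro rfl
      simp at hc
      linarith
    rw [Set.singleton_subset_iff, Set.mem_smul_set_iff_inv_smul_mem₀ hc0]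
    change c⁻¹ • (x : X) ∈ D
    rw [← hxy]
    change c⁻¹ • r • y ∈ D
    rw [smul_smul, ← Complex.coe_smul]
    refine hD.balanced.smul_mem ?_ hy
    rw [Complex.norm_real, norm_mul, norm_inv, Real.norm_of_nonneg hr.le]
    rw [inv_mul_le_iff₀ (norm_pos_iff.2 hc0)]
    simpa using hc
  refine ⟨gaugeSeminorm hbal hconv habs, fun x => ?_⟩
  change gauge D' x = gauge D (x : X)
  simp only [gauge_def']
  rfl

end Completant

section Completant

/-- The span of a completant disk is a Banach space. -/
lemma IsCompletantDisk.exists_banach' {X : Type u} [AddCommGroup X] [Module ℂ X]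
    {D : Set X} (hD : IsCompletantDisk D) (h0 : D.Nonempty) :
    ∃ (E : Type u) (_ : NormedAddCommGroup E) (_ : NormedSpace ℂ E) (_ : CompleteSpace E)
      (j : E →ₗ[ℂ] X), Function.Injective j ∧ (∀ x ∈ D, ∃ e, j e = x ∧ ‖e‖ ≤ 1) ∧
      j '' Metric.ball 0 1 ⊆ D := by
  obtain ⟨p, hp⟩ := hD.exists_banach h0
  let nrm : AddGroupNorm (Submodule.span ℂ D) :=
    { p.toAddGroupSeminorm with
      eq_zero_of_map_eq_zero' := fun x hx => by
        have : p x = 0 := hx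
        rw [hp] at this
        exact Subtype.ext (hD.eq_zero x x.2 this) }
  let i1 : NormedAddCommGroup (Submodule.span ℂ D) := nrm.toNormedAddCommGroup
  have hnorm : ∀ x : Submodule.span ℂ D, ‖x‖ = gauge D (x : X) := fun x => hp x
  let i2 : NormedSpace ℂ (Submodule.span ℂ D) :=
    { norm_smul_le := fun a x => (map_smul_eq_mul p a x).le }
  have i3 : CompleteSpace (Submodule.span ℂ D) := by
    refine Metric.complete_of_cauchySeq_tendsto fun s hs => ?_
    rw [Metric.cauchySeq_iff] at hs
    obtain ⟨x, hx, h⟩ := hD.complete (fun n => (s n : X)) (fun n => (s n).2) (by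
      intro ε hε
      obtain ⟨N, hN⟩ := hs ε hε
      refine ⟨N, fun m hm n hn => ?_⟩
      have := hN m hm n hn
      rw [dist_eq_norm, hnorm] at this
      exact this)
    refine ⟨⟨x, hx⟩, ?_⟩
    rw [tendsto_iff_norm_sub_tendsto_zero]
    simp only [hnorm]
    exact h
  refine ⟨Submodule.span ℂ D, i1, i2, i3, (Submodule.span ℂ D).subtype,
    Subtype.val_injective, ?_, ?_⟩
  · intro x hx
    refine ⟨⟨x, Submodule.subset_span hx⟩, rfl, ?_⟩
    rw [hnorm]
    exact gauge_le_of_mem zero_le_one (by simpa using hx)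
  · rintro _ ⟨e, he, rfl⟩
    rw [mem_ball_zero_iff, hnorm] at he
    by_cases hne : {r : ℝ | r ∈ Set.Ioi (0 : ℝ) ∧ (e : X) ∈ r • D}.Nonempty
    · obtain ⟨r, ⟨hr, y, hy, hy'⟩, hr1⟩ := exists_lt_of_csInf_lt hne he
      change (e : X) ∈ D
      rw [← hy']
      change r • y ∈ D
      rw [← Complex.coe_smul]
      refine hD.balanced.smul_mem ?_ hy
      rw [Complex.norm_real, Real.norm_of_nonneg (le_of_lt hr)]
      exact hr1.le
    · exfalso
      have hz : (0 : X) ∈ D := hD.balanced.zero_mem h0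
      have hspan : ∀ x ∈ Submodule.span ℂ D, ∃ r : ℝ, 0 < r ∧ x ∈ r • D := by
        intro x hx
        by_contra hcon
        have he0 : gauge D x = 0 := by
          have : {r : ℝ | 0 < r ∧ x ∈ r • D} = ∅ := by
            ext r
            refine ⟨?_, fun h => absurd h (Set.notMem_empty r)⟩
            rintro ⟨h1, h2⟩
            exact absurd ⟨r, h1, h2⟩ hcon
          rw [gauge, this, Real.sInf_empty]
        have := hD.eq_zero x hx he0
        subst this
        exact hcon ⟨1, one_pos, by simpa using hz⟩
      obtain ⟨r, hr, h⟩ := hspan e e.2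
      exact hne ⟨r, hr, h⟩

/-- The image of the closed unit ball of a Banach space is a completant disk. -/
lemma IsCompletantDisk.of_banach {X : Type*} [AddCommGroup X] [Module ℂ X]
    {E : Type*} [NormedAddCommGroup E] [NormedSpace ℂ E] [CompleteSpace E]
    (j : E →ₗ[ℂ] X) (hj : Function.Injective j) :
    IsCompletantDisk (j '' Metric.closedBall 0 1) := by
  have hg : ∀ e, gauge (j '' Metric.closedBall 0 1) (j e) = ‖e‖ := by
    intro e
    rw [← div_one ‖e‖, ← gauge_closedBall zero_le_one e, gauge_def', gauge_def']
    congr 1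
    ext r
    have : r⁻¹ • j e = j (r⁻¹ • e) := by
      rw [← Complex.coe_smul, ← Complex.coe_smul, map_smul]
    rw [Set.mem_ofPred_eq, Set.mem_ofPred_eq, this, hj.mem_set_image]
  have hspan : ∀ x ∈ Submodule.span ℂ (j '' Metric.closedBall 0 1), ∃ e, j e = x := by
    intro x hx
    have : Submodule.span ℂ (j '' Metric.closedBall 0 1) ≤ LinearMap.range j := by
      rw [Submodule.span_le]
      rintro _ ⟨e, -, rfl⟩
      exact ⟨e, rfl⟩
    exact this hx
  have hspan' : ∀ e, j e ∈ Submodule.span ℂ (j '' Metric.closedBall 0 1) := by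
    intro e
    by_cases h : e = 0
    · simp [h]
    have hn : (‖e‖ : ℂ) ≠ 0 := by exact_mod_cast norm_ne_zero_iff.2 h
    have : j e = (‖e‖ : ℂ) • j ((‖e‖ : ℂ)⁻¹ • e) := by
      rw [map_smul, smul_smul, mul_inv_cancel₀ hn, one_smul]
    rw [this]
    refine Submodule.smul_mem _ _ (Submodule.subset_span ⟨_, ?_, rfl⟩)
    rw [mem_closedBall_zero_iff, norm_smul, norm_inv, Complex.norm_real, norm_norm]
    exact (inv_mul_cancel₀ (norm_ne_zero_iff.2 h)).le
  refine ⟨?_, ?_, ?_, ?_⟩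
  · intro a ha
    rintro _ ⟨_, ⟨e, he, rfl⟩, rfl⟩
    refine ⟨a • e, ?_, map_smul _ _ _⟩
    rw [mem_closedBall_zero_iff] at he ⊢
    rw [norm_smul]
    exact mul_le_one₀ ha (norm_nonneg _) he
  · rintro _ ⟨e, he, rfl⟩ _ ⟨f, hf, rfl⟩ a b ha hb hab
    refine ⟨a • e + b • f, convex_closedBall (0 : E) 1 he hf ha hb hab, ?_⟩
    rw [map_add, ← Complex.coe_smul, ← Complex.coe_smul, ← Complex.coe_smul (a) (j e),
      ← Complex.coe_smul b (j f), map_smul, map_smul]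
  · intro x hx h
    obtain ⟨e, rfl⟩ := hspan x hx
    rw [hg, norm_eq_zero] at h
    simp [h]
  · intro s hs hc
    choose e he using fun n => hspan (s n) (hs n)
    have : CauchySeq e := by
      rw [Metric.cauchySeq_iff]
      intro ε hε
      obtain ⟨N, hN⟩ := hc ε hε
      refine ⟨N, fun m hm n hn => ?_⟩
      have := hN m hm n hn
      rwa [← he, ← he, ← map_sub, hg, ← dist_eq_norm] at this
    obtain ⟨y, hy⟩ := cauchySeq_tendsto_of_complete this
    refine ⟨j y, hspan' y, ?_⟩
    rw [tendsto_iff_norm_sub_tendsto_zero] at hy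
    simpa only [← he, ← map_sub, hg] using hy

end Completant

section Lift

variable {V : Type*} {W : Type*} [AddCommGroup V] [Module ℂ V] [Bornology V]
  [AddCommGroup W] [Module ℂ W] [Bornology W]

lemma eq_zero_of_forall_mem_smul {X : Type*} [AddCommGroup X] [Module ℂ X] [Bornology X]
    [CompleteBornological X] {B : Set X} (hB : IsBounded B) {x : X}
    (h : ∀ ε : ℝ, 0 < ε → x ∈ ε • B) : x = 0 := by
  obtain ⟨D, hBD, -, hD⟩ := CompleteBornological.exists_disk B hB
  have hx : x ∈ D := hBD (by simpa using h 1 one_pos)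
  refine hD.eq_zero x (Submodule.subset_span hx) (le_antisymm ?_ (gauge_nonneg x))
  refine le_of_forall_pos_le_add fun ε hε => ?_
  rw [zero_add]
  exact gauge_le_of_mem hε.le (Set.smul_set_mono hBD (h ε hε))

/-- `x` is the bornological sum of the series `∑ σ (c p) • f p`. -/
def IsBornSum {X : Type*} [AddCommGroup X] [Module ℂ X] [Bornology X] (σ : ℂ →+* ℂ)
    (f : V × W → X) (c : preTensor V W) (x : X) : Prop :=
  ∃ B : Set X, IsBounded B ∧ ∀ ε : ℝ, 0 < ε → ∃ F₀ : Finset (V × W), ∀ F, F₀ ⊆ F →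
    x - ∑ p ∈ F, σ (c.1 p) • f p ∈ ε • B

lemma IsBornSum.unique {X : Type*} [AddCommGroup X] [Module ℂ X] [Bornology X]
    [CompleteBornological X] {σ : ℂ →+* ℂ} {f : V × W → X} {c : preTensor V W} {x y : X}
    (hx : IsBornSum σ f c x) (hy : IsBornSum σ f c y) : x = y := by
  classical
  obtain ⟨B, hB, h⟩ := hx
  obtain ⟨B', hB', h'⟩ := hy
  rw [← sub_eq_zero]
  have hneg : IsBounded (B + (-1 : ℂ) • B') := CompleteBornological.isBounded_add _ _ hB
    (CompleteBornological.isBounded_smul _ _ hB')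
  refine eq_zero_of_forall_mem_smul hneg fun ε hε => ?_
  obtain ⟨F, hF⟩ := h ε hε
  obtain ⟨F', hF'⟩ := h' ε hε
  obtain ⟨b, hb, hb'⟩ := hF (F ∪ F') Finset.subset_union_left
  obtain ⟨d, hd, hd'⟩ := hF' (F ∪ F') Finset.subset_union_right
  refine ⟨b + (-1 : ℂ) • d, Set.add_mem_add hb ⟨d, hd, rfl⟩, ?_⟩
  simp only at hb' hd' ⊢
  rw [smul_add, smul_comm, hb', hd']
  simp

lemma IsBornSum.add {X : Type*} [AddCommGroup X] [Module ℂ X] [Bornology X]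
    [CompleteBornological X] {σ : ℂ →+* ℂ} {f : V × W → X} {c d : preTensor V W} {x y : X}
    (hx : IsBornSum σ f c x) (hy : IsBornSum σ f d y) : IsBornSum σ f (c + d) (x + y) := by
  classical
  obtain ⟨B, hB, h⟩ := hx
  obtain ⟨B', hB', h'⟩ := hy
  refine ⟨B + B', CompleteBornological.isBounded_add _ _ hB hB', fun ε hε => ?_⟩
  obtain ⟨F, hF⟩ := h ε hε
  obtain ⟨F', hF'⟩ := h' ε hε
  refine ⟨F ∪ F', fun G hG => ?_⟩
  obtain ⟨b, hb, hb'⟩ := hF G (Finset.subset_union_left.trans hG)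
  obtain ⟨d, hd, hd'⟩ := hF' G (Finset.subset_union_right.trans hG)
  refine ⟨b + d, Set.add_mem_add hb hd, ?_⟩
  simp only at hb' hd' ⊢
  rw [smul_add, hb', hd']
  simp [add_smul, Finset.sum_add_distrib]
  abel

lemma IsBornSum.smul {X : Type*} [AddCommGroup X] [Module ℂ X] [Bornology X]
    [CompleteBornological X] {σ : ℂ →+* ℂ} {f : V × W → X} {c : preTensor V W} {x : X}
    (z : ℂ) (hx : IsBornSum σ f c x) : IsBornSum σ f (z • c) (σ z • x) := by
  obtain ⟨B, hB, h⟩ := hx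
  refine ⟨σ z • B, CompleteBornological.isBounded_smul _ _ hB, fun ε hε => ?_⟩
  obtain ⟨F, hF⟩ := h ε hε
  refine ⟨F, fun G hG => ?_⟩
  obtain ⟨b, hb, hb'⟩ := hF G hG
  refine ⟨σ z • b, ⟨b, hb, rfl⟩, ?_⟩
  simp only at hb' ⊢
  rw [smul_comm, hb', smul_sub, Finset.smul_sum]
  simp [smul_smul]

/-- Existence of the sums, with a uniform bound. -/
lemma exists_isBornSum {X : Type*} [AddCommGroup X] [Module ℂ X] [Bornology X]
    [CompleteBornological X] {σ : ℂ →+* ℂ} [RingHomIsometric σ] {f : V × W → X}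
    {s : Set V} {t : Set W} (hf : IsBounded (f '' (s ×ˢ t))) :
    ∃ B : Set X, IsBounded B ∧ ∀ c : preTensor V W, SuppIn s t c.1 →
      ∃ x, IsBornSum σ f c x ∧ ∀ r : ℝ, 0 < r → l1norm c < r → x ∈ r • B := by
  classical
  obtain ⟨D, hfD, hDb, hD⟩ := CompleteBornological.exists_disk (f '' (s ×ˢ t) ∪ {0})
    (hf.union isBounded_singleton)
  have hD0 : D.Nonempty := ⟨0, hfD (Or.inr rfl)⟩
  obtain ⟨E, _, _, _, j, hj, hj1, hj2⟩ := hD.exists_banach' hD0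
  have : ∀ p : V × W, ∃ e : E, ‖e‖ ≤ 1 ∧ (p.1 ∈ s ∧ p.2 ∈ t → j e = f p) := by
    intro p
    by_cases hp : p.1 ∈ s ∧ p.2 ∈ t
    · obtain ⟨e, he, he'⟩ := hj1 (f p) (hfD (Or.inl ⟨p, hp, rfl⟩))
      exact ⟨e, he', fun _ => he⟩
    · exact ⟨0, by simp, fun h => absurd h hp⟩
  choose e he hef using this
  refine ⟨D, hDb, fun c hc => ?_⟩
  have hnorm : ∀ p, ‖σ (c.1 p) • e p‖ ≤ ‖c.1 p‖ := by
    intro p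
    rw [norm_smul, RingHomIsometric.norm_map]
    exact mul_le_of_le_one_right (norm_nonneg _) (he p)
  have hsum : Summable (fun p => σ (c.1 p) • e p) :=
    Summable.of_norm_bounded c.2.1 hnorm
  have hterm : ∀ p, j (σ (c.1 p) • e p) = σ (c.1 p) • f p := by
    intro p
    by_cases hp : c.1 p = 0
    · simp [hp]
    · rw [map_smul, hef p (hc p hp)]
  have key : ∀ (a : E) (r : ℝ), 0 < r → ‖a‖ < r → j a ∈ r • D := by
    intro a r hr har
    refine ⟨j (r⁻¹ • a), hj2 ⟨_, ?_, rfl⟩, ?_⟩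
    · rw [mem_ball_zero_iff, norm_smul, norm_inv, Real.norm_of_nonneg hr.le,
        inv_mul_lt_iff₀ hr]
      simpa using har
    · change r • j (r⁻¹ • a) = j a
      rw [← Complex.coe_smul, ← map_smul, Complex.coe_smul, smul_smul, mul_inv_cancel₀ hr.ne',
        one_smul]
  refine ⟨j (∑' p, σ (c.1 p) • e p), ⟨D, hDb, fun ε hε => ?_⟩, fun r hr hcr => ?_⟩
  · have := hsum.hasSum
    rw [HasSum, SummationFilter.unconditional_filter, Metric.tendsto_atTop] at this
    obtain ⟨F, hF⟩ := this ε hε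
    refine ⟨F, fun G hG => ?_⟩
    have h1 := hF G hG
    rw [dist_comm, dist_eq_norm] at h1
    have h2 := key _ ε hε h1
    rw [map_sub, map_sum] at h2
    simpa only [hterm] using h2
  · refine key _ r hr (lt_of_le_of_lt ?_ hcr)
    exact tsum_of_norm_bounded c.2.1.hasSum hnorm

/-- The universal property of the completed tensor product: existence. -/
theorem exists_lift {X : Type*} [AddCommGroup X] [Module ℂ X] [Bornology X]
    [CompleteBornological X] (σ : ℂ →+* ℂ) [RingHomIsometric σ] (f : V →ₛₗ[σ] W →ₛₗ[σ] X)
    (hf : IsBoundedMap₂ (fun v w => f v w)) :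
    ∃ F : CTensor V W →ₛₗ[σ] X, IsBoundedMap F ∧ ∀ v w, F (ctmul v w) = f v w := by
  classical
  let g : V × W → X := fun p => f p.1 p.2
  have hg : ∀ s t, IsBounded s → IsBounded t → IsBounded (g '' (s ×ˢ t)) := by
    intro s t hs ht
    have := hf s t hs ht
    rwa [← Set.image_prod] at this
  have hex : ∀ c : preTensor V W, ∃ x, IsBornSum σ g c x := by
    intro c
    obtain ⟨-, s, t, hs, ht, hst⟩ := c.2
    obtain ⟨B, -, h⟩ := exists_isBornSum (σ := σ) (hg s t hs ht)
    obtain ⟨x, hx, -⟩ := h c hst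
    exact ⟨x, hx⟩
  choose L hL using hex
  let Lm : preTensor V W →ₛₗ[σ] X :=
    { toFun := L
      map_add' := fun c d => (hL (c + d)).unique ((hL c).add (hL d))
      map_smul' := fun z c => (hL (z • c)).unique ((hL c).smul z) }
  have hbd : ∀ s t, IsBounded s → IsBounded t → ∃ B : Set X, IsBounded B ∧
      ∀ c : preTensor V W, SuppIn s t c.1 → ∀ r : ℝ, 0 < r → l1norm c < r → L c ∈ r • B := by
    intro s t hs ht
    obtain ⟨B, hB, h⟩ := exists_isBornSum (σ := σ) (hg s t hs ht)
    refine ⟨B, hB, fun c hc r hr hcr => ?_⟩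
    obtain ⟨x, hx, hx'⟩ := h c hc
    rw [(hL c).unique hx]
    exact hx' r hr hcr
  have hsingle : ∀ v w, Lm (preTmul v w) = f v w := by
    intro v w
    refine (hL _).unique ⟨{0}, isBounded_singleton, fun ε hε => ⟨{(v, w)}, fun F hF => ?_⟩⟩
    have hmem : (v, w) ∈ F := hF (Finset.mem_singleton_self _)
    have : ∑ p ∈ F, σ ((preTmul v w : preTensor V W).1 p) • g p = f v w := by
      rw [Finset.sum_eq_single (v, w)]
      · simp [preTmul, g]
      · intro p _ hp
        simp [preTmul, Pi.single_eq_of_ne hp]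
      · intro h
        exact absurd hmem h
    rw [this, sub_self]
    exact ⟨0, rfl, by simp⟩
  have hker : tensorKer V W ≤ LinearMap.ker Lm := by
    refine sInf_le ⟨?_, ?_⟩
    · rintro c (⟨v, v', w, rfl⟩ | ⟨v, w, w', rfl⟩ | ⟨z, v, w, rfl⟩ | ⟨z, v, w, rfl⟩)
      all_goals
        change Lm _ = 0
        simp [hsingle]
    · intro c d s t hs ht hcN hcs hds hlim
      obtain ⟨B, hB, h⟩ := hbd s t hs ht
      change Lm d = 0
      have hneg : IsBounded ((-1 : ℂ) • B) := CompleteBornological.isBounded_smul _ _ hB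
      refine eq_zero_of_forall_mem_smul hneg fun ε hε => ?_
      obtain ⟨n, hn⟩ := ((hlim.eventually (gt_mem_nhds hε))).exists
      have hsupp : SuppIn s t (c n - d).1 := by
        intro p hp
        by_cases hc : (c n).1 p = 0
        · refine hds p fun hd => hp ?_
          change (c n).1 p - d.1 p = 0
          rw [hc, hd, sub_zero]
        · exact hcs n p hc
      obtain ⟨b, hb, hb'⟩ := h (c n - d) hsupp ε hε hn
      refine ⟨(-1 : ℂ) • b, ⟨b, hb, rfl⟩, ?_⟩
      have hL0 : Lm (c n - d) = - Lm d := by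
        rw [map_sub, show Lm (c n) = 0 from hcN n, zero_sub]
      change ε • b = Lm (c n - d) at hb'
      change ε • (-1 : ℂ) • b = Lm d
      rw [smul_comm, hb', hL0]
      simp
  refine ⟨(tensorKer V W).liftQ Lm hker, ?_, fun v w => hsingle v w⟩
  intro S hS
  obtain ⟨s, t, r, hs, ht, hS⟩ := (CTensor.isBounded_iff V W).1 hS
  obtain ⟨B, hB, h⟩ := hbd s t hs ht
  refine (CompleteBornological.isBounded_smul ((|r| + 1 : ℝ) : ℂ) B hB).subset ?_
  rintro _ ⟨y, hy, rfl⟩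
  obtain ⟨c, ⟨hc, hcr⟩, rfl⟩ := hS hy
  have := h c hc (|r| + 1) (by positivity) (by linarith [le_abs_self r])
  obtain ⟨b, hb, hb'⟩ := this
  refine ⟨b, hb, ?_⟩
  simp only [Complex.coe_smul]
  exact hb'

/-- The universal property of the completed tensor product: uniqueness. -/
theorem lift_unique {X : Type*} [AddCommGroup X] [Module ℂ X] [Bornology X]
    [CompleteBornological X] (σ : ℂ →+* ℂ) [RingHomIsometric σ] (F G : CTensor V W →ₛₗ[σ] X)
    (hF : IsBoundedMap F) (hG : IsBoundedMap G) (h : ∀ v w, F (ctmul v w) = G (ctmul v w)) :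
    F = G := by
  classical
  have key : ∀ H : CTensor V W →ₛₗ[σ] X, IsBoundedMap H → ∀ c : preTensor V W,
      IsBornSum σ (fun p => H (ctmul p.1 p.2)) c (H (CTensor.mkQ V W c)) := by
    intro H hH c
    obtain ⟨hsum, s, t, hs, ht, hst⟩ := c.2
    refine ⟨H '' tensorDisk s t 1, hH _ ((CTensor.isBounded_iff V W).2 ⟨s, t, 1, hs, ht, subset_rfl⟩),
      fun ε hε => ?_⟩
    have := hsum.hasSum
    rw [HasSum, SummationFilter.unconditional_filter, Metric.tendsto_atTop] at this
    obtain ⟨F₀, hF₀⟩ := this ε hε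
    refine ⟨F₀, fun F hF => ?_⟩
    let d : preTensor V W := c - ∑ p ∈ F, c.1 p • preTmul p.1 p.2
    have hd : ∀ p, d.1 p = if p ∈ F then 0 else c.1 p := by
      intro p
      have : (∑ q ∈ F, c.1 q • (preTmul q.1 q.2 : preTensor V W)).1 p =
          if p ∈ F then c.1 p else 0 := by
        rw [Submodule.coe_sum, Finset.sum_apply]
        simp [preTmul, Pi.single_apply]
      change c.1 p - _ = _
      rw [this]
      split_ifs <;> simp
    have hds : SuppIn s t d.1 := by
      intro p hp
      rw [hd] at hp
      refine hst p ?_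
      split_ifs at hp <;> simp_all
    have hd1 : l1norm d ≤ ε := by
      have h1 := hF₀ F hF
      have h2 : (∑ p ∈ F, ‖c.1 p‖) + ∑' p, ‖d.1 p‖ = ∑' p, ‖c.1 p‖ := by
        have h3 : ∑ p ∈ F, ‖c.1 p‖ = ∑' p, if p ∈ F then ‖c.1 p‖ else 0 := by
          rw [tsum_eq_sum (s := F) (by intro b hb; simp [hb])]
          exact Finset.sum_congr rfl (by intro b hb; simp [hb])
        rw [h3, ← Summable.tsum_add]
        · congr 1
          ext p
          rw [hd]
          split_ifs <;> simp
        · exact summable_of_ne_finset_zero (s := F) (by intro b hb; simp [hb])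
        · exact d.2.1
      rw [Real.dist_eq, abs_lt] at h1
      change ∑' p, ‖d.1 p‖ ≤ ε
      linarith [h1.1]
    have hεc : ((ε : ℝ) : ℂ) ≠ 0 := by exact_mod_cast hε.ne'
    refine ⟨H (CTensor.mkQ V W (((ε : ℝ) : ℂ)⁻¹ • d)), ⟨_, ⟨_, ⟨?_, ?_⟩, rfl⟩, rfl⟩, ?_⟩
    · intro p hp
      refine hds p fun h0 => hp ?_
      change _ * d.1 p = 0
      rw [h0, mul_zero]
    · change ∑' p, ‖((ε : ℝ) : ℂ)⁻¹ * d.1 p‖ ≤ 1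
      simp only [norm_mul]
      rw [tsum_mul_left, norm_inv, Complex.norm_real, Real.norm_of_nonneg hε.le]
      rw [inv_mul_le_iff₀ hε]
      rw [mul_one]
      exact hd1
    · change ε • H (CTensor.mkQ V W (((ε : ℝ) : ℂ)⁻¹ • d)) = _
      have hσ : Continuous σ :=
        (AddMonoidHomClass.isometry_of_norm σ fun z => RingHomIsometric.norm_map).continuous
      have hσε : σ ((ε : ℝ) : ℂ) = ((ε : ℝ) : ℂ) := by
        rcases Complex.ringHom_eq_id_or_conj_of_continuous hσ with h | h
        · rw [h, RingHom.id_apply]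
        · rw [h, Complex.conj_ofReal]
      rw [map_smul, map_smulₛₗ, map_inv₀, hσε, ← Complex.coe_smul, smul_smul,
        mul_inv_cancel₀ hεc, one_smul, map_sub, map_sub, map_sum, map_sum]
      simp only [map_smul, map_smulₛₗ]
      rfl
  ext x
  obtain ⟨c, rfl⟩ := Submodule.mkQ_surjective _ x
  have h1 := key F hF c
  have h2 := key G hG c
  simp only [h] at h1
  exact h1.unique h2

end Lift

section TensorComplete

variable {V : Type*} {W : Type*} [AddCommGroup V] [Module ℂ V] [Bornology V]
  [AddCommGroup W] [Module ℂ W] [Bornology W]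

lemma l1norm_add_le (c d : preTensor V W) : l1norm (c + d) ≤ l1norm c + l1norm d := by
  have h := c.2.1.add d.2.1
  refine (Summable.tsum_le_tsum (fun p => norm_add_le (c.1 p) (d.1 p)) (c + d).2.1 h).trans ?_
  exact (Summable.tsum_add c.2.1 d.2.1).le

lemma l1norm_smul (z : ℂ) (c : preTensor V W) : l1norm (z • c) = ‖z‖ * l1norm c := by
  change ∑' p, ‖z * c.1 p‖ = _
  simp only [norm_mul]
  exact tsum_mul_left

lemma tensorKer_isBornClosed : IsBornClosed (tensorKer V W) := by
  intro c d s t hs ht hc hcs hds hlim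
  refine Submodule.mem_sInf.2 fun N hN => ?_
  exact hN.2 c d s t hs ht (fun n => Submodule.mem_sInf.1 (hc n) N hN) hcs hds hlim

/-- The image of a ball of a Banach space under a linear map with closed kernel is a completant
disk, up to a factor between `1` and `2`. -/
lemma exists_completantDisk_of_map {X : Type*} [AddCommGroup X] [Module ℂ X]
    {M : Type*} [NormedAddCommGroup M] [NormedSpace ℂ M] [CompleteSpace M]
    (π : M →ₗ[ℂ] X) (hker : IsClosed (LinearMap.ker π : Set M)) {r : ℝ} (hr : 0 < r) :
    ∃ D, IsCompletantDisk D ∧ (∀ f, ‖f‖ ≤ r → π f ∈ D) ∧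
      ∀ x ∈ D, ∃ f, ‖f‖ ≤ r * 2 ∧ π f = x := by
  have := hker
  let j : (M ⧸ LinearMap.ker π) →ₗ[ℂ] X := (LinearMap.ker π).liftQ π le_rfl
  have hj : Function.Injective j := by
    rw [← LinearMap.ker_eq_bot]
    exact Submodule.ker_liftQ_eq_bot _ _ _ le_rfl
  let k : (M ⧸ LinearMap.ker π) →ₗ[ℂ] X := (r : ℂ) • j
  have hr0 : (r : ℂ) ≠ 0 := by exact_mod_cast hr.ne'
  have hk : Function.Injective k := by
    intro x y hxy
    exact hj (smul_right_injective _ hr0 hxy)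
  refine ⟨k '' Metric.closedBall 0 1, IsCompletantDisk.of_banach k hk, ?_, ?_⟩
  · intro f hf
    refine ⟨Submodule.Quotient.mk ((r : ℂ)⁻¹ • f), ?_, ?_⟩
    · rw [mem_closedBall_zero_iff]
      refine (Submodule.Quotient.norm_mk_le _ _).trans ?_
      rw [norm_smul, norm_inv, Complex.norm_real, Real.norm_of_nonneg hr.le,
        inv_mul_le_iff₀ hr, mul_one]
      exact hf
    · change (r : ℂ) • π ((r : ℂ)⁻¹ • f) = _
      rw [map_smul, smul_smul, mul_inv_cancel₀ hr0, one_smul]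
  · rintro _ ⟨x, hx, rfl⟩
    rw [mem_closedBall_zero_iff] at hx
    obtain ⟨f, hf, hfn⟩ := Submodule.Quotient.norm_mk_lt (S := LinearMap.ker π) x one_pos
    refine ⟨(r : ℂ) • f, ?_, ?_⟩
    · rw [norm_smul, Complex.norm_real, Real.norm_of_nonneg hr.le]
      gcongr
      linarith
    · rw [← hf]
      change π _ = (r : ℂ) • π f
      rw [map_smul]

/-- Every bounded set is contained in a bounded completant disk. -/
lemma exists_tensorDisk {s : Set V} {t : Set W} (hs : IsBounded s) (ht : IsBounded t) (r : ℝ) :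
    ∃ D, tensorDisk s t r ⊆ D ∧ IsBounded D ∧ IsCompletantDisk D := by
  classical
  let M : Submodule ℂ (lp (fun _ : V × W => ℂ) 1) :=
    { carrier := {f | ∀ p, ¬ (p.1 ∈ s ∧ p.2 ∈ t) → f p = 0}
      zero_mem' := fun p _ => rfl
      add_mem' := fun {f g} hf hg p hp => by
        rw [lp.coeFn_add, Pi.add_apply, hf p hp, hg p hp, add_zero]
      smul_mem' := fun z f hf p hp => by
        rw [lp.coeFn_smul, Pi.smul_apply, hf p hp, smul_zero] }
  have hMc : IsClosed (M : Set (lp (fun _ : V × W => ℂ) 1)) := by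
    have : (M : Set (lp (fun _ : V × W => ℂ) 1)) =
        ⋂ p : V × W, ⋂ _ : ¬ (p.1 ∈ s ∧ p.2 ∈ t), {f | f p = 0} := by
      ext f
      simp only [Set.mem_iInter]
      rfl
    rw [this]
    refine isClosed_iInter fun p => isClosed_iInter fun _ => ?_
    refine isClosed_eq ?_ continuous_const
    refine LipschitzWith.continuous (K := 1) (LipschitzWith.of_dist_le_mul fun f g => ?_)
    rw [dist_eq_norm, dist_eq_norm, NNReal.coe_one, one_mul]
    exact lp.norm_apply_le_norm one_ne_zero (f - g) p
  have : CompleteSpace M := hMc.completeSpace_coe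
  have hsum : ∀ f : lp (fun _ : V × W => ℂ) 1, Summable fun p => ‖f p‖ := by
    intro f
    have := (memℓp_gen_iff (p := 1) (by simp)).1 (lp.memℓp f)
    simpa using this
  have hnorm : ∀ f : lp (fun _ : V × W => ℂ) 1, ‖f‖ = ∑' p, ‖f p‖ := by
    intro f
    rw [lp.norm_eq_tsum_rpow (by simp)]
    simp
  let ι : M →ₗ[ℂ] preTensor V W :=
    { toFun := fun f => ⟨fun p => f.1 p, hsum f.1, s, t, hs, ht, fun p hp => by
        by_contra h
        exact hp (f.2 p h)⟩
      map_add' := fun f g => rfl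
      map_smul' := fun z f => rfl }
  have hιs : ∀ f, SuppIn s t (ι f).1 := fun f p hp => by
    by_contra h
    exact hp (f.2 p h)
  have hιn : ∀ f, l1norm (ι f) = ‖f‖ := fun f => (hnorm f.1).symm
  have hιe : ∀ c : preTensor V W, SuppIn s t c.1 → ∃ f, ι f = c := by
    intro c hc
    refine ⟨⟨⟨c.1, memℓp_gen (by simpa using c.2.1)⟩, fun p hp => ?_⟩, rfl⟩
    by_contra h
    exact hp (hc p h)
  let π : M →ₗ[ℂ] CTensor V W := (CTensor.mkQ V W).comp ι
  have hker : IsClosed (LinearMap.ker π : Set M) := by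
    refine IsSeqClosed.isClosed fun f g hf hg => ?_
    have hmem : ∀ h : M, h ∈ LinearMap.ker π ↔ ι h ∈ tensorKer V W := fun h =>
      Submodule.Quotient.mk_eq_zero _
    refine (hmem g).2 (tensorKer_isBornClosed (fun n => ι (f n)) (ι g) s t hs ht
      (fun n => (hmem _).1 (hf n)) (fun n => hιs _) (hιs g) ?_)
    simp only [← map_sub, hιn]
    exact tendsto_iff_norm_sub_tendsto_zero.1 hg
  obtain ⟨D, hD, hD1, hD2⟩ :=
    exists_completantDisk_of_map π hker (r := |r| + 1) (by positivity)
  refine ⟨D, ?_, (CTensor.isBounded_iff V W).2 ⟨s, t, (|r| + 1) * 2, hs, ht, ?_⟩, hD⟩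
  · rintro _ ⟨c, ⟨hc, hcr⟩, rfl⟩
    obtain ⟨f, rfl⟩ := hιe c hc
    refine hD1 f ?_
    rw [← hιn]
    linarith [le_abs_self r]
  · intro x hx
    obtain ⟨f, hf, rfl⟩ := hD2 x hx
    exact ⟨ι f, ⟨hιs f, (hιn f).trans_le hf⟩, rfl⟩

instance : CompleteBornological (CTensor V W) where
  isBounded_add := by
    intro S T hS hT
    obtain ⟨s, t, r, hs, ht, h⟩ := (CTensor.isBounded_iff V W).1 hS
    obtain ⟨s', t', r', hs', ht', h'⟩ := (CTensor.isBounded_iff V W).1 hT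
    refine (CTensor.isBounded_iff V W).2
      ⟨s ∪ s', t ∪ t', r + r', hs.union hs', ht.union ht', ?_⟩
    rintro _ ⟨x, hx, y, hy, rfl⟩
    obtain ⟨c, ⟨hc, hcr⟩, rfl⟩ := h hx
    obtain ⟨d, ⟨hd, hdr⟩, rfl⟩ := h' hy
    refine ⟨c + d, ⟨?_, (l1norm_add_le c d).trans (add_le_add hcr hdr)⟩, map_add _ _ _⟩
    intro p hp
    by_cases h0 : c.1 p = 0
    · have h1 : d.1 p ≠ 0 := by
        intro h1
        refine hp ?_
        change c.1 p + d.1 p = 0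
        rw [h0, h1, add_zero]
      exact ⟨Or.inr (hd p h1).1, Or.inr (hd p h1).2⟩
    · exact ⟨Or.inl (hc p h0).1, Or.inl (hc p h0).2⟩
  isBounded_smul := by
    intro z S hS
    obtain ⟨s, t, r, hs, ht, h⟩ := (CTensor.isBounded_iff V W).1 hS
    refine (CTensor.isBounded_iff V W).2 ⟨s, t, ‖z‖ * r, hs, ht, ?_⟩
    rintro _ ⟨x, hx, rfl⟩
    obtain ⟨c, ⟨hc, hcr⟩, rfl⟩ := h hx
    refine ⟨z • c, ⟨?_, ?_⟩, map_smul _ _ _⟩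
    · intro p hp
      refine hc p fun h0 => hp ?_
      change z * c.1 p = 0
      rw [h0, mul_zero]
    · rw [l1norm_smul]
      gcongr
  isBounded_hull := by
    intro S hS
    obtain ⟨s, t, r, hs, ht, h⟩ := (CTensor.isBounded_iff V W).1 hS
    obtain ⟨D, hD, hDb, hDc⟩ := exists_tensorDisk hs ht r
    refine hDb.subset (convexHull_min ?_ hDc.convex)
    exact hDc.balanced.balancedHull_subset_of_subset (h.trans hD)
  exists_disk := by
    intro S hS
    obtain ⟨s, t, r, hs, ht, h⟩ := (CTensor.isBounded_iff V W).1 hS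
    obtain ⟨D, hD, hDb, hDc⟩ := exists_tensorDisk hs ht r
    exact ⟨D, h.trans hD, hDb, hDc⟩

end TensorComplete

section LiftDef

variable {V : Type*} {W : Type*} [AddCommGroup V] [Module ℂ V] [Bornology V]
  [AddCommGroup W] [Module ℂ W] [Bornology W]
  {X : Type*} [AddCommGroup X] [Module ℂ X] [Bornology X]

open Classical in
/-- The `σ`-semilinear bounded map `V ⊗ W → X` with `v ⊗ w ↦ f v w`, for a bounded
`σ`-semibilinear map `f` into a complete space `X`. -/
noncomputable def liftₛₗ (σ : ℂ →+* ℂ) (f : V → W → X) : CTensor V W →ₛₗ[σ] X :=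
  if h : ∃ F : CTensor V W →ₛₗ[σ] X, IsBoundedMap F ∧ ∀ v w, F (ctmul v w) = f v w then h.choose
  else 0

/-- The bounded linear map `V ⊗ W → X` with `v ⊗ w ↦ f v w`. -/
noncomputable def lift (f : V → W → X) : CTensor V W →ₗ[ℂ] X := liftₛₗ (RingHom.id ℂ) f

/-- `liftₛₗ` has the defining property of the completed tensor product. -/
theorem liftₛₗ_spec [CompleteBornological X] (σ : ℂ →+* ℂ) [RingHomIsometric σ]
    (f : V →ₛₗ[σ] W →ₛₗ[σ] X) (hf : IsBoundedMap₂ (fun v w => f v w)) :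
    IsBoundedMap (liftₛₗ σ fun v w => f v w) ∧
      ∀ v w, liftₛₗ σ (fun v w => f v w) (ctmul v w) = f v w := by
  have h := exists_lift σ f hf
  rw [liftₛₗ, dif_pos h]
  exact h.choose_spec

/-- `lift` has the defining property of the completed tensor product. -/
theorem lift_spec [CompleteBornological X] (f : V →ₗ[ℂ] W →ₗ[ℂ] X)
    (hf : IsBoundedMap₂ (fun v w => f v w)) :
    IsBoundedMap (lift fun v w => f v w) ∧ ∀ v w, lift (fun v w => f v w) (ctmul v w) = f v w :=
  liftₛₗ_spec (RingHom.id ℂ) f hf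

end LiftDef

/-! ## Bornological `*`-algebras and multipliers -/

section Algebra

/-- A multiplier: a pair of bounded maps `b ↦ c b` and `b ↦ b c`. -/
structure Multiplier (B : Type*) [AddCommGroup B] [Module ℂ B] [Bornology B] [Mul B] where
  left : B →ₗ[ℂ] B
  right : B →ₗ[ℂ] B
  bounded_left : IsBoundedMap left
  bounded_right : IsBoundedMap right
  left_mul : ∀ a b, left (a * b) = left a * b
  right_mul : ∀ a b, right (a * b) = a * right b
  right_mul_eq : ∀ a b, right a * b = a * left b

/-- A module with action `act` is essential: every bounded set is the image of a bounded set under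
the linearized action `A ⊗ V → V`. -/
def IsEssentialAction {A V : Type*} [AddCommGroup A] [Module ℂ A] [Bornology A]
    [AddCommGroup V] [Module ℂ V] [Bornology V] (act : A → V → V) : Prop :=
  ∀ B : Set V, IsBounded B → ∃ C : Set (CTensor A V), IsBounded C ∧ lift act '' C = B

variable {A : Type*} [NonUnitalRing A] [Module ℂ A] [IsScalarTower ℂ A A] [SMulCommClass ℂ A A]
  [StarRing A] [StarModule ℂ A] [Bornology A]

/-- The product of `A ⊗ A`, with `(a ⊗ b) (c ⊗ d) = a c ⊗ b d`. -/
noncomputable instance : Mul (CTensor A A) where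
  mul s t := lift (fun a b => lift (fun c d => ctmul (a * c) (b * d)) t) s

/-- The involution of `A ⊗ A`, with `a ⊗ b ↦ star a ⊗ star b`. -/
noncomputable def starT : CTensor A A →ₛₗ[starRingEnd ℂ] CTensor A A :=
  liftₛₗ (starRingEnd ℂ) fun a b => ctmul (star a) (star b)

/-- `(b ⊗ 1) u`. -/
noncomputable def mulLeft₁ (b : A) (u : CTensor A A) : CTensor A A :=
  lift (fun x y => ctmul (b * x) y) u

/-- `(1 ⊗ b) u`. -/
noncomputable def mulLeft₂ (b : A) (u : CTensor A A) : CTensor A A :=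
  lift (fun x y => ctmul x (b * y)) u

/-- `u (b ⊗ 1)`. -/
noncomputable def mulRight₁ (u : CTensor A A) (b : A) : CTensor A A :=
  lift (fun x y => ctmul (x * b) y) u

/-- `u (1 ⊗ b)`. -/
noncomputable def mulRight₂ (u : CTensor A A) (b : A) : CTensor A A :=
  lift (fun x y => ctmul x (y * b)) u

end Algebra

/-! ## Bornological quantum groups -/

/-- A bornological quantum group (with involution), given by the algebra `A` of functions on it,
the coproduct `comul : A → M(A ⊗ A)`, the left invariant integral `haar`, the counit and the
antipode. -/
structure BornologicalQuantumGroup (A : Type*) [NonUnitalRing A] [Module ℂ A]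
    [IsScalarTower ℂ A A] [SMulCommClass ℂ A A] [StarRing A] [StarModule ℂ A] [Bornology A]
    [CompleteBornological A] where
  /- `A` is an essential bornological `*`-algebra with the approximation property. -/
  approximation : HasApproximationProperty A
  bounded_mul : IsBoundedMap₂ fun a b : A => a * b
  bounded_star : IsBoundedMap fun a : A => star a
  essential : IsEssentialAction fun a b : A => a * b
  /- The coproduct is an essential bounded `*`-homomorphism into the multipliers. -/
  comul : A → Multiplier (CTensor A A)
  comul_linear_left : IsLinearMap ℂ fun a => (comul a).left
  comul_linear_right : IsLinearMap ℂ fun a => (comul a).right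
  comul_bounded_left : IsBoundedMap₂ fun a u => (comul a).left u
  comul_bounded_right : IsBoundedMap₂ fun a u => (comul a).right u
  comul_mul_left : ∀ a b u, (comul (a * b)).left u = (comul a).left ((comul b).left u)
  comul_mul_right : ∀ a b u, (comul (a * b)).right u = (comul b).right ((comul a).right u)
  comul_star_left : ∀ a u, (comul (star a)).left u = starT ((comul a).right (starT u))
  comul_star_right : ∀ a u, (comul (star a)).right u = starT ((comul a).left (starT u))
  comul_essential : IsEssentialAction fun a u => (comul a).left u
  /- The Galois maps `a ⊗ b ↦ Δ(a) (b ⊗ 1)` and `a ⊗ b ↦ (1 ⊗ a) Δ(b)` are bounded linear maps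
  from `A ⊗ A` to itself; the two equations for each of them say that the given element of `A ⊗ A`
  is the given multiplier. -/
  galoisL : CTensor A A →ₗ[ℂ] CTensor A A
  galoisL_bounded : IsBoundedMap galoisL
  galoisL_mul : ∀ a b u, galoisL (ctmul a b) * u = (comul a).left (mulLeft₁ b u)
  mul_galoisL : ∀ a b u, u * galoisL (ctmul a b) = mulRight₁ ((comul a).right u) b
  galoisR : CTensor A A →ₗ[ℂ] CTensor A A
  galoisR_bounded : IsBoundedMap galoisR
  galoisR_mul : ∀ a b u, galoisR (ctmul a b) * u = mulLeft₂ a ((comul b).left u)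
  mul_galoisR : ∀ a b u, u * galoisR (ctmul a b) = (comul b).right (mulRight₂ u a)
  /- Coassociativity: `(1 ⊗ 1 ⊗ c) (Δ ⊗ ι)(Δ(a)) (b ⊗ 1 ⊗ 1)` equals
  `(1 ⊗ 1 ⊗ c) (ι ⊗ Δ)(Δ(a)) (b ⊗ 1 ⊗ 1)`, as elements of `A ⊗ (A ⊗ A)`. -/
  coassoc : ∀ a b c,
    lift (fun x y => lift (fun p q => ctmul p (ctmul q y)) (galoisL (ctmul x b)))
        (galoisR (ctmul c a)) =
      lift (fun x y => ctmul x (galoisR (ctmul c y))) (galoisL (ctmul a b))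
  /- The integral is a positive faithful bounded linear functional with
  `(ι ⊗ φ)(Δ(a)) = φ(a) 1`. -/
  haar : A →ₗ[ℂ] ℂ
  haar_bounded : IsBoundedMap haar
  haar_nonneg : ∀ a, 0 ≤ (haar (star a * a)).re ∧ (haar (star a * a)).im = 0
  haar_faithful : ∀ a, haar (star a * a) = 0 → a = 0
  haar_left_invariant : ∀ a b, lift (fun x y => haar y • x) (galoisL (ctmul a b)) = haar a • b
  haar_left_invariant' : ∀ a b,
    lift (fun x y => haar y • x) (starT (galoisL (ctmul (star a) (star b)))) = haar a • b
  /- The counit is an essential bounded homomorphism `A → ℂ` (essential: it is nonzero) with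
  `(ε ⊗ ι)(Δ(a)) = a = (ι ⊗ ε)(Δ(a))`. -/
  counit : A →ₗ[ℂ] ℂ
  counit_bounded : IsBoundedMap counit
  counit_mul : ∀ a b, counit (a * b) = counit a * counit b
  counit_ne_zero : counit ≠ 0
  counit_left : ∀ a b, lift (fun x y => counit x • y) (galoisR (ctmul b a)) = b * a
  counit_left' : ∀ a b,
    lift (fun x y => counit x • y) (starT (galoisR (ctmul (star b) (star a)))) = a * b
  counit_right : ∀ a b, lift (fun x y => counit y • x) (galoisL (ctmul a b)) = a * b
  counit_right' : ∀ a b,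
    lift (fun x y => counit y • x) (starT (galoisL (ctmul (star a) (star b)))) = b * a
  /- The antipode is a bounded antiautomorphism of the algebra and of the coalgebra; the equation
  `antipode_comul` is `Δ(S(a)) (S(b) ⊗ 1) = flip ((S ⊗ S)((1 ⊗ b) Δ(a)))`. -/
  antipode : A ≃ₗ[ℂ] A
  antipode_bounded : IsBoundedMap antipode
  antipode_symm_bounded : IsBoundedMap antipode.symm
  antipode_mul : ∀ a b, antipode (a * b) = antipode b * antipode a
  antipode_comul : ∀ a b, galoisL (ctmul (antipode a) (antipode b)) =
    lift (fun x y => ctmul (antipode y) (antipode x)) (galoisR (ctmul b a))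
  /- `m((S ⊗ ι)(Δ(a) (1 ⊗ b))) = ε(a) b` and `m((ι ⊗ S)((a ⊗ 1) Δ(b))) = ε(b) a`. -/
  antipode_left : ∀ a b,
    lift (fun x y => antipode x * y) (starT (galoisR (ctmul (star b) (star a)))) = counit a • b
  antipode_right : ∀ a b,
    lift (fun x y => x * antipode y) (starT (galoisL (ctmul (star b) (star a)))) = counit b • a

namespace BornologicalQuantumGroup

variable {A : Type*} [NonUnitalRing A] [Module ℂ A] [IsScalarTower ℂ A A] [SMulCommClass ℂ A A]
  [StarRing A] [StarModule ℂ A] [Bornology A] [CompleteBornological A]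
  (G : BornologicalQuantumGroup A)

/-- The scaling constant is `1`. -/
def HasTrivialScaling : Prop := ∀ a, G.haar (G.antipode (G.antipode a)) = G.haar a

/-- The modular element: `(φ ⊗ ι)(Δ(a)) = φ(a) δ`, an equality of multipliers. -/
def IsModularElement (δ : Multiplier A) : Prop :=
  (∀ a b, lift (fun x y => G.haar x • y) (starT (G.galoisR (ctmul (star b) (star a)))) =
    G.haar a • δ.left b) ∧
  ∀ a b, lift (fun x y => G.haar x • y) (G.galoisR (ctmul b a)) = G.haar a • δ.right b

/-- The convolution product `f * g = (ι ⊗ φ)((1 ⊗ S⁻¹(g)) Δ(f))` of `𝒟(𝔾)`. -/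
noncomputable def conv (f g : A) : A :=
  lift (fun x y => G.haar y • x) (G.galoisR (ctmul (G.antipode.symm g) f))

/-- The convolution adjoint `f ↦ star (S f) δ` of `𝒟(𝔾)`, where `δ` is the modular element. -/
def convStar (δ : Multiplier A) (f : A) : A := δ.right (star (G.antipode f))

end BornologicalQuantumGroup

/-! ## Operator algebras -/

section Operator

variable {H : Type*} [NormedAddCommGroup H] [InnerProductSpace ℂ H] [CompleteSpace H]

/-- The ultraweak topology of `B(H)`: the coarsest topology for which the functionals
`T ↦ ∑ ⟪ξ n, T η n⟫` with `∑ ‖ξ n‖ ^ 2 < ∞` and `∑ ‖η n‖ ^ 2 < ∞` are continuous. -/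
@[reducible] noncomputable def ultraweak (H : Type*) [NormedAddCommGroup H] [InnerProductSpace ℂ H] :
    TopologicalSpace (H →L[ℂ] H) :=
  ⨅ p : {p : (ℕ → H) × (ℕ → H) //
      (Summable fun n => ‖p.1 n‖ ^ 2) ∧ Summable fun n => ‖p.2 n‖ ^ 2},
    TopologicalSpace.induced (fun T => ∑' n, inner ℂ (p.1.1 n) (T (p.1.2 n))) inferInstance

/-- The von Neumann algebra generated by a set of operators. -/
noncomputable def vnGen (s : Set (H →L[ℂ] H)) : StarSubalgebra ℂ (H →L[ℂ] H) :=
  StarSubalgebra.centralizer ℂ (StarSubalgebra.centralizer ℂ s : Set (H →L[ℂ] H))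

lemma subset_vnGen (s : Set (H →L[ℂ] H)) : s ⊆ vnGen s := by
  intro x hx
  change x ∈ StarSubalgebra.centralizer ℂ _
  rw [StarSubalgebra.mem_centralizer_iff]
  intro g hg
  have h := (StarSubalgebra.mem_centralizer_iff ℂ).1 hg x hx
  have h' := (StarSubalgebra.mem_centralizer_iff ℂ).1 (star_mem hg) x hx
  exact ⟨h.1.symm, h'.1.symm⟩

/-- The predual of a von Neumann algebra: the space of its ultraweakly continuous linear
functionals, with the norm of the dual. -/
noncomputable def predual (M : StarSubalgebra ℂ (H →L[ℂ] H)) : Submodule ℂ (StrongDual ℂ M) where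
  carrier := {ω | Continuous[(ultraweak H).induced (fun x : M => (x : H →L[ℂ] H)),
    inferInstance] fun x : M => ω x}
  zero_mem' := by
    let _ : TopologicalSpace M := (ultraweak H).induced (fun x : M => (x : H →L[ℂ] H))
    exact continuous_const
  add_mem' := by
    intro ω θ hω hθ
    let _ : TopologicalSpace M := (ultraweak H).induced (fun x : M => (x : H →L[ℂ] H))
    exact Continuous.add hω hθ
  smul_mem' := by
    intro z ω hω
    let _ : TopologicalSpace M := (ultraweak H).induced (fun x : M => (x : H →L[ℂ] H))
    exact Continuous.const_smul hω z

/-- The Hilbert space tensor product. -/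
abbrev HTensor (H : Type*) [NormedAddCommGroup H] [InnerProductSpace ℂ H] : Type _ :=
  UniformSpace.Completion (H ⊗[ℂ] H)

/-- The elementary tensor of two vectors. -/
noncomputable def htmul (ξ η : H) : HTensor H := ((ξ ⊗ₜ[ℂ] η : H ⊗[ℂ] H) : HTensor H)

/-- The operator `x ⊗ y`. -/
noncomputable def opTensor (x y : H →L[ℂ] H) : HTensor H →L[ℂ] HTensor H :=
  (TensorProduct.mapL x y).completion

/-- The von Neumann algebra tensor product of `M` with itself. -/
noncomputable def vnTensor (M : StarSubalgebra ℂ (H →L[ℂ] H)) :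
    StarSubalgebra ℂ (HTensor H →L[ℂ] HTensor H) :=
  vnGen {T | ∃ x ∈ M, ∃ y ∈ M, T = opTensor x y}

lemma opTensor_mem {M : StarSubalgebra ℂ (H →L[ℂ] H)} (x y : M) :
    opTensor (x : H →L[ℂ] H) (y : H →L[ℂ] H) ∈ vnTensor M :=
  subset_vnGen _ ⟨x, x.2, y, y.2, rfl⟩

/-- The coproduct `x ↦ W* (1 ⊗ x) W`. -/
noncomputable def comulOp (W : HTensor H →L[ℂ] HTensor H) (x : H →L[ℂ] H) :
    HTensor H →L[ℂ] HTensor H :=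
  star W * opTensor 1 x * W

/-- `θ` is the convolution product `(ω₁ ⊗ ω₂) ∘ Δ`, where `Δ x = W* (1 ⊗ x) W` and `ω₁ ⊗ ω₂` is the
ultraweakly continuous functional on the von Neumann algebra tensor product with
`x ⊗ y ↦ ω₁ x * ω₂ y`. -/
def IsConvolution (W : HTensor H →L[ℂ] HTensor H) {M : StarSubalgebra ℂ (H →L[ℂ] H)}
    (θ ω₁ ω₂ : predual M) : Prop :=
  ∃ Θ : predual (vnTensor M),
    (∀ x y : M, Θ.1 ⟨opTensor x y, opTensor_mem x y⟩ = ω₁.1 x * ω₂.1 y) ∧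
    ∀ x : M, ∃ h : comulOp W x ∈ vnTensor M, θ.1 x = Θ.1 ⟨comulOp W x, h⟩

/-- The operator `ζ ↦ ζ ⊗ η`. -/
noncomputable def tensorRight (η : H) : H →L[ℂ] HTensor H :=
  (UniformSpace.Completion.toComplL (𝕜 := ℂ) (E := H ⊗[ℂ] H)).comp
    ((TensorProduct.mkL ℂ H H).flip η)

/-- The slice `(ι ⊗ ω)(T)` with `ω = ⟪ξ, · η⟫`. -/
noncomputable def slice (ξ η : H) (T : HTensor H →L[ℂ] HTensor H) : H →L[ℂ] H :=
  (ContinuousLinearMap.adjoint (tensorRight ξ)).comp (T.comp (tensorRight η))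

/-- The graph of the antipode of the von Neumann algebra of a locally compact quantum group with
multiplicative unitary `W`: the ultraweakly closed unbounded operator that has the span of the
slices `(ι ⊗ ω)(W)` as a core and maps `(ι ⊗ ω)(W)` to `(ι ⊗ ω)(W*)`. -/
def antipodeGraph (W : HTensor H →L[ℂ] HTensor H) : Set ((H →L[ℂ] H) × (H →L[ℂ] H)) :=
  @closure _ (@instTopologicalSpaceProd _ _ (ultraweak H) (ultraweak H))
    (Submodule.span ℂ {p : (H →L[ℂ] H) × (H →L[ℂ] H) |
      ∃ ξ η : H, p = (slice ξ η W, slice ξ η (star W))} : Set _)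

/-- `ω` has the convolution adjoint `θ`: for all `x` in the domain of the antipode,
`θ x` is the complex conjugate of `ω (S(x)*)`. -/
def IsConvolutionAdjoint (W : HTensor H →L[ℂ] HTensor H) {M : StarSubalgebra ℂ (H →L[ℂ] H)}
    (θ ω : predual M) : Prop :=
  ∀ x y : M, ((x : H →L[ℂ] H), (y : H →L[ℂ] H)) ∈ antipodeGraph W →
    θ.1 x = starRingEnd ℂ (ω.1 (star y))

/-- The von Neumann algebra `L^∞(𝔾)`, generated by the regular representation. -/
noncomputable def LInfty {A : Type*} [AddCommGroup A] [Module ℂ A]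
    (m : A →ₗ[ℂ] (H →L[ℂ] H)) : StarSubalgebra ℂ (H →L[ℂ] H) := vnGen (Set.range m)

lemma mem_LInfty {A : Type*} [AddCommGroup A] [Module ℂ A]
    (m : A →ₗ[ℂ] (H →L[ℂ] H)) (a : A) : m a ∈ LInfty m :=
  subset_vnGen _ ⟨a, rfl⟩

end Operator

section GNS

variable {A : Type*} [NonUnitalRing A] [Module ℂ A] [IsScalarTower ℂ A A] [SMulCommClass ℂ A A]
  [StarRing A] [StarModule ℂ A] [Bornology A] [CompleteBornological A]
  {H : Type*} [NormedAddCommGroup H] [InnerProductSpace ℂ H] [CompleteSpace H]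

/-- A GNS pair `(H, Λ)` for the integral of a bornological quantum group. -/
structure IsGNSPair (G : BornologicalQuantumGroup A) (Λ : A →ₗ[ℂ] H) : Prop where
  denseRange : DenseRange Λ
  inner_eq : ∀ f g, inner ℂ (Λ f) (Λ g) = G.haar (star f * g)

/-- `m` is the representation of `A` by (the extensions of) the left multiplication operators. -/
def IsRegularRep (Λ : A →ₗ[ℂ] H) (m : A →ₗ[ℂ] (H →L[ℂ] H)) : Prop :=
  ∀ f g, m f (Λ g) = Λ (f * g)

/-- `W` is the multiplicative unitary: the unitary operator with
`W ((Λ ⊗ Λ)(Δ(g) (f ⊗ 1))) = Λ(f) ⊗ Λ(g)`. -/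
def IsMultiplicativeUnitary (G : BornologicalQuantumGroup A) (Λ : A →ₗ[ℂ] H)
    (W : HTensor H →L[ℂ] HTensor H) : Prop :=
  W ∈ unitary (HTensor H →L[ℂ] HTensor H) ∧
    ∀ f g, W (lift (fun a b => htmul (Λ a) (Λ b)) (G.galoisL (ctmul g f))) = htmul (Λ f) (Λ g)

end GNS

end BornQG

/-! The crucial point is that `m(a) ↦ φ(ax)` is a normal functional, and this comes from a KMS
property of `φ`: there is a bounded surjective linear map `τ` of `A` with `φ(xp) = φ(τ(p)x)`
(`exists_modular_automorphism_inv`). If `x = bp`, then `φ(abp) = φ(τ(p)ab) = ⟪Λ(τ(p)*), m(a)Λ(b)⟫`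
is a vector functional. Since `A` is essential, every bounded set of elements `x` is the image under
multiplication of a bounded set in `A ⊗ A`. Hence each `x̂` is an absolutely convergent series of
vector functionals, with a norm bound that is uniform on bounded sets. Surjectivity of `τ` makes all
functionals `⟪Λ(a), · Λ(b)⟫` occur, and their span is norm dense in the predual. Uniqueness, and
hence independence of the chosen representation of `x`, holds because normal functionals are
determined by their values on the nondegenerate `*`-algebra `m(A)` (`inner_eq_zero_of_mem_vnGen`, a
form of the density theorem).

The algebra behind this rests on strong left invariance, `S((ι ⊗ φ)(Δ(y)(1 ⊗ x))) = (ι ⊗ φ)((1 ⊗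
y)Δ(x))` (`S_sr_gRs`). It yields `S(S(a)*) = a*`, and, since `φ ∘ S` is right invariant and `φ ∘ S²
= φ`, also the modular element with `φ(zδ) = φ(Sz) = φ(δz)`, the KMS property, and `φ(a(x * y)) = (φ
⊗ φ)(Δ(a)(x ⊗ y))`. The last formula is multiplicativity of `x ↦ x̂` on `m(A)`. It extends to `L^∞`
because both sides are normal. Compatibility with the involutions is the formula `φ(u x^*) = conj
φ(S(u)* x)` for the convolution adjoint, together with the fact that `S` maps the slices of `W` to
those of `W*`; the resulting relation is ultraweakly closed, so it passes to the closed antipode.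

The operators arise from the Galois map `f ⊗ g ↦ Δ(g)(f ⊗ 1)`. Left invariance makes it isometric,
the antipode makes it surjective, so it extends to a unitary `V = W*`. The slices of `V` are left
multiplications by `(ι ⊗ φ)((1 ⊗ a)Δ(b))`, and such elements exhaust `A`, which proves that the
regular representation is bounded.

Coproducts are only multipliers of `A ⊗ A`, so identities in `A ⊗ A` are tested by multiplying with
elements `c ⊗ d`. That this loses nothing is where the approximation property enters
(`HasApproximationProperty.eq_zero_of_sl`). -/

namespace BornQG

/-! ## Bounded linear maps between bornological vector spaces -/

/-- Bounded linear maps between bornological vector spaces. -/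
structure BL (V W : Type*) [AddCommGroup V] [Module ℂ V] [Bornology V]
    [AddCommGroup W] [Module ℂ W] [Bornology W] extends V →ₗ[ℂ] W where
  bounded' : IsBoundedMap toFun

namespace BL

section Basic

variable {V W X : Type*} [AddCommGroup V] [Module ℂ V] [Bornology V]
  [AddCommGroup W] [Module ℂ W] [Bornology W] [AddCommGroup X] [Module ℂ X] [Bornology X]

instance : FunLike (BL V W) V W where
  coe f := f.toLinearMap
  coe_injective := by
    rintro ⟨f, hf⟩ ⟨g, hg⟩ h
    have : f = g := DFunLike.coe_injective h
    subst this
    rfl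

instance : LinearMapClass (BL V W) ℂ V W where
  map_add f := f.toLinearMap.map_add
  map_smulₛₗ f := f.toLinearMap.map_smul

@[simp] lemma coe_toLinearMap (f : BL V W) : ⇑f.toLinearMap = f := rfl

@[simp] lemma coe_mk (f : V →ₗ[ℂ] W) (hf : IsBoundedMap f) : ⇑(⟨f, hf⟩ : BL V W) = f := rfl

@[simp] lemma toLinearMap_apply (f : BL V W) (x : V) : f.toLinearMap x = f x := rfl

lemma bounded (f : BL V W) : IsBoundedMap f := f.bounded'

@[ext] lemma ext {f g : BL V W} (h : ∀ x, f x = g x) : f = g := DFunLike.ext _ _ h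

/-- Composition of bounded linear maps. -/
def comp (g : BL W X) (f : BL V W) : BL V X where
  toLinearMap := g.toLinearMap.comp f.toLinearMap
  bounded' := by
    intro s hs
    have := g.bounded _ (f.bounded s hs)
    rwa [← Set.image_comp] at this

@[simp] lemma comp_apply (g : BL W X) (f : BL V W) (x : V) : g.comp f x = g (f x) := rfl

/-- The identity map. -/
def id (V : Type*) [AddCommGroup V] [Module ℂ V] [Bornology V] : BL V V where
  toLinearMap := LinearMap.id
  bounded' := by
    intro s hs
    simpa using hs

@[simp] lemma id_apply (x : V) : BL.id V x = x := rfl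

/-- The zero map. -/
def zero (V W : Type*) [AddCommGroup V] [Module ℂ V] [Bornology V]
    [AddCommGroup W] [Module ℂ W] [Bornology W] : BL V W where
  toLinearMap := 0
  bounded' := by
    intro s _
    refine (isBounded_singleton (x := (0 : W))).subset ?_
    rintro _ ⟨x, _, rfl⟩
    rfl

@[simp] lemma zero_apply (x : V) : BL.zero V W x = 0 := rfl

/-- Scalar multiples of a bounded linear map. -/
def smulc [CompleteBornological W] (z : ℂ) (f : BL V W) : BL V W where
  toLinearMap := z • f.toLinearMap
  bounded' := by
    intro s hs
    refine (CompleteBornological.isBounded_smul z _ (f.bounded s hs)).subset ?_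
    rintro _ ⟨x, hx, rfl⟩
    exact ⟨f x, ⟨x, hx, rfl⟩, rfl⟩

@[simp] lemma smulc_apply [CompleteBornological W] (z : ℂ) (f : BL V W) (x : V) :
    smulc z f x = z • f x := rfl

/-- The difference of two bounded linear maps. -/
def subt [CompleteBornological W] (f g : BL V W) : BL V W where
  toLinearMap := f.toLinearMap - g.toLinearMap
  bounded' := by
    intro s hs
    refine (CompleteBornological.isBounded_add _ _ (f.bounded s hs)
      (CompleteBornological.isBounded_smul (-1) _ (g.bounded s hs))).subset ?_
    rintro _ ⟨x, hx, rfl⟩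
    refine ⟨f x, ⟨x, hx, rfl⟩, (-1 : ℂ) • g x, ⟨g x, ⟨x, hx, rfl⟩, rfl⟩, ?_⟩
    change f x + (-1 : ℂ) • g x = f x - g x
    simp [sub_eq_add_neg]

@[simp] lemma subt_apply [CompleteBornological W] (f g : BL V W) (x : V) :
    subt f g x = f x - g x := rfl

end Basic

end BL

/-! ### Separate boundedness of maps of two variables. -/

section Disks

variable {X : Type*} [AddCommGroup X] [Module ℂ X] [Bornology X] [CompleteBornological X]

lemma IsBoundedMap.image2_left {Y Z T : Type*} [Bornology Y] [Bornology Z] [Bornology T]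
    {f : Y → Z → T} (hf : IsBoundedMap₂ f) (y : Y) : IsBoundedMap (f y) := by
  intro s hs
  have := hf {y} s isBounded_singleton hs
  rwa [Set.image2_singleton_left] at this

lemma IsBoundedMap.image2_right {Y Z T : Type*} [Bornology Y] [Bornology Z] [Bornology T]
    {f : Y → Z → T} (hf : IsBoundedMap₂ f) (z : Z) : IsBoundedMap fun y => f y z := by
  intro s hs
  have := hf s {z} hs isBounded_singleton
  rwa [Set.image2_singleton_right] at this

end Disks

/-! ### Banach spaces as bornological vector spaces. -/

section Banach

/-- Normed spaces that are complete are complete bornological vector spaces. -/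
instance completeBornological_of_banach {E : Type*} [NormedAddCommGroup E] [NormedSpace ℂ E]
    [CompleteSpace E] : CompleteBornological E where
  isBounded_add _ _ hs ht := hs.add ht
  isBounded_smul c _ hs := hs.smul₀ c
  isBounded_hull := by
    intro s hs
    obtain ⟨r, hr⟩ := hs.subset_closedBall 0
    refine (Metric.isBounded_closedBall (x := (0 : E)) (r := r)).subset
      (convexHull_min ?_ (convex_closedBall _ _))
    exact (balanced_closedBall_zero (𝕜 := ℂ)).balancedHull_subset_of_subset hr
  exists_disk := by
    intro s hs
    obtain ⟨r, hr⟩ := hs.subset_closedBall 0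
    -- The radius `r` may be zero or negative; `|r| + 1` is a positive upper bound.
    let z : ℂ := ((|r| + 1 : ℝ) : ℂ)
    have hz : z ≠ 0 := by
      have : (|r| + 1 : ℝ) ≠ 0 := by positivity
      exact Complex.ofReal_ne_zero.2 this
    have hzn : ‖z‖ = |r| + 1 := by
      rw [Complex.norm_real, Real.norm_of_nonneg (by positivity)]
    refine ⟨(z • LinearMap.id : E →ₗ[ℂ] E) '' Metric.closedBall 0 1, ?_, ?_,
      IsCompletantDisk.of_banach _ ?_⟩
    · intro x hx
      refine ⟨z⁻¹ • x, ?_, ?_⟩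
      · have h1 := hr hx
        rw [mem_closedBall_zero_iff] at h1 ⊢
        rw [norm_smul, norm_inv, hzn, inv_mul_le_iff₀ (by positivity)]
        linarith [le_abs_self r]
      · simp [smul_smul, hz]
    · rw [Metric.isBounded_iff_subset_closedBall 0]
      refine ⟨|r| + 1, ?_⟩
      rintro _ ⟨x, hx, rfl⟩
      rw [mem_closedBall_zero_iff] at hx ⊢
      simp only [LinearMap.smul_apply, LinearMap.id_apply, norm_smul, hzn]
      exact mul_le_of_le_one_right (by positivity) hx
    · intro x y h
      exact smul_right_injective _ hz h

variable {V E : Type*} [AddCommGroup V] [Module ℂ V] [Bornology V] [NormedAddCommGroup E]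
  [NormedSpace ℂ E]

/-- A continuous linear map is bounded. -/
def BL.ofCLM {F : Type*} [NormedAddCommGroup F] [NormedSpace ℂ F] (f : E →L[ℂ] F) : BL E F where
  toLinearMap := f.toLinearMap
  bounded' := by
    intro s hs
    exact f.lipschitz.isBounded_image hs

@[simp] lemma BL.ofCLM_apply {F : Type*} [NormedAddCommGroup F] [NormedSpace ℂ F] (f : E →L[ℂ] F)
    (x : E) : BL.ofCLM f x = f x := rfl

end Banach

/-! ### Tensors as absolutely convergent series. -/

section Series

variable {V W X : Type*} [AddCommGroup V] [Module ℂ V] [Bornology V]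
  [AddCommGroup W] [Module ℂ W] [Bornology W] [AddCommGroup X] [Module ℂ X] [Bornology X]

/-- A bounded linear map is compatible with the defining series of the tensors. -/
lemma isBornSum_apply {σ : ℂ →+* ℂ} [RingHomIsometric σ] (H : CTensor V W →ₛₗ[σ] X)
    (hH : IsBoundedMap H) (c : preTensor V W) :
    IsBornSum σ (fun p => H (ctmul p.1 p.2)) c (H (CTensor.mkQ V W c)) := by
  classical
  obtain ⟨hsum, s, t, hs, ht, hst⟩ := c.2
  refine ⟨H '' tensorDisk s t 1, hH _ ((CTensor.isBounded_iff V W).2 ⟨s, t, 1, hs, ht, subset_rfl⟩),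
    fun ε hε => ?_⟩
  have := hsum.hasSum
  rw [HasSum, SummationFilter.unconditional_filter, Metric.tendsto_atTop] at this
  obtain ⟨F₀, hF₀⟩ := this ε hε
  refine ⟨F₀, fun F hF => ?_⟩
  let d : preTensor V W := c - ∑ p ∈ F, c.1 p • preTmul p.1 p.2
  have hd : ∀ p, d.1 p = if p ∈ F then 0 else c.1 p := by
    intro p
    have : (∑ q ∈ F, c.1 q • (preTmul q.1 q.2 : preTensor V W)).1 p =
        if p ∈ F then c.1 p else 0 := by
      rw [Submodule.coe_sum, Finset.sum_apply]
      simp [preTmul, Pi.single_apply]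
    change c.1 p - _ = _
    rw [this]
    split_ifs <;> simp
  have hds : SuppIn s t d.1 := by
    intro p hp
    rw [hd] at hp
    refine hst p ?_
    split_ifs at hp <;> simp_all
  have hd1 : l1norm d ≤ ε := by
    have h1 := hF₀ F hF
    have h2 : (∑ p ∈ F, ‖c.1 p‖) + ∑' p, ‖d.1 p‖ = ∑' p, ‖c.1 p‖ := by
      have h3 : ∑ p ∈ F, ‖c.1 p‖ = ∑' p, if p ∈ F then ‖c.1 p‖ else 0 := by
        rw [tsum_eq_sum (s := F) (by intro b hb; simp [hb])]
        exact Finset.sum_congr rfl (by intro b hb; simp [hb])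
      rw [h3, ← Summable.tsum_add]
      · congr 1
        ext p
        rw [hd]
        split_ifs <;> simp
      · exact summable_of_ne_finset_zero (s := F) (by intro b hb; simp [hb])
      · exact d.2.1
    rw [Real.dist_eq, abs_lt] at h1
    change ∑' p, ‖d.1 p‖ ≤ ε
    linarith [h1.1]
  have hεc : ((ε : ℝ) : ℂ) ≠ 0 := by exact_mod_cast hε.ne'
  refine ⟨H (CTensor.mkQ V W (((ε : ℝ) : ℂ)⁻¹ • d)), ⟨_, ⟨_, ⟨?_, ?_⟩, rfl⟩, rfl⟩, ?_⟩
  · intro p hp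
    refine hds p fun h0 => hp ?_
    change _ * d.1 p = 0
    rw [h0, mul_zero]
  · change ∑' p, ‖((ε : ℝ) : ℂ)⁻¹ * d.1 p‖ ≤ 1
    simp only [norm_mul]
    rw [tsum_mul_left, norm_inv, Complex.norm_real, Real.norm_of_nonneg hε.le]
    rw [inv_mul_le_iff₀ hε]
    rw [mul_one]
    exact hd1
  · change ε • H (CTensor.mkQ V W (((ε : ℝ) : ℂ)⁻¹ • d)) = _
    have hσ : Continuous σ :=
      (AddMonoidHomClass.isometry_of_norm σ fun z => RingHomIsometric.norm_map).continuous
    have hσε : σ ((ε : ℝ) : ℂ) = ((ε : ℝ) : ℂ) := by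
      rcases Complex.ringHom_eq_id_or_conj_of_continuous hσ with h | h
      · rw [h, RingHom.id_apply]
      · rw [h, Complex.conj_ofReal]
    rw [map_smul, map_smulₛₗ, map_inv₀, hσε, ← Complex.coe_smul, smul_smul,
      mul_inv_cancel₀ hεc, one_smul, map_sub, map_sub, map_sum, map_sum]
    simp only [map_smul, map_smulₛₗ]
    rfl

/-- The defining series of a tensor is mapped to a series that converges in norm by a bounded
linear map into a normed space. -/
lemma hasSum_apply {E : Type*} [NormedAddCommGroup E] [NormedSpace ℂ E]
    (H : BL (CTensor V W) E) (c : preTensor V W) :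
    HasSum (fun p => c.1 p • H (ctmul p.1 p.2)) (H (CTensor.mkQ V W c)) := by
  obtain ⟨B, hB, h⟩ := isBornSum_apply (σ := RingHom.id ℂ) H.toLinearMap H.bounded c
  obtain ⟨r, hr, hBr⟩ := hB.subset_closedBall_lt 0 0
  classical
  rw [HasSum, SummationFilter.unconditional_filter]
  refine Metric.tendsto_atTop.2 fun ε hε => ?_
  -- The bounded set controlling the remainders lies in the ball of radius `r`; the factor 2 makes
  -- the final inequality strict.
  obtain ⟨F, hF⟩ := h (ε / (2 * r)) (by positivity)
  refine ⟨F, fun G hG => ?_⟩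
  obtain ⟨b, hb, hb'⟩ := hF G hG
  have hb1 := hBr hb
  rw [mem_closedBall_zero_iff] at hb1
  rw [dist_comm, dist_eq_norm]
  change (ε / (2 * r)) • b = H (CTensor.mkQ V W c) - ∑ p ∈ G, c.1 p • H (ctmul p.1 p.2) at hb'
  rw [← hb', norm_smul, Real.norm_of_nonneg (by positivity)]
  calc ε / (2 * r) * ‖b‖ ≤ ε / (2 * r) * r := by gcongr
    _ = ε / 2 := by field_simp
    _ < ε := by linarith

/-- Sums of series in a bounded completant disk stay in multiples of that disk. -/
lemma IsBornSum.mem_smul [CompleteBornological X] {σ : ℂ →+* ℂ} [RingHomIsometric σ]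
    {f : V × W → X} {c : preTensor V W} {x : X} (hx : IsBornSum σ f c x) {D : Set X}
    (hDb : IsBounded D) (hD : IsCompletantDisk D) (hD0 : D.Nonempty)
    (hf : ∀ p, c.1 p ≠ 0 → f p ∈ D) {r : ℝ} (hr : 0 < r) (hc : l1norm c < r) : x ∈ r • D := by
  classical
  obtain ⟨E, _, _, _, j, hj, hj1, hj2⟩ := hD.exists_banach' hD0
  have : ∀ p : V × W, ∃ e : E, ‖e‖ ≤ 1 ∧ (c.1 p ≠ 0 → j e = f p) := by
    intro p
    by_cases hp : c.1 p ≠ 0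
    · obtain ⟨e, he, he'⟩ := hj1 (f p) (hf p hp)
      exact ⟨e, he', fun _ => he⟩
    · exact ⟨0, by simp, fun h => absurd h hp⟩
  choose e he hef using this
  have hnorm : ∀ p, ‖σ (c.1 p) • e p‖ ≤ ‖c.1 p‖ := by
    intro p
    rw [norm_smul, RingHomIsometric.norm_map]
    exact mul_le_of_le_one_right (norm_nonneg _) (he p)
  have hsum : Summable (fun p => σ (c.1 p) • e p) :=
    Summable.of_norm_bounded c.2.1 hnorm
  have hterm : ∀ p, j (σ (c.1 p) • e p) = σ (c.1 p) • f p := by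
    intro p
    by_cases hp : c.1 p = 0
    · simp [hp]
    · rw [map_smul, hef p hp]
  have key : ∀ (a : E) (r : ℝ), 0 < r → ‖a‖ < r → j a ∈ r • D := by
    intro a r hr har
    refine ⟨j (r⁻¹ • a), hj2 ⟨_, ?_, rfl⟩, ?_⟩
    · rw [mem_ball_zero_iff, norm_smul, norm_inv, Real.norm_of_nonneg hr.le,
        inv_mul_lt_iff₀ hr]
      simpa using har
    · change r • j (r⁻¹ • a) = j a
      rw [← Complex.coe_smul, ← map_smul, Complex.coe_smul, smul_smul, mul_inv_cancel₀ hr.ne',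
        one_smul]
  have hx' : IsBornSum σ f c (j (∑' p, σ (c.1 p) • e p)) := by
    refine ⟨D, hDb, fun ε hε => ?_⟩
    have := hsum.hasSum
    rw [HasSum, SummationFilter.unconditional_filter, Metric.tendsto_atTop] at this
    obtain ⟨F, hF⟩ := this ε hε
    refine ⟨F, fun G hG => ?_⟩
    have h1 := hF G hG
    rw [dist_comm, dist_eq_norm] at h1
    have h2 := key _ ε hε h1
    rw [map_sub, map_sum] at h2
    simpa only [hterm] using h2
  rw [hx.unique hx']
  refine key _ r hr (lt_of_le_of_lt ?_ hc)
  exact tsum_of_norm_bounded c.2.1.hasSum hnorm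

/-- A family of bounded linear maps on a tensor product is equibounded if it is equibounded on
elementary tensors. -/
lemma isBounded_image2_tensor [CompleteBornological X] {I : Type*}
    {σ : ℂ →+* ℂ} [RingHomIsometric σ] (Φ : I → CTensor V W →ₛₗ[σ] X)
    (hΦ : ∀ i, IsBoundedMap (Φ i)) (J : Set I)
    (h : ∀ s t, IsBounded s → IsBounded t →
      IsBounded {x | ∃ i ∈ J, ∃ v ∈ s, ∃ w ∈ t, x = Φ i (ctmul v w)})
    {B : Set (CTensor V W)} (hB : IsBounded B) :
    IsBounded (Set.image2 (fun i u => Φ i u) J B) := by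
  obtain ⟨s, t, r, hs, ht, hBs⟩ := (CTensor.isBounded_iff V W).1 hB
  -- One disk absorbs the values of all maps of the family on elementary tensors, so the sums with
  -- coefficients of `ℓ¹` norm at most `r` lie in a common multiple of it.
  obtain ⟨D, hfD, hDb, hD⟩ := CompleteBornological.exists_disk _
    ((h s t hs ht).union (isBounded_singleton (x := (0 : X))))
  refine (CompleteBornological.isBounded_smul ((|r| + 1 : ℝ) : ℂ) D hDb).subset ?_
  rintro _ ⟨i, hi, u, hu, rfl⟩
  obtain ⟨c, ⟨hc, hcr⟩, rfl⟩ := hBs hu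
  have := (isBornSum_apply (Φ i) (hΦ i) c).mem_smul hDb hD ⟨0, hfD (Or.inr rfl)⟩
    (fun p hp => hfD (Or.inl ⟨i, hi, _, (hc p hp).1, _, (hc p hp).2, rfl⟩))
    (r := |r| + 1) (by positivity) (by linarith [le_abs_self r])
  obtain ⟨b, hb, hb'⟩ := this
  refine ⟨b, hb, ?_⟩
  simp only [Complex.coe_smul]
  exact hb'

end Series

/-! ### Elementary tensors. -/

section Elementary

variable {V W X : Type*} [AddCommGroup V] [Module ℂ V] [Bornology V]
  [AddCommGroup W] [Module ℂ W] [Bornology W]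

lemma mkQ_eq_zero_of_mem_tensorRel {c : preTensor V W} (hc : c ∈ tensorRel V W) :
    CTensor.mkQ V W c = 0 :=
  (Submodule.Quotient.mk_eq_zero _).2 (Submodule.mem_sInf.2 fun _ hN => hN.1 hc)

lemma add_ctmul (v v' : V) (w : W) : ctmul (v + v') w = ctmul v w + ctmul v' w := by
  have := mkQ_eq_zero_of_mem_tensorRel (V := V) (W := W) (Or.inl ⟨v, v', w, rfl⟩)
  rw [map_sub, map_sub, sub_sub, sub_eq_zero] at this
  exact this

lemma ctmul_add (v : V) (w w' : W) : ctmul v (w + w') = ctmul v w + ctmul v w' := by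
  have := mkQ_eq_zero_of_mem_tensorRel (V := V) (W := W) (Or.inr (Or.inl ⟨v, w, w', rfl⟩))
  rw [map_sub, map_sub, sub_sub, sub_eq_zero] at this
  exact this

lemma smul_ctmul (z : ℂ) (v : V) (w : W) : ctmul (z • v) w = z • ctmul v w := by
  have := mkQ_eq_zero_of_mem_tensorRel (V := V) (W := W)
    (Or.inr (Or.inr (Or.inl ⟨z, v, w, rfl⟩)))
  rw [map_sub, map_smul, sub_eq_zero] at this
  exact this

lemma ctmul_smul (z : ℂ) (v : V) (w : W) : ctmul v (z • w) = z • ctmul v w := by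
  have := mkQ_eq_zero_of_mem_tensorRel (V := V) (W := W)
    (Or.inr (Or.inr (Or.inr ⟨z, v, w, rfl⟩)))
  rw [map_sub, map_smul, sub_eq_zero] at this
  exact this

lemma l1norm_preTmul (v : V) (w : W) : l1norm (preTmul v w) = 1 := by
  classical
  change ∑' p, ‖(Pi.single (v, w) (1 : ℂ) : V × W → ℂ) p‖ = 1
  rw [tsum_eq_single (v, w)]
  · simp
  · intro p hp
    simp [Pi.single_eq_of_ne hp]

lemma ctmul_mem_tensorDisk {s : Set V} {t : Set W} {v : V} {w : W} (hv : v ∈ s) (hw : w ∈ t) :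
    ctmul v w ∈ tensorDisk s t 1 := by
  classical
  refine ⟨preTmul v w, ⟨?_, (l1norm_preTmul v w).le⟩, rfl⟩
  intro p hp
  have : p = (v, w) := by
    by_contra h
    exact hp (by simp [preTmul, Pi.single_eq_of_ne h])
  subst this
  exact ⟨hv, hw⟩

lemma isBoundedMap₂_ctmul : IsBoundedMap₂ (fun (v : V) (w : W) => ctmul v w) := by
  intro s t hs ht
  refine (CTensor.isBounded_iff V W).2 ⟨s, t, 1, hs, ht, ?_⟩
  rintro _ ⟨v, hv, w, hw, rfl⟩
  exact ctmul_mem_tensorDisk hv hw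

end Elementary

namespace BL

/-! ### Functoriality, associators and slice maps of the completed tensor product. -/

section Tensor

variable {V W X V' W' : Type*} [AddCommGroup V] [Module ℂ V] [Bornology V]
  [AddCommGroup W] [Module ℂ W] [Bornology W] [AddCommGroup X] [Module ℂ X] [Bornology X]
  [AddCommGroup V'] [Module ℂ V'] [Bornology V'] [AddCommGroup W'] [Module ℂ W'] [Bornology W']

/-- The map on the tensor product given by a bounded bilinear map. -/
noncomputable def ofLift [CompleteBornological X] (f : V →ₗ[ℂ] W →ₗ[ℂ] X)
    (hf : IsBoundedMap₂ (fun v w => f v w)) : BL (CTensor V W) X :=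
  ⟨lift fun v w => f v w, (lift_spec f hf).1⟩

@[simp] lemma ofLift_ctmul [CompleteBornological X] (f : V →ₗ[ℂ] W →ₗ[ℂ] X)
    (hf : IsBoundedMap₂ (fun v w => f v w)) (v : V) (w : W) :
    ofLift f hf (ctmul v w) = f v w := (lift_spec f hf).2 v w

/-- Uniqueness in the universal property. Almost every identity below is reduced by it to elementary
tensors, which is why the composites are built as bounded maps. -/
lemma congr [CompleteBornological X] {f g : BL (CTensor V W) X}
    (h : ∀ v w, f (ctmul v w) = g (ctmul v w)) (u : CTensor V W) : f u = g u := by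
  have := lift_unique (RingHom.id ℂ) f.toLinearMap g.toLinearMap f.bounded g.bounded h
  exact LinearMap.congr_fun this u

/-- A map that agrees with a bounded linear map on elementary tensors has that map as its
linearization. -/
lemma lift_eq [CompleteBornological X] (F : BL (CTensor V W) X) (f : V → W → X)
    (h : ∀ v w, F (ctmul v w) = f v w) (u : CTensor V W) : lift f u = F u := by
  let f' : V →ₗ[ℂ] W →ₗ[ℂ] X := LinearMap.mk₂ ℂ (fun v w => F (ctmul v w))
    (fun v v' w => by rw [add_ctmul, map_add]) (fun z v w => by rw [smul_ctmul, map_smul])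
    (fun v w w' => by rw [ctmul_add, map_add]) (fun z v w => by rw [ctmul_smul, map_smul])
  have hf' : f = fun v w => f' v w := by
    ext v w
    exact (h v w).symm
  have hb : IsBoundedMap₂ (fun v w => f' v w) := by
    intro s t hs ht
    have := F.bounded _ (isBoundedMap₂_ctmul s t hs ht)
    rwa [Set.image_image2] at this
  subst hf'
  refine congr (f := ofLift f' hb) (fun v w => ?_) u
  simp [f']

/-- The tensor product of two bounded linear maps. -/
noncomputable def tmap (f : BL V V') (g : BL W W') : BL (CTensor V W) (CTensor V' W') :=
  ofLift (LinearMap.mk₂ ℂ (fun v w => ctmul (f v) (g w))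
    (fun v v' w => by rw [map_add, add_ctmul]) (fun z v w => by rw [map_smul, smul_ctmul])
    (fun v w w' => by rw [map_add, ctmul_add]) (fun z v w => by rw [map_smul, ctmul_smul])) (by
    intro s t hs ht
    have := isBoundedMap₂_ctmul _ _ (f.bounded s hs) (g.bounded t ht)
    rwa [Set.image2_image_left, Set.image2_image_right] at this)

@[simp] lemma tmap_ctmul (f : BL V V') (g : BL W W') (v : V) (w : W) :
    tmap f g (ctmul v w) = ctmul (f v) (g w) := by
  exact ofLift_ctmul _ _ v w

/-- The flip map. -/
noncomputable def swap (V W : Type*) [AddCommGroup V] [Module ℂ V] [Bornology V]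
    [AddCommGroup W] [Module ℂ W] [Bornology W] : BL (CTensor V W) (CTensor W V) :=
  ofLift (LinearMap.mk₂ ℂ (fun v w => ctmul w v)
    (fun v v' w => ctmul_add _ _ _) (fun z v w => ctmul_smul _ _ _)
    (fun v w w' => add_ctmul _ _ _) (fun z v w => smul_ctmul _ _ _)) (by
    intro s t hs ht
    have := isBoundedMap₂_ctmul _ _ ht hs
    rwa [Set.image2_swap] at this)

@[simp] lemma swap_ctmul (v : V) (w : W) : swap V W (ctmul v w) = ctmul w v := by
  exact ofLift_ctmul _ _ v w

/-- The map `w ↦ v ⊗ w`. -/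
noncomputable def tl (W : Type*) [AddCommGroup W] [Module ℂ W] [Bornology W] (v : V) :
    BL W (CTensor V W) where
  toFun w := ctmul v w
  map_add' := ctmul_add v
  map_smul' z w := ctmul_smul z v w
  bounded' := IsBoundedMap.image2_left isBoundedMap₂_ctmul v

@[simp] lemma tl_apply (v : V) (w : W) : tl W v w = ctmul v w := rfl

/-- The map `v ↦ v ⊗ w`. -/
noncomputable def tr (V : Type*) [AddCommGroup V] [Module ℂ V] [Bornology V] (w : W) :
    BL V (CTensor V W) where
  toFun v := ctmul v w
  map_add' v v' := add_ctmul v v' w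
  map_smul' z v := smul_ctmul z v w
  bounded' := IsBoundedMap.image2_right isBoundedMap₂_ctmul w

@[simp] lemma tr_apply (v : V) (w : W) : tr V w v = ctmul v w := rfl

/-- Joint boundedness of a family of linear maps on a tensor product. -/
lemma isBoundedMap₂_of_ctmul [CompleteBornological X] {Y : Type*} [Bornology Y]
    (Φ : Y → BL (CTensor V W) X)
    (h : ∀ S s t, IsBounded S → IsBounded s → IsBounded t →
      IsBounded {x | ∃ y ∈ S, ∃ v ∈ s, ∃ w ∈ t, x = Φ y (ctmul v w)}) :
    IsBoundedMap₂ (fun y u => Φ y u) := fun S _ hS hB =>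
  isBounded_image2_tensor (σ := RingHom.id ℂ) (fun y => (Φ y).toLinearMap)
    (fun y => (Φ y).bounded) S (fun s t hs ht => h S s t hS hs ht) hB

/-- The associator `V ⊗ (W ⊗ X) → (V ⊗ W) ⊗ X`. -/
noncomputable def assocL (V W X : Type*) [AddCommGroup V] [Module ℂ V] [Bornology V]
    [AddCommGroup W] [Module ℂ W] [Bornology W] [AddCommGroup X] [Module ℂ X] [Bornology X] :
    BL (CTensor V (CTensor W X)) (CTensor (CTensor V W) X) :=
  ofLift (LinearMap.mk₂ ℂ (fun v u => tmap (tl W v) (BL.id X) u)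
    (fun v v' u => by
      have h := congr (f := subt (subt (tmap (tl W (v + v')) (BL.id X)) (tmap (tl W v) (BL.id X)))
        (tmap (tl W v') (BL.id X))) (g := BL.zero _ _)
        (fun w x => by simp [add_ctmul]) u
      simp only [subt_apply, zero_apply] at h
      rwa [sub_sub, sub_eq_zero] at h)
    (fun z v u => by
      refine congr (f := tmap (tl W (z • v)) (BL.id X)) (g := smulc z (tmap (tl W v) (BL.id X)))
        (fun w x => by simp [smul_ctmul]) u)
    (fun v u u' => map_add _ _ _) (fun z v u => map_smul _ _ _)) (by
    refine isBoundedMap₂_of_ctmul (fun v => tmap (tl W v) (BL.id X)) fun S s t hS hs ht => ?_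
    refine (isBoundedMap₂_ctmul _ _ (isBoundedMap₂_ctmul S s hS hs) ht).subset ?_
    rintro _ ⟨v, hv, w, hw, x, hx, rfl⟩
    exact ⟨_, ⟨v, hv, w, hw, rfl⟩, x, hx, by simp⟩)

@[simp] lemma assocL_ctmul (v : V) (w : W) (x : X) :
    assocL V W X (ctmul v (ctmul w x)) = ctmul (ctmul v w) x := by
  exact (ofLift_ctmul _ _ v (ctmul w x)).trans (tmap_ctmul _ _ _ _)

/-- The associator `(V ⊗ W) ⊗ X → V ⊗ (W ⊗ X)`. -/
noncomputable def assocR (V W X : Type*) [AddCommGroup V] [Module ℂ V] [Bornology V]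
    [AddCommGroup W] [Module ℂ W] [Bornology W] [AddCommGroup X] [Module ℂ X] [Bornology X] :
    BL (CTensor (CTensor V W) X) (CTensor V (CTensor W X)) :=
  (tmap (BL.id V) (swap X W)).comp <| (swap _ _).comp <| (assocL X W V).comp <|
    (tmap (BL.id X) (swap V W)).comp (swap _ _)

@[simp] lemma assocR_ctmul (v : V) (w : W) (x : X) :
    assocR V W X (ctmul (ctmul v w) x) = ctmul v (ctmul w x) := by
  simp [assocR]

lemma assocL_assocR (u : CTensor (CTensor V W) X) : assocL V W X (assocR V W X u) = u := by
  have h : ∀ (x : X) (u : CTensor V W), assocL V W X (assocR V W X (ctmul u x)) = ctmul u x :=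
    fun x u => congr (f := (assocL V W X).comp ((assocR V W X).comp (tr _ x))) (g := tr _ x)
      (fun v w => by simp) u
  exact congr (f := (assocL V W X).comp (assocR V W X)) (g := BL.id _) (fun u x => h x u) u

/-- The slice map `f ⊗ ι`. -/
noncomputable def sl [CompleteBornological W] (f : BL V ℂ) : BL (CTensor V W) W :=
  ofLift (LinearMap.mk₂ ℂ (fun v w => f v • w)
    (fun v v' w => by rw [map_add, add_smul]) (fun z v w => by rw [map_smul, smul_assoc])
    (fun v w w' => smul_add _ _ _) (fun z v w => smul_comm _ _ _)) (by
    intro s t hs ht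
    obtain ⟨D, hD, hDb, hDc⟩ := CompleteBornological.exists_disk t ht
    obtain ⟨r, hr⟩ := (f.bounded s hs).subset_closedBall 0
    refine (CompleteBornological.isBounded_smul ((|r| + 1 : ℝ) : ℂ) D hDb).subset ?_
    rintro _ ⟨v, hv, w, hw, rfl⟩
    have h1 : ‖f v‖ ≤ r := by simpa using hr ⟨v, hv, rfl⟩
    have h0 : ((|r| + 1 : ℝ) : ℂ) ≠ 0 := by
      have : (|r| + 1 : ℝ) ≠ 0 := by positivity
      exact_mod_cast this
    refine ⟨(((|r| + 1 : ℝ) : ℂ)⁻¹ * f v) • w, hDc.balanced.smul_mem ?_ (hD hw), ?_⟩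
    · rw [norm_mul, norm_inv, Complex.norm_real, Real.norm_of_nonneg (by positivity),
        inv_mul_le_iff₀ (by positivity)]
      linarith [le_abs_self r]
    · simp only [LinearMap.mk₂_apply, smul_smul]
      rw [mul_inv_cancel_left₀ h0])

@[simp] lemma sl_ctmul [CompleteBornological W] (f : BL V ℂ) (v : V) (w : W) :
    sl f (ctmul v w) = f v • w := by
  exact ofLift_ctmul _ _ v w

/-- The slice map `ι ⊗ f`. -/
noncomputable def sr [CompleteBornological V] (f : BL W ℂ) : BL (CTensor V W) V :=
  (sl f).comp (swap V W)

@[simp] lemma sr_ctmul [CompleteBornological V] (f : BL W ℂ) (v : V) (w : W) :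
    sr f (ctmul v w) = f w • v := by
  simp [sr]

lemma sl_tmap [CompleteBornological W] [CompleteBornological W'] (f : BL V' ℂ) (g : BL V V')
    (h : BL W W') (u : CTensor V W) : sl f (tmap g h u) = h (sl (f.comp g) u) :=
  congr (f := (sl f).comp (tmap g h)) (g := h.comp (sl (f.comp g))) (fun v w => by simp) u

lemma sr_tmap [CompleteBornological V] [CompleteBornological V'] (f : BL W' ℂ) (g : BL V V')
    (h : BL W W') (u : CTensor V W) : sr f (tmap g h u) = g (sr (f.comp h) u) :=
  congr (f := (sr f).comp (tmap g h)) (g := g.comp (sr (f.comp h))) (fun v w => by simp) u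

lemma sr_swap [CompleteBornological V] (f : BL W ℂ) (u : CTensor W V) :
    sr f (swap W V u) = sl f u :=
  congr (f := (sr f).comp (swap W V)) (g := sl f) (fun v w => by simp) u

/-- Fubini for slices: it exchanges the order in which two functionals are applied. -/
lemma apply_sl [CompleteBornological V] [CompleteBornological W] (f : BL V ℂ) (g : BL W ℂ)
    (u : CTensor V W) : g (sl f u) = f (sr g u) :=
  congr (f := g.comp (sl f)) (g := f.comp (sr g)) (fun v w => by simp [mul_comm]) u

lemma tmap_tmap {V'' W'' : Type*} [AddCommGroup V''] [Module ℂ V''] [Bornology V'']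
    [AddCommGroup W''] [Module ℂ W''] [Bornology W''] (f : BL V V') (g : BL W W')
    (f' : BL V' V'') (g' : BL W' W'') (u : CTensor V W) :
    tmap f' g' (tmap f g u) = tmap (f'.comp f) (g'.comp g) u :=
  congr (f := (tmap f' g').comp (tmap f g)) (g := tmap (f'.comp f) (g'.comp g))
    (fun v w => by simp) u

lemma swap_tmap (f : BL V V') (g : BL W W') (u : CTensor V W) :
    swap V' W' (tmap f g u) = tmap g f (swap V W u) :=
  congr (f := (swap V' W').comp (tmap f g)) (g := (tmap g f).comp (swap V W))
    (fun v w => by simp) u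

lemma swap_swap (u : CTensor V W) : swap W V (swap V W u) = u :=
  congr (f := (swap W V).comp (swap V W)) (g := BL.id _) (fun v w => by simp) u

end Tensor

end BL

end BornQG


namespace BornQG

/-! ## The approximation property and slice maps -/

section Approximation

/-- Absolutely summable families can be multiplied with weights that tend to infinity. -/
lemma exists_weight {P : Type*} {c : P → ℂ} (hc : Summable fun p => ‖c p‖) :
    ∃ w : P → ℝ, (∀ p, 0 < w p) ∧ (Summable fun p => w p * ‖c p‖) ∧
      Tendsto (fun p => if c p = 0 then 0 else (w p)⁻¹) cofinite (𝓝 0) := by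
  classical
  have hfin : ∑' p, ‖c p‖ₑ ≠ ⊤ := by
    have := hc.tsum_ofReal_ne_top
    simpa [ofReal_norm] using this
  -- Tails below `4⁻ᵏ` leave room for the weight `2ᵏ` outside `F k`: the contributions are then
  -- bounded by the geometric series of `2⁻ᵏ`.
  have htail : ∀ k : ℕ, ∃ F : Finset P, ∑' p : {p // p ∉ F}, ‖c p‖ₑ ≤ ((4 : ENNReal) ^ k)⁻¹ := by
    intro k
    have := ENNReal.tendsto_tsum_compl_atTop_zero hfin
    have hpos : (0 : ENNReal) < ((4 : ENNReal) ^ k)⁻¹ := by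
      simp [ENNReal.inv_pos]
    obtain ⟨F, hF⟩ := ((this.eventually (gt_mem_nhds hpos))).exists
    exact ⟨F, hF.le⟩
  choose F hF using htail
  let W : P → ENNReal := fun p => 1 + ∑' k : ℕ, if p ∈ F k then 0 else (2 : ENNReal) ^ k
  have hW : ∑' p, W p * ‖c p‖ₑ ≠ ⊤ := by
    have h1 : ∑' p, W p * ‖c p‖ₑ =
        ∑' p, ‖c p‖ₑ + ∑' k : ℕ, ∑' p, (if p ∈ F k then 0 else (2 : ENNReal) ^ k * ‖c p‖ₑ) := by
      rw [ENNReal.tsum_comm, ← ENNReal.tsum_add]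
      congr 1
      ext p
      rw [add_mul, one_mul, ← ENNReal.tsum_mul_right]
      congr 1
      congr 1
      ext k
      split_ifs <;> simp
    have h2 : ∀ k : ℕ, ∑' p, (if p ∈ F k then 0 else (2 : ENNReal) ^ k * ‖c p‖ₑ) ≤
        (2⁻¹ : ENNReal) ^ k := by
      intro k
      have h3 : ∑' p, (if p ∈ F k then 0 else (2 : ENNReal) ^ k * ‖c p‖ₑ) =
          ∑' p : {p // p ∉ F k}, (2 : ENNReal) ^ k * ‖c p‖ₑ := by
        change _ = ∑' p : ({p | p ∉ F k} : Set P), (2 : ENNReal) ^ k * ‖c p‖ₑ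
        rw [tsum_subtype ({p | p ∉ F k} : Set P) (fun p => (2 : ENNReal) ^ k * ‖c p‖ₑ)]
        congr 1
        ext p
        simp [Set.indicator_apply, ite_not]
      rw [h3, ENNReal.tsum_mul_left]
      calc (2 : ENNReal) ^ k * _ ≤ (2 : ENNReal) ^ k * ((4 : ENNReal) ^ k)⁻¹ := by gcongr; exact hF k
        _ = (2⁻¹ : ENNReal) ^ k := by
          rw [ENNReal.inv_pow, ← mul_pow]
          congr 1
          rw [show (4 : ENNReal) = 2 * 2 by norm_num,
            ENNReal.mul_inv (by simp) (by simp), ← mul_assoc, ENNReal.mul_inv_cancel (by simp)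
            (by simp), one_mul]
    rw [h1]
    refine ENNReal.add_ne_top.2 ⟨hfin, ne_top_of_le_ne_top ?_ (ENNReal.tsum_le_tsum h2)⟩
    rw [ENNReal.tsum_geometric]
    simp
  have hWtop : ∀ p, c p ≠ 0 → W p ≠ ⊤ := by
    intro p hp htop
    refine hW (ENNReal.tsum_eq_top_of_eq_top ⟨p, ?_⟩)
    rw [htop, ENNReal.top_mul]
    simpa using hp
  -- Where `c` vanishes the extended weight `W` may be infinite, so the value 1 is used there.
  let w : P → ℝ := fun p => if c p = 0 then 1 else (W p).toReal
  have hw1 : ∀ p, c p ≠ 0 → 1 ≤ (W p).toReal := by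
    intro p hp
    rw [← ENNReal.toReal_one]
    exact ENNReal.toReal_mono (hWtop p hp) le_self_add
  refine ⟨w, ?_, ?_, ?_⟩
  · intro p
    by_cases hp : c p = 0
    · simp [w, hp]
    · simp only [w, hp, if_false]
      linarith [hw1 p hp]
  · have := ENNReal.summable_toReal hW
    refine this.congr fun p => ?_
    by_cases hp : c p = 0
    · simp [w, hp]
    · simp [w, hp, ENNReal.toReal_mul]
  · rw [Metric.tendsto_nhds]
    intro ε hε
    obtain ⟨k, hk⟩ := exists_pow_lt_of_lt_one hε (show (1 / 2 : ℝ) < 1 by norm_num)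
    refine (F k).finite_toSet.subset fun p hp => ?_
    by_contra hpF
    apply hp
    have hpF : p ∉ F k := hpF
    change dist (if c p = 0 then 0 else (w p)⁻¹) 0 < ε
    by_cases hcp : c p = 0
    · simpa [hcp] using hε
    · simp only [hcp, if_false, w, dist_zero_right]
      have h2 : (2 : ℝ) ^ k ≤ (W p).toReal := by
        have : ((2 : ENNReal) ^ k).toReal ≤ (W p).toReal := by
          refine ENNReal.toReal_mono (hWtop p hcp) (le_trans ?_ le_add_self)
          refine le_trans ?_ (ENNReal.le_tsum k)
          simp [hpF]
        simpa using this
      rw [Real.norm_of_nonneg (by positivity)]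
      refine lt_of_le_of_lt ?_ hk
      rw [one_div, inv_pow]
      exact inv_anti₀ (by positivity) h2

variable {V W : Type*} [AddCommGroup V] [Module ℂ V] [Bornology V] [CompleteBornological V]
  [AddCommGroup W] [Module ℂ W] [Bornology W] [CompleteBornological W]

/-- Linear functionals on a finite-dimensional subspace are bounded. -/
lemma isBoundedMap_comp_of_finiteDimensional {X : Type*} [AddCommGroup X] [Module ℂ X]
    [Bornology X] (F : X →ₗ[ℂ] V) (hF : IsBoundedMap F)
    [FiniteDimensional ℂ (LinearMap.range F)] (g : LinearMap.range F →ₗ[ℂ] ℂ) :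
    IsBoundedMap (g.comp F.rangeRestrict) := by
  intro s hs
  obtain ⟨D, hFD, hDb, hD⟩ := CompleteBornological.exists_disk (F '' s ∪ {0})
    ((hF s hs).union isBounded_singleton)
  obtain ⟨E, _, _, _, j, hj, hj1, hj2⟩ := hD.exists_banach' ⟨0, hFD (Or.inr rfl)⟩
  -- Boundedness is checked in the Banach space of a disk containing `F '' s`: the preimage of the
  -- range is finite-dimensional there, and linear functionals on it are automatically continuous.
  let L : Submodule ℂ E := (LinearMap.range F).comap j
  let j' : L →ₗ[ℂ] LinearMap.range F := (j.comp L.subtype).codRestrict _ (fun x => x.2)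
  have hj' : Function.Injective j' := by
    intro x y h
    exact Subtype.ext (hj (congrArg Subtype.val h))
  have : FiniteDimensional ℂ L := FiniteDimensional.of_injective j' hj'
  let G : L →L[ℂ] ℂ := LinearMap.toContinuousLinearMap (g.comp j')
  rw [Metric.isBounded_iff_subset_closedBall 0]
  refine ⟨‖G‖, ?_⟩
  rintro _ ⟨x, hx, rfl⟩
  obtain ⟨e, he, hen⟩ := hj1 (F x) (hFD (Or.inl ⟨x, hx, rfl⟩))
  have heL : e ∈ L := by
    change j e ∈ LinearMap.range F
    rw [he]
    exact ⟨x, rfl⟩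
  have h1 : (g.comp F.rangeRestrict) x = G ⟨e, heL⟩ := by
    change g _ = g _
    congr 1
    exact Subtype.ext he.symm
  rw [mem_closedBall_zero_iff, h1]
  refine (G.le_opNorm _).trans (mul_le_of_le_one_right (norm_nonneg _) ?_)
  exact hen

/-- If `V` has the approximation property, the elements of `V ⊗ W` are determined by their slices
with the bounded linear functionals on `V`. -/
theorem HasApproximationProperty.eq_zero_of_sl (hAP : HasApproximationProperty V)
    (u : CTensor V W) (hu : ∀ f : BL V ℂ, BL.sl f u = 0) : u = 0 := by
  classical
  obtain ⟨c, rfl⟩ := Submodule.mkQ_surjective _ u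
  change CTensor.mkQ V W c = 0
  change ∀ f : BL V ℂ, BL.sl f (CTensor.mkQ V W c) = 0 at hu
  obtain ⟨hsum, s, t, hs, ht, hst⟩ := c.2
  obtain ⟨w, hw0, hws, hwt⟩ := exists_weight hsum
  obtain ⟨D, hsD, hDb, hD⟩ := CompleteBornological.exists_disk (s ∪ {0})
    (hs.union isBounded_singleton)
  obtain ⟨E, _, _, _, j, hj, hj1, hj2⟩ := hD.exists_banach' ⟨0, hsD (Or.inr rfl)⟩
  have : ∀ p : V × W, ∃ e : E, ‖e‖ ≤ 1 ∧ (c.1 p ≠ 0 → j e = p.1) := by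
    intro p
    by_cases hp : c.1 p ≠ 0
    · obtain ⟨e, he, he'⟩ := hj1 p.1 (hsD (Or.inl (hst p hp).1))
      exact ⟨e, he', fun _ => he⟩
    · exact ⟨0, by simp, fun h => absurd h hp⟩
  choose e he hej using this
  -- The left legs divided by the weights form a null family, so together with 0 they form a compact
  -- set, to which the approximation property applies. The weights themselves are absorbed by the
  -- coefficients in `c'`.
  let l : V × W → E := fun p => (((if c.1 p = 0 then 0 else (w p)⁻¹ : ℝ)) : ℂ) • e p
  have hl : Tendsto l cofinite (𝓝 0) := by
    refine squeeze_zero_norm (fun p => ?_) (hwt.norm.trans (by simp))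
    rw [norm_smul, Complex.norm_real]
    exact mul_le_of_le_one_right (norm_nonneg _) (he p)
  have hcomp := hl.isCompact_insert_range_of_cofinite
  have hmemD : ∀ (a : E) (r : ℝ), 0 < r → ‖a‖ < r → j a ∈ r • D := by
    intro a r hr har
    refine ⟨j (r⁻¹ • a), hj2 ⟨_, ?_, rfl⟩, ?_⟩
    · rw [mem_ball_zero_iff, norm_smul, norm_inv, Real.norm_of_nonneg hr.le,
        inv_mul_lt_iff₀ hr]
      simpa using har
    · change r • j (r⁻¹ • a) = j a
      rw [← Complex.coe_smul, ← map_smul, Complex.coe_smul, smul_smul, mul_inv_cancel₀ hr.ne',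
        one_smul]
  have hgauge : ∀ a : E, gauge D (j a) ≤ ‖a‖ := by
    intro a
    refine le_of_forall_pos_le_add fun ε hε => ?_
    exact gauge_le_of_mem (by positivity) (hmemD a _ (by positivity) (by linarith))
  have hK : IsBornCompact (j '' insert 0 (Set.range l)) := by
    refine ⟨D, hDb, hD, ?_, ?_⟩
    · rintro _ ⟨a, -, rfl⟩
      obtain ⟨y, hy, hy'⟩ := hmemD a (‖a‖ + 1) (by positivity) (by linarith)
      rw [← hy']
      change (‖a‖ + 1) • y ∈ _
      rw [← Complex.coe_smul]
      exact Submodule.smul_mem _ _ (Submodule.subset_span hy)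
    · intro x hx
      choose a ha ha' using hx
      obtain ⟨b, hb, k, hk, hlim⟩ := hcomp.isSeqCompact ha
      refine ⟨j b, ⟨b, hb, rfl⟩, k, hk, ?_⟩
      refine squeeze_zero (fun n => gauge_nonneg _) (fun n => ?_)
        (tendsto_iff_norm_sub_tendsto_zero.1 hlim)
      rw [← ha', ← map_sub]
      exact hgauge _
  obtain ⟨B, hB, hAPB⟩ := hAP _ hK
  obtain ⟨D', hBD', hD'b, hD'⟩ := CompleteBornological.exists_disk
    (Set.image2 (fun (v : V) (x : W) => ctmul v x) B t ∪ {0})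
    ((isBoundedMap₂_ctmul B t hB ht).union isBounded_singleton)
  let c' : preTensor V W := ⟨fun p => (w p : ℂ) * c.1 p, by
    refine ⟨?_, s, t, hs, ht, ?_⟩
    · refine hws.congr fun p => ?_
      rw [norm_mul, Complex.norm_real, Real.norm_of_nonneg (hw0 p).le]
    · intro p hp
      refine hst p fun h => hp ?_
      change (w p : ℂ) * c.1 p = 0
      rw [h, mul_zero]⟩
  have hc'0 : 0 ≤ l1norm c' := tsum_nonneg fun p => norm_nonneg _
  refine eq_zero_of_forall_mem_smul
    (CompleteBornological.isBounded_smul ((l1norm c' + 1 : ℝ) : ℂ) D' hD'b) fun ε hε => ?_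
  obtain ⟨F, hFb, hFfin, hFB⟩ := hAPB ε hε
  let F' : BL V V := ⟨F, hFb⟩
  -- the slices vanish, so the finite rank approximation vanishes
  have hF0 : BL.tmap F' (BL.id W) (CTensor.mkQ V W c) = 0 := by
    -- In a basis `b i` of the range, `(F ⊗ ι)(u) = ∑ b i ⊗ (f i ⊗ ι)(u)` for the bounded coordinate
    -- functionals `f i`, and every slice of `u` is zero.
    let b := Module.finBasis ℂ (LinearMap.range F)
    let f : Fin (Module.finrank ℂ (LinearMap.range F)) → BL V ℂ := fun i =>
      ⟨(b.coord i).comp F.rangeRestrict, isBoundedMap_comp_of_finiteDimensional F hFb _⟩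
    have hf : ∀ v, F v = ∑ i, f i v • (b i : V) := by
      intro v
      have := congrArg Subtype.val (b.sum_repr (F.rangeRestrict v))
      rw [Submodule.coe_sum] at this
      exact this.symm
    let T : CTensor V W →ₗ[ℂ] CTensor V W :=
      ∑ i, (BL.tl W (b i : V)).toLinearMap.comp (BL.sl (f i)).toLinearMap
    have hTb : IsBoundedMap T := by
      suffices ∀ I : Finset (Fin (Module.finrank ℂ (LinearMap.range F))), IsBoundedMap
        (∑ i ∈ I, (BL.tl W (b i : V)).toLinearMap.comp (BL.sl (f i)).toLinearMap :
          CTensor V W →ₗ[ℂ] CTensor V W) from this _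
      intro I
      induction I using Finset.induction_on with
      | empty => exact (BL.zero (CTensor V W) (CTensor V W)).bounded
      | insert i I hi ih =>
        rw [Finset.sum_insert hi]
        intro S hS
        refine (CompleteBornological.isBounded_add _ _
          (((BL.tl W (b i : V)).comp (BL.sl (f i))).bounded S hS) (ih S hS)).subset ?_
        rintro _ ⟨x, hx, rfl⟩
        exact ⟨_, ⟨x, hx, rfl⟩, _, ⟨x, hx, rfl⟩, rfl⟩
    have hTa : ∀ x, T x = ∑ i, ctmul (b i : V) (BL.sl (f i) x) := by
      intro x
      simp [T, LinearMap.sum_apply]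
    have := BL.congr (f := BL.tmap F' (BL.id W)) (g := ⟨T, hTb⟩) (fun v x => by
      rw [BL.tmap_ctmul]
      change ctmul (F v) x = T _
      rw [hTa, hf]
      simp only [BL.sl_ctmul, ctmul_smul, ← smul_ctmul]
      change BL.tr V x _ = ∑ i, BL.tr V x _
      rw [map_sum]) (CTensor.mkQ V W c)
    rw [this]
    change T _ = 0
    rw [hTa]
    refine Finset.sum_eq_zero fun i _ => ?_
    rw [hu]
    exact (BL.tl W (b i : V)).toLinearMap.map_zero
  -- Consequently `(G ⊗ ι)(u) = -u` for `G = F - ι`, and it remains to see that `(G ⊗ ι)(u)` is of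
  -- size `ε`.
  let G : BL V V := BL.subt F' (BL.id V)
  have hG : BL.tmap G (BL.id W) (CTensor.mkQ V W c) = - CTensor.mkQ V W c := by
    have := BL.congr (f := BL.tmap G (BL.id W))
      (g := BL.subt (BL.tmap F' (BL.id W)) (BL.id _)) (fun v x => by
        simp only [BL.tmap_ctmul, BL.subt_apply, BL.id_apply, G]
        change BL.tr V x (F' v - v) = BL.tr V x _ - BL.tr V x _
        rw [map_sub]) (CTensor.mkQ V W c)
    rw [this, BL.subt_apply, hF0, zero_sub, BL.id_apply]
  have hsm := isBornSum_apply (σ := RingHom.id ℂ) (BL.tmap G (BL.id W)).toLinearMap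
    (BL.tmap G (BL.id W)).bounded c
  -- The series for `(G ⊗ ι)(u)` is rewritten with coefficients `ε w c`, so that its vectors are
  -- `ε⁻¹ G(p.1 / w) ⊗ p.2`; these lie in a fixed disk, since `G` maps the compact set into `ε • B`.
  let g : V × W → CTensor V W := fun p =>
    (ε : ℂ)⁻¹ • (((w p)⁻¹ : ℝ) : ℂ) • ctmul (G p.1) p.2
  have hε0 : (ε : ℂ) ≠ 0 := by exact_mod_cast hε.ne'
  have hsm' : IsBornSum (RingHom.id ℂ) g ((ε : ℂ) • c')
      (BL.tmap G (BL.id W) (CTensor.mkQ V W c)) := by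
    obtain ⟨B', hB', h⟩ := hsm
    refine ⟨B', hB', fun η hη => ?_⟩
    obtain ⟨F₀, hF₀⟩ := h η hη
    refine ⟨F₀, fun F hF => ?_⟩
    have h2 := hF₀ F hF
    suffices he : ∑ p ∈ F, RingHom.id ℂ (((ε : ℂ) • c').1 p) • g p =
        ∑ p ∈ F, RingHom.id ℂ (c.1 p) •
          (BL.tmap G (BL.id W)).toLinearMap (ctmul p.1 p.2) by
      rw [he]
      exact h2
    refine Finset.sum_congr rfl fun p _ => ?_
    have hwp : (w p : ℂ) ≠ 0 := by exact_mod_cast (hw0 p).ne'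
    change ((ε : ℂ) * ((w p : ℂ) * c.1 p)) • (ε : ℂ)⁻¹ • (((w p)⁻¹ : ℝ) : ℂ) • ctmul (G p.1) p.2 =
      c.1 p • BL.tmap G (BL.id W) (ctmul p.1 p.2)
    rw [BL.tmap_ctmul, smul_smul, smul_smul, BL.id_apply]
    congr 1
    push_cast
    field_simp
  have hmem := hsm'.mem_smul hD'b hD' ⟨0, hBD' (Or.inr rfl)⟩ (r := ε * (l1norm c' + 1))
    (fun p hp => by
      have hcp : c.1 p ≠ 0 := by
        intro h
        apply hp
        change (ε : ℂ) * ((w p : ℂ) * c.1 p) = 0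
        rw [h, mul_zero, mul_zero]
      have hx : (((w p)⁻¹ : ℝ) : ℂ) • p.1 ∈ j '' insert 0 (Set.range l) := by
        refine ⟨l p, Or.inr ⟨p, rfl⟩, ?_⟩
        simp only [l, hcp, if_false, map_smul, hej p hcp]
      obtain ⟨y, hy, hy'⟩ := hFB _ hx
      refine hBD' (Or.inl ⟨y, hy, p.2, (hst p hcp).2, ?_⟩)
      change ctmul y p.2 = (ε : ℂ)⁻¹ • (((w p)⁻¹ : ℝ) : ℂ) • ctmul (G p.1) p.2
      rw [← smul_ctmul, ← smul_ctmul]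
      congr 1
      have h1 : G ((((w p)⁻¹ : ℝ) : ℂ) • p.1) = (ε : ℂ) • y := by
        rw [Complex.coe_smul]
        exact hy'.symm
      rw [← map_smul, h1, smul_smul, inv_mul_cancel₀ hε0, one_smul])
    (by positivity) (by
      rw [l1norm_smul, Complex.norm_real, Real.norm_of_nonneg hε.le]
      gcongr
      linarith)
  rw [hG] at hmem
  obtain ⟨y, hy, hy'⟩ := hmem
  refine ⟨((l1norm c' + 1 : ℝ) : ℂ) • (-y), ⟨-y, ?_, rfl⟩, ?_⟩
  · have := hD'.balanced.smul_mem (a := (-1 : ℂ)) (by simp) hy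
    simpa using this
  · change (ε * (l1norm c' + 1)) • y = _ at hy'
    change ε • ((l1norm c' + 1 : ℝ) : ℂ) • (-y) = _
    rw [Complex.coe_smul, smul_smul, smul_neg, hy', neg_neg]

/-- A bornological vector space is separated by its bounded linear functionals. -/
def IsSeparated (V : Type*) [AddCommGroup V] [Module ℂ V] [Bornology V] : Prop :=
  ∀ v : V, (∀ f : BL V ℂ, f v = 0) → v = 0

/-- If `V` has the approximation property and `W` is separated, the elements of `V ⊗ W` are
determined by their slices with any separating family of bounded linear functionals on `V`. -/
theorem HasApproximationProperty.eq_zero_of_sl_family (hAP : HasApproximationProperty V)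
    (hW : IsSeparated W) {I : Type*} (g : I → BL V ℂ) (hg : ∀ v, (∀ i, g i v = 0) → v = 0)
    (u : CTensor V W) (hu : ∀ i, BL.sl (g i) u = 0) : u = 0 := by
  refine hAP.eq_zero_of_sl u fun f => hW _ fun h => ?_
  rw [BL.apply_sl]
  have : BL.sr h u = 0 := hg _ fun i => by
    rw [← BL.apply_sl, hu, map_zero]
  rw [this, map_zero]

end Approximation

end BornQG


namespace BornQG

namespace BornologicalQuantumGroup

variable {A : Type*} [NonUnitalRing A] [Module ℂ A] [IsScalarTower ℂ A A] [SMulCommClass ℂ A A]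
  [StarRing A] [StarModule ℂ A] [Bornology A] [CompleteBornological A]
  (G : BornologicalQuantumGroup A)

/-! ## The structure maps of a bornological quantum group as bounded linear maps -/

/-- Left multiplication. -/
def lm (a : A) : BL A A where
  toFun b := a * b
  map_add' := mul_add a
  map_smul' z b := mul_smul_comm z a b
  bounded' := IsBoundedMap.image2_left G.bounded_mul a

/-- Right multiplication. -/
def rm (a : A) : BL A A where
  toFun b := b * a
  map_add' b c := add_mul b c a
  map_smul' z b := smul_mul_assoc z b a
  bounded' := IsBoundedMap.image2_right G.bounded_mul a

@[simp] lemma lm_apply (a b : A) : G.lm a b = a * b := rfl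

@[simp] lemma rm_apply (a b : A) : G.rm a b = b * a := rfl

/-- The multiplication as a map on the tensor product. -/
noncomputable def mulT : BL (CTensor A A) A :=
  BL.ofLift (LinearMap.mk₂ ℂ (fun a b => a * b) add_mul smul_mul_assoc mul_add
    (fun z a b => mul_smul_comm z a b)) G.bounded_mul

@[simp] lemma mulT_ctmul (a b : A) : G.mulT (ctmul a b) = a * b :=
  BL.ofLift_ctmul _ _ a b

/-- The integral. -/
def φ : BL A ℂ := ⟨G.haar, G.haar_bounded⟩

/-- The counit. -/
def ε : BL A ℂ := ⟨G.counit, G.counit_bounded⟩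

/-- The antipode. -/
def S : BL A A := ⟨G.antipode, G.antipode_bounded⟩

/-- The inverse of the antipode. -/
def Sinv : BL A A := ⟨G.antipode.symm, G.antipode_symm_bounded⟩

lemma φ_apply (a : A) : G.φ a = G.haar a := rfl

@[simp] lemma S_Sinv (a : A) : G.S (G.Sinv a) = a := G.antipode.apply_symm_apply a

@[simp] lemma Sinv_S (a : A) : G.Sinv (G.S a) = a := G.antipode.symm_apply_apply a

@[simp] lemma S_mul (a b : A) : G.S (a * b) = G.S b * G.S a := G.antipode_mul a b

lemma S_injective : Function.Injective G.S := G.antipode.injective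

lemma starT_bounded_spec (G : BornologicalQuantumGroup A) :
     IsBoundedMap (starT : CTensor A A →ₛₗ[starRingEnd ℂ] CTensor A A) ∧
    ∀ a b : A, starT (ctmul a b) = ctmul (star a) (star b) := by
  let f : A →ₛₗ[starRingEnd ℂ] A →ₛₗ[starRingEnd ℂ] CTensor A A :=
    LinearMap.mk₂'ₛₗ (starRingEnd ℂ) (starRingEnd ℂ) (fun a b => ctmul (star a) (star b))
      (fun a a' b => by rw [star_add, add_ctmul])
      (fun z a b => by rw [star_smul, smul_ctmul]; rfl)
      (fun a b b' => by rw [star_add, ctmul_add])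
      (fun z a b => by rw [star_smul, ctmul_smul]; rfl)
  refine liftₛₗ_spec (starRingEnd ℂ) f ?_
  intro s t hs ht
  have := isBoundedMap₂_ctmul _ _ (G.bounded_star s hs) (G.bounded_star t ht)
  rwa [Set.image2_image_left, Set.image2_image_right] at this

lemma starT_ctmul (G : BornologicalQuantumGroup A) (a b : A) : starT (ctmul a b) = ctmul (star a) (star b) :=
  G.starT_bounded_spec.2 a b

/-- The conjugate of a bounded linear map by the involution. -/
noncomputable def conjT (f : BL (CTensor A A) (CTensor A A)) : BL (CTensor A A) (CTensor A A) where
  toFun u := starT (f (starT u))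
  map_add' u v := by simp only [map_add]
  map_smul' z u := by
    simp only [map_smulₛₗ, RingHom.id_apply]
    congr 1
    exact Complex.conj_conj z
  bounded' := by
    intro s hs
    have := G.starT_bounded_spec.1 _ (f.bounded _ (G.starT_bounded_spec.1 s hs))
    rwa [← Set.image_comp, ← Set.image_comp] at this

lemma conjT_apply (f : BL (CTensor A A) (CTensor A A)) (u : CTensor A A) :
    G.conjT f u = starT (f (starT u)) := rfl

@[simp] lemma starT_starT (G : BornologicalQuantumGroup A) (u : CTensor A A) : starT (starT u) = u :=
  BL.congr (f := G.conjT (BL.id _)) (g := BL.id _) (fun a b => by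
    simp [conjT_apply, G.starT_ctmul]) u

/-- `starT` is conjugate linear, so the comparison on elementary tensors is made for the linear map
`starT ∘ (f ⊗ g) ∘ starT`. -/
lemma starT_tmap (G : BornologicalQuantumGroup A) (f g f' g' : BL A A) (hf : ∀ a, star (f a) = f' (star a))
    (hg : ∀ a, star (g a) = g' (star a)) (u : CTensor A A) :
    starT (BL.tmap f g u) = BL.tmap f' g' (starT u) := by
  have := BL.congr (f := G.conjT (BL.tmap f g)) (g := BL.tmap f' g')
    (fun a b => by simp [conjT_apply, G.starT_ctmul, hf, hg]) (starT u)
  rwa [conjT_apply, G.starT_starT] at this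

/-- The product of `A ⊗ A` is an iterated linearization. Evaluating the outer one requires that `(a,
b) ↦ (a ⊗ b)u` be bilinear and jointly bounded, which is the bulk of the proof. -/
lemma ctmul_mul (c d : A) (u : CTensor A A) :
    ctmul c d * u = BL.tmap (G.lm c) (G.lm d) u := by
  have h1 : ∀ a b : A, lift (fun c d => ctmul (a * c) (b * d)) u =
      BL.tmap (G.lm a) (G.lm b) u := fun a b =>
    BL.lift_eq (BL.tmap (G.lm a) (G.lm b)) _ (fun v w => by simp) u
  change lift (fun a b => lift (fun c d => ctmul (a * c) (b * d)) u) (ctmul c d) = _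
  simp only [h1]
  let f : A →ₗ[ℂ] A →ₗ[ℂ] CTensor A A := LinearMap.mk₂ ℂ (fun a b => BL.tmap (G.lm a) (G.lm b) u)
    (fun a a' b => by
      have h := BL.congr (f := BL.subt (BL.subt (BL.tmap (G.lm (a + a')) (G.lm b))
        (BL.tmap (G.lm a) (G.lm b))) (BL.tmap (G.lm a') (G.lm b))) (g := BL.zero _ _)
        (fun x y => by simp [add_mul, add_ctmul]) u
      simp only [BL.subt_apply, BL.zero_apply] at h
      rwa [sub_sub, sub_eq_zero] at h)
    (fun z a b => BL.congr (f := BL.tmap (G.lm (z • a)) (G.lm b))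
      (g := BL.smulc z (BL.tmap (G.lm a) (G.lm b))) (fun x y => by simp [smul_mul_assoc, smul_ctmul]) u)
    (fun a b b' => by
      have h := BL.congr (f := BL.subt (BL.subt (BL.tmap (G.lm a) (G.lm (b + b')))
        (BL.tmap (G.lm a) (G.lm b))) (BL.tmap (G.lm a) (G.lm b'))) (g := BL.zero _ _)
        (fun x y => by simp [add_mul, ctmul_add]) u
      simp only [BL.subt_apply, BL.zero_apply] at h
      rwa [sub_sub, sub_eq_zero] at h)
    (fun z a b => BL.congr (f := BL.tmap (G.lm a) (G.lm (z • b)))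
      (g := BL.smulc z (BL.tmap (G.lm a) (G.lm b))) (fun x y => by simp [smul_mul_assoc, ctmul_smul]) u)
  refine (lift_spec f ?_).2 c d
  intro s t hs ht
  have := BL.isBoundedMap₂_of_ctmul (Y := A × A)
    (fun p => BL.tmap (G.lm p.1) (G.lm p.2)) (fun S s' t' hS hs' ht' => by
      refine (isBoundedMap₂_ctmul _ _
        (G.bounded_mul _ _ (Bornology.IsBounded.image_fst hS) hs')
        (G.bounded_mul _ _ (Bornology.IsBounded.image_snd hS) ht')).subset ?_
      rintro _ ⟨p, hp, v, hv, w, hw, rfl⟩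
      exact ⟨_, ⟨p.1, ⟨p, hp, rfl⟩, v, hv, rfl⟩, _, ⟨p.2, ⟨p, hp, rfl⟩, w, hw, rfl⟩, by simp⟩)
    (s ×ˢ t) {u} (hs.prod ht) isBounded_singleton
  refine this.subset ?_
  rintro _ ⟨a, ha, b, hb, rfl⟩
  exact ⟨(a, b), ⟨ha, hb⟩, u, rfl, rfl⟩

lemma mul_ctmul (c d : A) (u : CTensor A A) :
    u * ctmul c d = BL.tmap (G.rm c) (G.rm d) u := by
  have h1 : ∀ a b : A, lift (fun c d => ctmul (a * c) (b * d)) (ctmul c d) =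
      ctmul (a * c) (b * d) := fun a b => by
    rw [BL.lift_eq (BL.tmap (G.lm a) (G.lm b)) _ (fun v w => by simp)]
    simp
  change lift (fun a b => lift (fun c d => ctmul (a * c) (b * d)) (ctmul c d)) u = _
  simp only [h1]
  exact BL.lift_eq (BL.tmap (G.rm c) (G.rm d)) _ (fun v w => by simp) u

lemma mulLeft₁_eq (b : A) (u : CTensor A A) :
    mulLeft₁ b u = BL.tmap (G.lm b) (BL.id A) u := BL.lift_eq _ _ (fun v w => by simp) u

lemma mulLeft₂_eq (b : A) (u : CTensor A A) :
    mulLeft₂ b u = BL.tmap (BL.id A) (G.lm b) u := BL.lift_eq _ _ (fun v w => by simp) u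

lemma mulRight₁_eq (b : A) (u : CTensor A A) :
    mulRight₁ u b = BL.tmap (G.rm b) (BL.id A) u := BL.lift_eq _ _ (fun v w => by simp) u

lemma mulRight₂_eq (b : A) (u : CTensor A A) :
    mulRight₂ u b = BL.tmap (BL.id A) (G.rm b) u := BL.lift_eq _ _ (fun v w => by simp) u

/-- Left multiplication with `Δ(a)`. -/
def dL (a : A) : BL (CTensor A A) (CTensor A A) := ⟨(G.comul a).left, (G.comul a).bounded_left⟩

/-- Right multiplication with `Δ(a)`. -/
def dR (a : A) : BL (CTensor A A) (CTensor A A) := ⟨(G.comul a).right, (G.comul a).bounded_right⟩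

/-- The map `a ⊗ b ↦ Δ(a) (b ⊗ 1)`. -/
def gL : BL (CTensor A A) (CTensor A A) := ⟨G.galoisL, G.galoisL_bounded⟩

/-- The map `b ⊗ a ↦ (1 ⊗ b) Δ(a)`. -/
def gR : BL (CTensor A A) (CTensor A A) := ⟨G.galoisR, G.galoisR_bounded⟩

/-- The map `b ⊗ a ↦ (b ⊗ 1) Δ(a)`. -/
noncomputable def gLs : BL (CTensor A A) (CTensor A A) := (G.conjT G.gL).comp (BL.swap A A)

/-- The map `a ⊗ b ↦ Δ(a) (1 ⊗ b)`. -/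
noncomputable def gRs : BL (CTensor A A) (CTensor A A) := (G.conjT G.gR).comp (BL.swap A A)

lemma gLs_ctmul (b a : A) : G.gLs (ctmul b a) = starT (G.galoisL (ctmul (star a) (star b))) := by
  simp only [gLs, BL.comp_apply, BL.swap_ctmul, conjT_apply, G.starT_ctmul]
  rfl

lemma gRs_ctmul (a b : A) : G.gRs (ctmul a b) = starT (G.galoisR (ctmul (star b) (star a))) := by
  simp only [gRs, BL.comp_apply, BL.swap_ctmul, conjT_apply, G.starT_ctmul]
  rfl

lemma starT_gLs (b a : A) : starT (G.gLs (ctmul b a)) = G.gL (ctmul (star a) (star b)) := by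
  rw [gLs_ctmul, G.starT_starT]
  rfl

lemma starT_gRs (a b : A) : starT (G.gRs (ctmul a b)) = G.gR (ctmul (star b) (star a)) := by
  rw [gRs_ctmul, G.starT_starT]
  rfl

/-! ### Multiplier relations -/

lemma dL_tmap_rm (a c d : A) (u : CTensor A A) :
    G.dL a (BL.tmap (G.rm c) (G.rm d) u) = BL.tmap (G.rm c) (G.rm d) (G.dL a u) := by
  rw [← mul_ctmul, ← mul_ctmul]
  exact (G.comul a).left_mul _ _

lemma tmap_rm_gL (a b c d : A) :
    BL.tmap (G.rm c) (G.rm d) (G.gL (ctmul a b)) = G.dL a (ctmul (b * c) d) := by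
  rw [← mul_ctmul]
  refine (G.galoisL_mul a b (ctmul c d)).trans ?_
  rw [G.mulLeft₁_eq, BL.tmap_ctmul]
  rfl

lemma tmap_lm_gL (a b c d : A) :
    BL.tmap (G.lm c) (G.lm d) (G.gL (ctmul a b)) =
      BL.tmap (G.rm b) (BL.id A) (G.dR a (ctmul c d)) := by
  rw [← ctmul_mul]
  refine (G.mul_galoisL a b (ctmul c d)).trans ?_
  rw [G.mulRight₁_eq]
  rfl

lemma tmap_rm_gR (a b c d : A) :
    BL.tmap (G.rm c) (G.rm d) (G.gR (ctmul b a)) =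
      BL.tmap (BL.id A) (G.lm b) (G.dL a (ctmul c d)) := by
  rw [← mul_ctmul]
  refine (G.galoisR_mul b a (ctmul c d)).trans ?_
  rw [G.mulLeft₂_eq]
  rfl

lemma tmap_lm_gR (a b c d : A) :
    BL.tmap (G.lm c) (G.lm d) (G.gR (ctmul b a)) = G.dR a (ctmul c (d * b)) := by
  rw [← ctmul_mul]
  refine (G.mul_galoisR b a (ctmul c d)).trans ?_
  rw [G.mulRight₂_eq, BL.tmap_ctmul]
  rfl

lemma dL_eq_starT (a : A) (u : CTensor A A) : G.dL a u = starT (G.dR (star a) (starT u)) := by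
  have := G.comul_star_left (star a) u
  rwa [star_star] at this

lemma starT_tmap_lm_rm (c d : A) (u : CTensor A A) :
    starT (BL.tmap (G.lm c) (G.lm d) u) = BL.tmap (G.rm (star c)) (G.rm (star d)) (starT u) :=
  G.starT_tmap _ _ _ _ (fun a => star_mul c a) (fun a => star_mul d a) u

lemma tmap_rm_gLs (a b c d : A) :
    BL.tmap (G.rm c) (G.rm d) (G.gLs (ctmul b a)) =
      BL.tmap (G.lm b) (BL.id A) (G.dL a (ctmul c d)) := by
  rw [dL_eq_starT, G.starT_ctmul, gLs_ctmul]
  have h := G.tmap_lm_gL (star a) (star b) (star c) (star d)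
  have h2 := congrArg starT h
  rw [G.starT_tmap_lm_rm, star_star, star_star] at h2
  refine h2.trans ?_
  exact G.starT_tmap _ _ (G.lm b) (BL.id A) (fun x => by simp) (fun x => rfl) _

lemma tmap_rm_gRs (a b c d : A) :
    BL.tmap (G.rm c) (G.rm d) (G.gRs (ctmul a b)) = G.dL a (ctmul c (b * d)) := by
  rw [dL_eq_starT, G.starT_ctmul, gRs_ctmul]
  have h := G.tmap_lm_gR (star a) (star b) (star c) (star d)
  have h2 := congrArg starT h
  rw [G.starT_tmap_lm_rm, star_star, star_star] at h2
  rw [star_mul]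
  exact h2

/-! ### Nondegeneracy -/

lemma haar_mul_star_self {a : A} (h : G.φ (a * star a) = 0) : a = 0 := by
  have := G.haar_faithful (star a) (by rwa [star_star])
  simpa using congrArg star this

/-- Faithfulness of `φ`, applied with `x = (a - b)*`. -/
lemma eq_of_haar_mul_right {a b : A} (h : ∀ x, G.φ (a * x) = G.φ (b * x)) : a = b := by
  rw [← sub_eq_zero]
  refine G.haar_mul_star_self ?_
  rw [sub_mul, map_sub, h, sub_self]

lemma eq_of_haar_mul_left {a b : A} (h : ∀ x, G.φ (x * a) = G.φ (x * b)) : a = b := by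
  rw [← sub_eq_zero]
  refine G.haar_faithful _ ?_
  change G.φ (star (a - b) * (a - b)) = 0
  rw [mul_sub, map_sub, h, sub_self]

lemma eq_of_mul_right (G : BornologicalQuantumGroup A) {a b : A} (h : ∀ x, a * x = b * x) : a = b :=
  G.eq_of_haar_mul_right fun x => by rw [h]

lemma eq_of_mul_left (G : BornologicalQuantumGroup A) {a b : A} (h : ∀ x, x * a = x * b) : a = b :=
  G.eq_of_haar_mul_left fun x => by rw [h]

lemma isSeparated (G : BornologicalQuantumGroup A) : IsSeparated A := fun a h =>
  G.eq_of_haar_mul_right fun x => by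
    rw [zero_mul, map_zero]
    exact h (G.φ.comp (G.rm x))

variable {W : Type*} [AddCommGroup W] [Module ℂ W] [Bornology W] [CompleteBornological W]

/-- The functionals `φ(· c)` separate the points of `A` and factor through right multiplication by
`c`, so the approximation property applies. -/
lemma eq_of_tmap_rm_left (hW : IsSeparated W) {u v : CTensor A W}
    (h : ∀ c, BL.tmap (G.rm c) (BL.id W) u = BL.tmap (G.rm c) (BL.id W) v) : u = v := by
  rw [← sub_eq_zero]
  refine G.approximation.eq_zero_of_sl_family hW (fun c => G.φ.comp (G.rm c))
    (fun a ha => G.eq_of_haar_mul_right fun x => by rw [zero_mul, map_zero]; exact ha x) _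
    fun c => ?_
  have := BL.sl_tmap G.φ (G.rm c) (BL.id W) (u - v)
  rw [BL.id_apply] at this
  rw [← this, map_sub, h, sub_self, map_zero]

lemma eq_of_tmap_lm_left (hW : IsSeparated W) {u v : CTensor A W}
    (h : ∀ c, BL.tmap (G.lm c) (BL.id W) u = BL.tmap (G.lm c) (BL.id W) v) : u = v := by
  rw [← sub_eq_zero]
  refine G.approximation.eq_zero_of_sl_family hW (fun c => G.φ.comp (G.lm c))
    (fun a ha => G.eq_of_haar_mul_left fun x => by rw [mul_zero, map_zero]; exact ha x) _
    fun c => ?_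
  have := BL.sl_tmap G.φ (G.lm c) (BL.id W) (u - v)
  rw [BL.id_apply] at this
  rw [← this, map_sub, h, sub_self, map_zero]

lemma eq_of_tmap_rm_right {u v : CTensor A A}
    (h : ∀ c, BL.tmap (BL.id A) (G.rm c) u = BL.tmap (BL.id A) (G.rm c) v) : u = v := by
  rw [← BL.swap_swap u, ← BL.swap_swap v]
  refine congrArg _ (G.eq_of_tmap_rm_left G.isSeparated fun c => ?_)
  rw [← BL.swap_tmap, ← BL.swap_tmap, h]

lemma eq_of_tmap_lm_right {u v : CTensor A A}
    (h : ∀ c, BL.tmap (BL.id A) (G.lm c) u = BL.tmap (BL.id A) (G.lm c) v) : u = v := by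
  rw [← BL.swap_swap u, ← BL.swap_swap v]
  refine congrArg _ (G.eq_of_tmap_lm_left G.isSeparated fun c => ?_)
  rw [← BL.swap_tmap, ← BL.swap_tmap, h]

lemma eq_of_tmap_rm {u v : CTensor A A}
    (h : ∀ c d, BL.tmap (G.rm c) (G.rm d) u = BL.tmap (G.rm c) (G.rm d) v) : u = v := by
  refine G.eq_of_tmap_rm_left G.isSeparated fun c => G.eq_of_tmap_rm_right fun d => ?_
  rw [BL.tmap_tmap, BL.tmap_tmap]
  exact h c d

lemma eq_of_tmap_lm {u v : CTensor A A}
    (h : ∀ c d, BL.tmap (G.lm c) (G.lm d) u = BL.tmap (G.lm c) (G.lm d) v) : u = v := by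
  refine G.eq_of_tmap_lm_left G.isSeparated fun c => G.eq_of_tmap_lm_right fun d => ?_
  rw [BL.tmap_tmap, BL.tmap_tmap]
  exact h c d

/-! ### Relations between the Galois maps -/

lemma tmap_comm {f g f' g' : BL A A} (hf : ∀ x, f (f' x) = f' (f x)) (hg : ∀ x, g (g' x) = g' (g x))
    (u : CTensor A A) : BL.tmap f g (BL.tmap f' g' u) = BL.tmap f' g' (BL.tmap f g u) :=
  BL.congr (f := (BL.tmap f g).comp (BL.tmap f' g')) (g := (BL.tmap f' g').comp (BL.tmap f g))
    (fun a b => by simp [hf, hg]) u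

lemma tmap_rm_rm_left (a b c : A) (u : CTensor A A) :
    BL.tmap (G.rm a) (G.rm b) (BL.tmap (G.rm c) (BL.id A) u) =
      BL.tmap (G.rm (c * a)) (G.rm b) u :=
  BL.congr (f := (BL.tmap (G.rm a) (G.rm b)).comp (BL.tmap (G.rm c) (BL.id A)))
    (g := BL.tmap (G.rm (c * a)) (G.rm b)) (fun x y => by simp [mul_assoc]) u

lemma tmap_rm_rm_right (a b c : A) (u : CTensor A A) :
    BL.tmap (G.rm a) (G.rm b) (BL.tmap (BL.id A) (G.rm c) u) =
      BL.tmap (G.rm a) (G.rm (c * b)) u :=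
  BL.congr (f := (BL.tmap (G.rm a) (G.rm b)).comp (BL.tmap (BL.id A) (G.rm c)))
    (g := BL.tmap (G.rm a) (G.rm (c * b))) (fun x y => by simp [mul_assoc]) u

lemma tmap_rm_lm_left (a b c : A) (u : CTensor A A) :
    BL.tmap (G.rm a) (G.rm b) (BL.tmap (G.lm c) (BL.id A) u) =
      BL.tmap (G.lm c) (BL.id A) (BL.tmap (G.rm a) (G.rm b) u) :=
  tmap_comm (fun x => by simp [mul_assoc]) (fun x => by simp) u

lemma tmap_rm_lm_right (a b c : A) (u : CTensor A A) :
    BL.tmap (G.rm a) (G.rm b) (BL.tmap (BL.id A) (G.lm c) u) =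
      BL.tmap (BL.id A) (G.lm c) (BL.tmap (G.rm a) (G.rm b) u) :=
  tmap_comm (fun x => by simp) (fun x => by simp [mul_assoc]) u

/-- Both sides are `(1 ⊗ c)Δ(a)(b ⊗ 1)`. The relations up to `dL_ctmul` express in the same way that
`Δ` takes values in multipliers; most are verified by multiplying with `p ⊗ q` from the right. -/
lemma lm_right_gL (a b c : A) : BL.tmap (BL.id A) (G.lm c) (G.gL (ctmul a b)) =
    BL.tmap (G.rm b) (BL.id A) (G.gR (ctmul c a)) := by
  refine G.eq_of_tmap_rm fun p q => ?_
  rw [tmap_rm_lm_right, tmap_rm_gL, tmap_rm_rm_left, tmap_rm_gR]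

lemma rm_right_gL (a b c : A) : BL.tmap (BL.id A) (G.rm c) (G.gL (ctmul a b)) =
    BL.tmap (G.rm b) (BL.id A) (G.gRs (ctmul a c)) := by
  refine G.eq_of_tmap_rm fun p q => ?_
  rw [tmap_rm_rm_right, tmap_rm_gL, tmap_rm_rm_left, tmap_rm_gRs]

lemma lm_right_gRs (a b c : A) : BL.tmap (BL.id A) (G.lm c) (G.gRs (ctmul a b)) =
    BL.tmap (BL.id A) (G.rm b) (G.gR (ctmul c a)) := by
  refine G.eq_of_tmap_rm fun p q => ?_
  rw [tmap_rm_lm_right, tmap_rm_gRs, tmap_rm_rm_right, tmap_rm_gR]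

lemma lm_left_gRs (a b c : A) : BL.tmap (G.lm c) (BL.id A) (G.gRs (ctmul a b)) =
    BL.tmap (BL.id A) (G.rm b) (G.gLs (ctmul c a)) := by
  refine G.eq_of_tmap_rm fun p q => ?_
  rw [tmap_rm_lm_left, tmap_rm_gRs, tmap_rm_rm_right, tmap_rm_gLs]

lemma lm_left_gR (a b c : A) : BL.tmap (G.lm c) (BL.id A) (G.gR (ctmul b a)) =
    BL.tmap (BL.id A) (G.lm b) (G.gLs (ctmul c a)) := by
  refine G.eq_of_tmap_rm fun p q => ?_
  rw [tmap_rm_lm_left, tmap_rm_gR, tmap_rm_lm_right, tmap_rm_gLs]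
  exact tmap_comm (f := G.lm c) (g := BL.id A) (f' := BL.id A) (g' := G.lm b)
    (fun x => rfl) (fun x => rfl) _

lemma rm_right_gRs (a b c : A) : BL.tmap (BL.id A) (G.rm c) (G.gRs (ctmul a b)) =
    G.gRs (ctmul a (b * c)) := by
  refine G.eq_of_tmap_rm fun p q => ?_
  rw [tmap_rm_rm_right, tmap_rm_gRs, tmap_rm_gRs, mul_assoc]

lemma lm_right_gR (a b c : A) : BL.tmap (BL.id A) (G.lm c) (G.gR (ctmul b a)) =
    G.gR (ctmul (c * b) a) := by
  refine G.eq_of_tmap_rm fun p q => ?_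
  rw [tmap_rm_lm_right, tmap_rm_gR, tmap_rm_gR, BL.tmap_tmap]
  congr 2
  ext x
  simp [mul_assoc]

lemma dL_mul (a b : A) (u : CTensor A A) : G.dL (a * b) u = G.dL a (G.dL b u) :=
  G.comul_mul_left a b u

lemma dL_gL (a b c : A) : G.dL a (G.gL (ctmul b c)) = G.gL (ctmul (a * b) c) := by
  refine G.eq_of_tmap_rm fun p q => ?_
  rw [← dL_tmap_rm, tmap_rm_gL, tmap_rm_gL, dL_mul]

lemma dL_ctmul (a b c : A) : G.dL a (ctmul b c) = BL.tmap (G.rm b) (BL.id A) (G.gRs (ctmul a c)) := by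
  refine G.eq_of_tmap_rm fun p q => ?_
  rw [← dL_tmap_rm, tmap_rm_rm_left, tmap_rm_gRs, BL.tmap_ctmul]
  rfl

/-! ### The axioms for the integral, the counit and the antipode -/

lemma lift_sr (u : CTensor A A) : lift (fun x y => G.haar y • x) u = BL.sr G.φ u :=
  BL.lift_eq (BL.sr G.φ) _ (fun x y => by simp [φ_apply]) u

lemma lift_sl (u : CTensor A A) : lift (fun x y => G.haar x • y) u = BL.sl G.φ u :=
  BL.lift_eq (BL.sl G.φ) _ (fun x y => by simp [φ_apply]) u

lemma sr_gL (a b : A) : BL.sr G.φ (G.gL (ctmul a b)) = G.φ a • b := by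
  rw [← lift_sr]
  exact G.haar_left_invariant a b

lemma sl_counit_gR (a b : A) : BL.sl G.ε (G.gR (ctmul b a)) = b * a := by
  rw [← G.counit_left a b]
  exact (BL.lift_eq (BL.sl G.ε) _ (fun x y => BL.sl_ctmul _ _ _) _).symm

/-- The map `a ⊗ b ↦ S(a) b`. -/
noncomputable def mulS : BL (CTensor A A) A := G.mulT.comp (BL.tmap G.S (BL.id A))

@[simp] lemma mulS_ctmul (a b : A) : G.mulS (ctmul a b) = G.S a * b := by
  simp [mulS]

lemma mulS_gRs (a b : A) : G.mulS (G.gRs (ctmul a b)) = G.ε a • b := by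
  refine Eq.trans ?_ (G.antipode_left a b)
  rw [gRs_ctmul]
  exact (BL.lift_eq G.mulS _ (fun x y => G.mulS_ctmul x y) _).symm

/-- After multiplication by `e` from the right this becomes `S(b)S(a₁)a₂e = ε(a)S(b)e`, which is the
antipode axiom for `Δ(a)(1 ⊗ e)`. -/
lemma mulS_gL (a b : A) : G.mulS (G.gL (ctmul a b)) = G.ε a • G.S b := by
  refine G.eq_of_mul_right fun e => ?_
  have h1 := BL.congr (f := (G.rm e).comp G.mulS)
    (g := G.mulS.comp (BL.tmap (BL.id A) (G.rm e))) (fun x y => by simp [mul_assoc])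
    (G.gL (ctmul a b))
  have h2 := BL.congr (f := (G.lm (G.S b)).comp G.mulS)
    (g := G.mulS.comp (BL.tmap (G.rm b) (BL.id A))) (fun x y => by simp [mul_assoc])
    (G.gRs (ctmul a e))
  simp only [BL.comp_apply, rm_apply, lm_apply] at h1 h2
  rw [h1, rm_right_gL, ← h2, mulS_gRs]
  rw [mul_smul_comm, smul_mul_assoc]

lemma gL_S_S (a b : A) : G.gL (ctmul (G.S a) (G.S b)) =
    BL.swap A A (BL.tmap G.S G.S (G.gR (ctmul b a))) := by
  refine (G.antipode_comul a b).trans ?_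
  exact BL.lift_eq ((BL.swap A A).comp (BL.tmap G.S G.S)) _ (fun x y => by simp; rfl) _

/-- Coassociativity. -/
lemma tmap_gL_gR (a b c : A) :
    BL.tmap (G.gL.comp (BL.tr A b)) (BL.id A) (G.gR (ctmul c a)) =
      BL.assocL A A A (BL.tmap (BL.id A) (G.gR.comp (BL.tl A c)) (G.gL (ctmul a b))) := by
  have h := G.coassoc a b c
  rw [BL.lift_eq ((BL.assocR A A A).comp (BL.tmap (G.gL.comp (BL.tr A b)) (BL.id A))) _
    (fun x y => ?_), BL.lift_eq (BL.tmap (BL.id A) (G.gR.comp (BL.tl A c))) _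
    (fun x y => ?_)] at h
  · have h2 := congrArg (BL.assocL A A A) h
    simp only [BL.comp_apply, BL.assocL_assocR] at h2
    exact h2
  · rw [BL.tmap_ctmul]
    rfl
  · simp only [BL.comp_apply, BL.tmap_ctmul, BL.id_apply, BL.tr_apply]
    exact (BL.lift_eq ((BL.assocR A A A).comp (BL.tr _ y)) _ (fun p q => by simp) _).symm

lemma tmap_mulS_assocL (x : A) (w : CTensor A A) :
    BL.tmap G.mulS (BL.id A) (BL.assocL A A A (ctmul x w)) = BL.tmap (G.lm (G.S x)) (BL.id A) w :=
  BL.congr (f := (BL.tmap G.mulS (BL.id A)).comp ((BL.assocL A A A).comp (BL.tl _ x)))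
    (g := BL.tmap (G.lm (G.S x)) (BL.id A)) (fun a b => by simp) w

/-- `S(a₁ d) a₂ ⊗ c a₃ = S(d) ⊗ c a`. -/
lemma mulS_coassoc (a c d : A) :
    BL.tmap G.mulS (BL.id A)
      (BL.assocL A A A (BL.tmap (BL.id A) (G.gR.comp (BL.tl A c)) (G.gL (ctmul a d)))) =
      ctmul (G.S d) (c * a) := by
  rw [← tmap_gL_gR, BL.tmap_tmap, ← sl_counit_gR]
  refine BL.congr (f := BL.tmap (G.mulS.comp (G.gL.comp (BL.tr A d))) ((BL.id A).comp (BL.id A)))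
    (g := (BL.tl A (G.S d)).comp (BL.sl G.ε)) (fun x y => ?_) _
  simp [mulS_gL, smul_ctmul, ctmul_smul]

/-- The map `b ⊗ a ↦ (b ⊗ 1) Δ(a)` has a bounded linear right inverse. -/
lemma gLs_inv (a b : A) :
    G.gLs (BL.tmap G.S (BL.id A) (G.gL (ctmul a (G.Sinv b)))) = ctmul b a := by
  refine G.eq_of_tmap_lm_right fun c => ?_
  -- Multiplied by `1 ⊗ c`, the claim reads `bS(a₁)a₂ ⊗ ca₃ = b ⊗ ca`, the case `d = S⁻¹(b)` of
  -- `mulS_coassoc`.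
  have h := BL.congr
    (f := (BL.tmap (BL.id A) (G.lm c)).comp (G.gLs.comp (BL.tmap G.S (BL.id A))))
    (g := (BL.tmap G.mulS (BL.id A)).comp ((BL.assocL A A A).comp
      (BL.tmap (BL.id A) (G.gR.comp (BL.tl A c))))) (fun x y => by
        simp only [BL.comp_apply, BL.tmap_ctmul, BL.id_apply, BL.tl_apply]
        rw [tmap_mulS_assocL, lm_left_gR]) (G.gL (ctmul a (G.Sinv b)))
  simp only [BL.comp_apply] at h
  rw [h, mulS_coassoc, S_Sinv, BL.tmap_ctmul]
  rfl

end BornologicalQuantumGroup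

end BornQG


namespace BornQG

namespace BornologicalQuantumGroup

variable {A : Type*} [NonUnitalRing A] [Module ℂ A] [IsScalarTower ℂ A A] [SMulCommClass ℂ A A]
  [StarRing A] [StarModule ℂ A] [Bornology A] [CompleteBornological A]
  (G : BornologicalQuantumGroup A)

/-! ### Strong left invariance -/

/-- The map `a ⊗ u ↦ Δ(a) u`. -/
noncomputable def act : BL (CTensor A (CTensor A A)) (CTensor A A) :=
  BL.ofLift (LinearMap.mk₂ ℂ (fun a u => G.dL a u)
    (fun a b u => LinearMap.congr_fun (G.comul_linear_left.map_add a b) u)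
    (fun z a u => LinearMap.congr_fun (G.comul_linear_left.map_smul z a) u)
    (fun a u v => map_add _ _ _) (fun z a u => map_smul _ _ _)) G.comul_bounded_left

@[simp] lemma act_ctmul (a : A) (u : CTensor A A) : G.act (ctmul a u) = G.dL a u :=
  BL.ofLift_ctmul _ _ a u

/-- The map `(p ⊗ y) ⊗ w ↦ (S(p) ⊗ c) Δ(y) w`. -/
noncomputable def actS (c : A) : BL (CTensor (CTensor A A) (CTensor A A)) (CTensor A A) :=
  (BL.tmap (BL.id A) (G.lm c)).comp <| (BL.tmap G.mulS (BL.id A)).comp <|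
    (BL.assocL A A A).comp <| (BL.tmap (BL.id A) G.act).comp (BL.assocR A A (CTensor A A))

lemma actS_ctmul (c p y : A) (w : CTensor A A) :
    G.actS c (ctmul (ctmul p y) w) =
      BL.tmap (BL.id A) (G.lm c) (BL.tmap (G.lm (G.S p)) (BL.id A) (G.dL y w)) := by
  simp [actS, tmap_mulS_assocL]

lemma lm_right_dL (c y a b : A) : BL.tmap (BL.id A) (G.lm c) (G.dL y (ctmul a b)) =
    BL.tmap (G.rm a) (G.rm b) (G.gR (ctmul c y)) := (G.tmap_rm_gR y c a b).symm

/-- In Sweedler notation the left side is `(S(y₁d) ⊗ c)Δ(y₂)w`, and `S(y₁d)y₂ ⊗ cy₃ = S(d) ⊗ cy`. -/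
lemma actS_gL (c d y : A) (w : CTensor A A) :
    G.actS c (ctmul (G.gL (ctmul y d)) w) = BL.tmap (G.lm (G.S d)) (G.lm (c * y)) w := by
  refine BL.congr (f := (G.actS c).comp (BL.tl _ (G.gL (ctmul y d)))) (fun a b => ?_) w
  have h := BL.congr (f := (G.actS c).comp (BL.tr _ (ctmul a b)))
    (g := (BL.tmap (G.rm a) (G.rm b)).comp ((BL.tmap G.mulS (BL.id A)).comp
      ((BL.assocL A A A).comp (BL.tmap (BL.id A) (G.gR.comp (BL.tl A c)))))) (fun p y => by
        simp only [BL.comp_apply, BL.tmap_ctmul, BL.id_apply, BL.tl_apply, BL.tr_apply]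
        rw [actS_ctmul, tmap_mulS_assocL, tmap_rm_lm_left, ← lm_right_dL]
        exact tmap_comm (f := BL.id A) (g := G.lm c) (f' := G.lm (G.S p)) (g' := BL.id A)
          (fun x => rfl) (fun x => rfl) _) (G.gL (ctmul y d))
  simp only [BL.comp_apply, BL.tl_apply, BL.tr_apply] at h ⊢
  rw [h, mulS_coassoc]
  simp

/-- The map `p ⊗ q ↦ (S(p) ⊗ 1) Δ(q) (b ⊗ 1)`. -/
noncomputable def gLS (b : A) : BL (CTensor A A) (CTensor A A) :=
  (BL.tmap G.mulS (BL.id A)).comp ((BL.assocL A A A).comp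
    (BL.tmap (BL.id A) (G.gL.comp (BL.tr A b))))

lemma gLS_ctmul (b p q : A) :
    G.gLS b (ctmul p q) = BL.tmap (G.lm (G.S p)) (BL.id A) (G.gL (ctmul q b)) := by
  simp [gLS, tmap_mulS_assocL]

/-- `(S(y₁) ⊗ 1) Δ(y₂ x) (b ⊗ 1) = (1 ⊗ y) Δ(x) (b ⊗ 1)`. -/
lemma gLS_gRs (x y b : A) :
    G.gLS b (G.gRs (ctmul y x)) = BL.tmap (BL.id A) (G.lm y) (G.gL (ctmul x b)) := by
  refine G.eq_of_tmap_lm fun e c => ?_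
  -- A left factor `S(d)` is absorbed through `S(d)S(y₁) = S(y₁d)`. This turns `Δ(y)` into `Δ(y)(d ⊗
  -- 1)`, an honest element of `A ⊗ A` to which `actS_gL` applies.
  obtain ⟨d, rfl⟩ : ∃ d, e = G.S d := ⟨G.Sinv e, by simp⟩
  have h1 : BL.tmap (G.lm (G.S d)) (G.lm c) (G.gLS b (G.gRs (ctmul y x))) =
      BL.tmap (BL.id A) (G.lm c) (G.gLS b (BL.tmap (G.rm d) (BL.id A) (G.gRs (ctmul y x)))) := by
    refine BL.congr (f := (BL.tmap (G.lm (G.S d)) (G.lm c)).comp (G.gLS b))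
      (g := (BL.tmap (BL.id A) (G.lm c)).comp ((G.gLS b).comp (BL.tmap (G.rm d) (BL.id A))))
      (fun p q => ?_) _
    simp only [BL.comp_apply, BL.tmap_ctmul, BL.id_apply, rm_apply, gLS_ctmul, S_mul]
    rw [BL.tmap_tmap, BL.tmap_tmap]
    congr 2
    ext z
    simp [mul_assoc]
  have h2 : BL.tmap (BL.id A) (G.lm c) (G.gLS b (BL.tmap (BL.id A) (G.rm x) (G.gL (ctmul y d)))) =
      G.actS c (ctmul (G.gL (ctmul y d)) (G.gL (ctmul x b))) := by
    refine BL.congr (f := (BL.tmap (BL.id A) (G.lm c)).comp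
      ((G.gLS b).comp (BL.tmap (BL.id A) (G.rm x))))
      (g := (G.actS c).comp (BL.tr _ (G.gL (ctmul x b)))) (fun p q => ?_) _
    simp only [BL.comp_apply, BL.tmap_ctmul, BL.id_apply, rm_apply, gLS_ctmul, BL.tr_apply]
    rw [actS_ctmul, dL_gL]
  rw [h1, ← rm_right_gL, h2, actS_gL, BL.tmap_tmap]
  congr 2
  ext z
  simp [mul_assoc]

/-- Strong left invariance: `S((ι ⊗ φ)(Δ(y) (1 ⊗ x))) = (ι ⊗ φ)((1 ⊗ y) Δ(x))`. -/
theorem S_sr_gRs (x y : A) :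
    G.S (BL.sr G.φ (G.gRs (ctmul y x))) = BL.sr G.φ (G.gR (ctmul y x)) := by
  refine G.eq_of_mul_right fun b => ?_
  -- Left invariance collapses `(ι ⊗ φ)` of `(S(y₁) ⊗ 1)Δ(y₂x)(b ⊗ 1)` to `S(y₁)φ(y₂x)b`.
  have h1 := BL.congr (f := (BL.sr G.φ).comp (G.gLS b))
    (g := (G.rm b).comp (G.S.comp (BL.sr G.φ))) (fun p q => by
      simp only [BL.comp_apply, gLS_ctmul, BL.sr_ctmul, rm_apply, map_smul]
      rw [BL.sr_tmap]
      change G.S p * BL.sr G.φ _ = _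
      rw [sr_gL, mul_smul_comm]) (G.gRs (ctmul y x))
  simp only [BL.comp_apply, rm_apply] at h1
  rw [← h1, gLS_gRs, lm_right_gL, BL.sr_tmap]
  rfl

lemma sr_gRs_eq (x y : A) :
    BL.sr G.φ (G.gRs (ctmul y x)) = G.Sinv (BL.sr G.φ (G.gR (ctmul y x))) := by
  rw [← S_sr_gRs, Sinv_S]

/-! ### The involution -/

/-- Polarization: `φ(z*z)` is real for `z = a + b` and for `z = a + ib`, which gives the imaginary
and the real part of the claim. -/
lemma haar_star_mul_comm (a b : A) :
    G.φ (star b * a) = starRingEnd ℂ (G.φ (star a * b)) := by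
  have key : ∀ x : A, (G.φ (star x * x)).im = 0 := fun x => (G.haar_nonneg x).2
  have h1 := key (a + b)
  have h2 := key (a + Complex.I • b)
  have ha := key a
  have hb := key b
  simp only [star_add, star_smul, add_mul, mul_add, map_add, smul_mul_assoc, mul_smul_comm,
    map_smul, smul_eq_mul, Complex.add_im, Complex.mul_im, Complex.mul_re, Complex.star_def,
    Complex.conj_I, Complex.neg_re, Complex.neg_im, Complex.I_re, Complex.I_im, ha, hb] at h1 h2
  refine Complex.ext ?_ ?_
  · rw [Complex.conj_re]
    linarith
  · rw [Complex.conj_im]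
    linarith

lemma exists_mulT (a : A) : ∃ u, G.mulT u = a := by
  obtain ⟨C, -, hC⟩ := G.essential {a} isBounded_singleton
  have : a ∈ lift (fun a b : A => a * b) '' C := by rw [hC]; rfl
  obtain ⟨u, -, hu⟩ := this
  refine ⟨u, ?_⟩
  rw [← hu]
  exact (BL.lift_eq G.mulT _ (fun x y => G.mulT_ctmul x y) u).symm

/-- The functional `a ↦ conj (f (star a))`. -/
noncomputable def conjF (f : BL A ℂ) : BL A ℂ where
  toFun a := starRingEnd ℂ (f (star a))
  map_add' a b := by simp
  map_smul' z a := by simp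
  bounded' := by
    intro s hs
    have h := f.bounded _ (G.bounded_star s hs)
    rw [Metric.isBounded_iff_subset_closedBall 0] at h ⊢
    obtain ⟨r, hr⟩ := h
    refine ⟨r, ?_⟩
    rintro _ ⟨x, hx, rfl⟩
    have := hr ⟨_, ⟨x, hx, rfl⟩, rfl⟩
    rw [mem_closedBall_zero_iff] at this ⊢
    rwa [RCLike.norm_conj]

@[simp] lemma conjF_apply (f : BL A ℂ) (a : A) :
    G.conjF f a = starRingEnd ℂ (f (star a)) := rfl

/-- Since `A` is essential, it suffices to consider products `xy`, where this is the Hermitian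
symmetry of `φ`. -/
lemma haar_star (a : A) : G.φ (star a) = starRingEnd ℂ (G.φ a) := by
  obtain ⟨u, rfl⟩ := G.exists_mulT a
  have := BL.congr (f := G.φ.comp G.mulT) (g := (G.conjF G.φ).comp G.mulT) (fun x y => by
    have h := G.haar_star_mul_comm y (star x)
    simp only [BL.comp_apply, mulT_ctmul, conjF_apply, star_mul]
    rwa [star_star] at h) u
  simp only [BL.comp_apply, conjF_apply] at this
  rw [this, Complex.conj_conj]

lemma star_sr (u : CTensor A A) : star (BL.sr G.φ u) = BL.sr G.φ (starT u) := by
  let T : BL (CTensor A A) A :=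
    { toFun := fun u => star (BL.sr G.φ (starT u))
      map_add' := fun u v => by simp
      map_smul' := fun z u => by simp
      bounded' := by
        intro s hs
        have := G.bounded_star _ ((BL.sr G.φ).bounded _ (G.starT_bounded_spec.1 s hs))
        rwa [← Set.image_comp, ← Set.image_comp] at this }
  have := BL.congr (f := T) (g := BL.sr G.φ) (fun x y => by
    change star (BL.sr G.φ (starT (ctmul x y))) = _
    rw [G.starT_ctmul, BL.sr_ctmul, BL.sr_ctmul, haar_star, star_smul, star_star,
      Complex.star_def, Complex.conj_conj]) (starT u)
  change star (BL.sr G.φ (starT (starT u))) = _ at this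
  rwa [G.starT_starT] at this

/-- The integral does not vanish. -/
lemma exists_haar_eq_one : ∃ e, G.φ e = 1 := by
  by_contra! h
  have h0 : ∀ a, G.φ a = 0 := by
    intro a
    by_contra ha
    exact h ((G.φ a)⁻¹ • a) (by rw [map_smul, smul_eq_mul, inv_mul_cancel₀ ha])
  apply G.counit_ne_zero
  ext a
  rw [G.haar_faithful a (h0 _), map_zero, map_zero]

/-- A right inverse of the left Galois map. -/
noncomputable def gLinv : BL (CTensor A A) (CTensor A A) :=
  G.conjT ((BL.swap A A).comp ((BL.tmap G.S (BL.id A)).comp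
    (G.gL.comp ((BL.swap A A).comp (BL.tmap G.Sinv (BL.id A))))))

/-- The involution interchanges `Δ(a)(b ⊗ 1)` and `(b* ⊗ 1)Δ(a*)`, so the right inverse is that of
`gLs_inv`, conjugated. -/
lemma gL_gLinv (u : CTensor A A) : G.gL (G.gLinv u) = u := by
  have h : ∀ u, G.gLs u = starT (G.gL (starT (BL.swap A A u))) := fun u => rfl
  have h1 : ∀ u, G.gLs (BL.tmap G.S (BL.id A) (G.gL (BL.swap A A
      (BL.tmap G.Sinv (BL.id A) u)))) = u :=
    BL.congr (f := G.gLs.comp ((BL.tmap G.S (BL.id A)).comp (G.gL.comp ((BL.swap A A).comp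
      (BL.tmap G.Sinv (BL.id A)))))) (g := BL.id _) (fun b a => by simp [gLs_inv])
  have h2 := congrArg starT (h1 (starT u))
  rw [h, G.starT_starT, G.starT_starT] at h2
  exact h2

/-- A right inverse of `gR`. -/
noncomputable def gRinv : BL (CTensor A A) (CTensor A A) :=
  (BL.swap A A).comp ((BL.tmap G.Sinv G.Sinv).comp (G.gLinv.comp
    ((BL.tmap G.S G.S).comp (BL.swap A A))))

/-- `gL` and `gR` are conjugate under the flip composed with `S ⊗ S`, because `S` is
anticomultiplicative. -/
lemma gR_gRinv (u : CTensor A A) : G.gR (G.gRinv u) = u := by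
  have h : ∀ u, G.gR u = BL.tmap G.Sinv G.Sinv (BL.swap A A
      (G.gL (BL.tmap G.S G.S (BL.swap A A u)))) :=
    BL.congr (f := G.gR) (g := (BL.tmap G.Sinv G.Sinv).comp ((BL.swap A A).comp
      (G.gL.comp ((BL.tmap G.S G.S).comp (BL.swap A A))))) (fun b a => by
        simp only [BL.comp_apply, BL.swap_ctmul, BL.tmap_ctmul, gL_S_S, BL.swap_swap]
        rw [BL.tmap_tmap]
        exact (BL.congr (f := BL.tmap (G.Sinv.comp G.S) (G.Sinv.comp G.S)) (g := BL.id _)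
          (fun x y => by simp) _).symm)
  rw [h, gRinv]
  simp only [BL.comp_apply, BL.swap_swap]
  have h2 : BL.tmap G.S G.S (BL.tmap G.Sinv G.Sinv
      (G.gLinv (BL.tmap G.S G.S (BL.swap A A u)))) = G.gLinv (BL.tmap G.S G.S (BL.swap A A u)) :=
    BL.congr (f := (BL.tmap G.S G.S).comp (BL.tmap G.Sinv G.Sinv)) (g := BL.id _)
      (fun x y => by simp) _
  rw [h2, gL_gLinv]
  exact BL.congr (f := (BL.tmap G.Sinv G.Sinv).comp ((BL.swap A A).comp
    ((BL.tmap G.S G.S).comp (BL.swap A A)))) (g := BL.id _) (fun x y => by simp) u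

/-- A bounded linear right inverse of `b ⊗ a ↦ (ι ⊗ φ)((1 ⊗ b) Δ(a))`. -/
lemma exists_section_sr_gR : ∃ s : BL A (CTensor A A), ∀ a, BL.sr G.φ (G.gR (s a)) = a := by
  obtain ⟨e, he⟩ := G.exists_haar_eq_one
  -- With `φ(e) = 1`, a preimage of `a ⊗ e` under `gR` has slice `a`.
  refine ⟨G.gRinv.comp (BL.tr A e), fun a => ?_⟩
  rw [BL.comp_apply, gR_gRinv, BL.tr_apply, BL.sr_ctmul, he, one_smul]

/-- Compatibility of the antipode and the involution. -/
theorem S_star_S (a : A) : G.S (star (G.S a)) = star a := by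
  obtain ⟨s, hs⟩ := G.exists_section_sr_gR
  let T : BL A A :=
    { toFun := fun a => star (G.S (star (G.S a)))
      map_add' := fun u v => by simp
      map_smul' := fun z u => by simp
      bounded' := by
        intro s hs
        have := G.bounded_star _ (G.S.bounded _ (G.bounded_star _ (G.S.bounded s hs)))
        rwa [← Set.image_comp, ← Set.image_comp, ← Set.image_comp] at this }
  -- The involution exchanges the two kinds of slices in strong left invariance, so two applications
  -- of the latter show that `* ∘ S ∘ * ∘ S` fixes all slices of `Δ(y)(1 ⊗ x)`. These slices exhaust
  -- `A`.
  have key : ∀ u, T (BL.sr G.φ (G.gRs u)) = BL.sr G.φ (G.gRs u) :=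
    BL.congr (f := T.comp ((BL.sr G.φ).comp G.gRs)) (g := (BL.sr G.φ).comp G.gRs) (fun y x => by
      change star (G.S (star (G.S (BL.sr G.φ (G.gRs (ctmul y x)))))) =
        BL.sr G.φ (G.gRs (ctmul y x))
      rw [S_sr_gRs, star_sr]
      have h1 : starT (G.gR (ctmul y x)) = G.gRs (ctmul (star x) (star y)) := by
        have := congrArg starT (G.starT_gRs (star x) (star y))
        rw [G.starT_starT, star_star, star_star] at this
        exact this.symm
      rw [h1, S_sr_gRs, star_sr]
      have h2 := G.starT_gRs y x
      rw [← h2, G.starT_starT])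
  have h3 : ∀ a, T a = a := by
    intro a
    have h4 := hs (star a)
    have h5 := congrArg star h4
    rw [star_star, star_sr] at h5
    have h6 : starT (G.gR (s (star a))) = G.gRs (BL.swap A A (starT (s (star a)))) := by
      change _ = starT (G.gR (starT (BL.swap A A (BL.swap A A (starT (s (star a)))))))
      rw [BL.swap_swap, G.starT_starT]
    rw [h6] at h5
    rw [← h5, key]
  have := congrArg star (h3 a)
  change star (star (G.S (star (G.S a)))) = star a at this
  rwa [star_star] at this

/-! ### Right invariance and the modular element -/

/-- Right invariance of `φ ∘ S`: left invariance of `φ` transported by the anticomultiplicative map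
`S`. -/
lemma sl_S_gR (a b : A) : BL.sl (G.φ.comp G.S) (G.gR (ctmul b a)) = G.φ (G.S a) • b := by
  apply G.S_injective
  have h := G.sr_gL (G.S a) (G.S b)
  rw [gL_S_S, BL.sr_swap, BL.sl_tmap] at h
  rw [h, map_smul]

lemma sl_S_gRs (a b : A) : BL.sl (G.φ.comp G.S) (G.gRs (ctmul b a)) = G.φ (G.S b) • a := by
  refine G.eq_of_mul_left fun c => ?_
  have h := BL.sl_tmap (G.φ.comp G.S) (BL.id A) (G.lm c) (G.gRs (ctmul b a))
  have h2 := BL.sl_tmap (G.φ.comp G.S) (BL.id A) (G.rm a) (G.gR (ctmul c b))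
  rw [lm_right_gRs, h2] at h
  change G.rm a (BL.sl (G.φ.comp G.S) _) = c * BL.sl (G.φ.comp G.S) _ at h
  rw [← h, sl_S_gR, rm_apply, smul_mul_assoc, mul_smul_comm]

/-- The axiom `antipode_comul` moves `S` past `Δ` with a factor in the first leg. Here the factor
sits in the second leg, so both sides are compared after multiplication with `S(b) ⊗ 1`. -/
lemma gR_S (x k : A) : G.gR (ctmul k (G.S x)) =
    BL.swap A A (BL.tmap G.S G.S (G.gL (ctmul x (G.Sinv k)))) := by
  refine G.eq_of_tmap_rm_left G.isSeparated fun e => ?_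
  obtain ⟨b, rfl⟩ : ∃ b, e = G.S b := ⟨G.Sinv e, by simp⟩
  rw [← lm_right_gL, gL_S_S]
  have h1 := BL.congr (f := (BL.tmap (BL.id A) (G.lm k)).comp ((BL.swap A A).comp
    (BL.tmap G.S G.S))) (g := (BL.swap A A).comp ((BL.tmap G.S G.S).comp
      (BL.tmap (G.rm (G.Sinv k)) (BL.id A)))) (fun p q => by simp) (G.gR (ctmul b x))
  have h2 := BL.congr (f := (BL.tmap (G.rm (G.S b)) (BL.id A)).comp ((BL.swap A A).comp
    (BL.tmap G.S G.S))) (g := (BL.swap A A).comp ((BL.tmap G.S G.S).comp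
      (BL.tmap (BL.id A) (G.lm b)))) (fun p q => by simp) (G.gL (ctmul x (G.Sinv k)))
  simp only [BL.comp_apply] at h1 h2
  rw [h1, h2, lm_right_gL]

lemma haar_S_S (hG : G.HasTrivialScaling) (a : A) : G.φ (G.S (G.S a)) = G.φ a := hG a

lemma haar_Sinv (hG : G.HasTrivialScaling) (a : A) : G.φ (G.Sinv a) = G.φ (G.S a) := by
  rw [← G.haar_S_S hG, S_Sinv]

/-- After exchanging the slices, strong left invariance produces `φ ∘ S⁻¹`. Trivial scaling replaces
it by `φ ∘ S`, which is right invariant. -/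
lemma haar_sl_gRs (hG : G.HasTrivialScaling) (a x : A) :
    G.φ (BL.sl G.φ (G.gRs (ctmul a x))) = G.φ a * G.φ (G.S x) := by
  rw [BL.apply_sl, sr_gRs_eq, G.haar_Sinv hG]
  change (G.φ.comp G.S) _ = _
  rw [← BL.apply_sl, sl_S_gR, map_smul, smul_eq_mul, mul_comm]

/-- The same exchange of slices, with strong left invariance read in the other direction so that `φ
∘ S` appears directly. -/
lemma haar_sl_gR (a x : A) :
    G.φ (BL.sl G.φ (G.gR (ctmul x a))) = G.φ a * G.φ (G.S x) := by
  rw [BL.apply_sl, ← S_sr_gRs]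
  change (G.φ.comp G.S) _ = _
  rw [← BL.apply_sl, sl_S_gRs, map_smul, smul_eq_mul, mul_comm]

lemma sl_gRs_mul (a b c : A) :
    BL.sl G.φ (G.gRs (ctmul a (b * c))) = BL.sl G.φ (G.gRs (ctmul a b)) * c := by
  have h := BL.sl_tmap G.φ (BL.id A) (G.rm c) (G.gRs (ctmul a b))
  rw [rm_right_gRs] at h
  exact h

lemma sl_gR_mul (a b c : A) :
    BL.sl G.φ (G.gR (ctmul (c * b) a)) = c * BL.sl G.φ (G.gR (ctmul b a)) := by
  have h := BL.sl_tmap G.φ (BL.id A) (G.lm c) (G.gR (ctmul b a))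
  rw [lm_right_gR] at h
  exact h

lemma mul_sl_gRs (a b c : A) :
    c * BL.sl G.φ (G.gRs (ctmul a b)) = BL.sl G.φ (G.gR (ctmul c a)) * b := by
  have h := BL.sl_tmap G.φ (BL.id A) (G.lm c) (G.gRs (ctmul a b))
  have h2 := BL.sl_tmap G.φ (BL.id A) (G.rm b) (G.gR (ctmul c a))
  rw [lm_right_gRs, h2] at h
  exact h.symm

/-- The existence of the modular element. -/
theorem exists_modular (hG : G.HasTrivialScaling) : ∃ δ : Multiplier A, G.IsModularElement δ ∧
    (∀ z, G.φ (δ.left z) = G.φ (G.S z)) ∧ ∀ z, G.φ (δ.right z) = G.φ (G.S z) := by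
  obtain ⟨e, he⟩ := G.exists_haar_eq_one
  -- The modular element is `(φ ⊗ ι)(Δ(e))` for an element `e` normalized by `φ(e) = 1`.
  let δ : Multiplier A :=
    { left := ((BL.sl G.φ).comp (G.gRs.comp (BL.tl A e))).toLinearMap
      right := ((BL.sl G.φ).comp (G.gR.comp (BL.tr A e))).toLinearMap
      bounded_left := BL.bounded _
      bounded_right := BL.bounded _
      left_mul := fun a b => G.sl_gRs_mul e a b
      right_mul := fun a b => G.sl_gR_mul e b a
      right_mul_eq := fun a b => (G.mul_sl_gRs e b a).symm }
  refine ⟨δ, ⟨fun a b => ?_, fun a b => ?_⟩, fun z => ?_, fun z => ?_⟩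
  · rw [lift_sl, ← gRs_ctmul]
    change BL.sl G.φ (G.gRs (ctmul a b)) = G.haar a • BL.sl G.φ (G.gRs (ctmul e b))
    -- Pairing with `φ(· x)` gives `φ(a)φ(S(bx))` on both sides, which shows that the slice depends
    -- on `a` only through `φ(a)`.
    refine G.eq_of_haar_mul_right fun x => ?_
    rw [smul_mul_assoc, map_smul, ← sl_gRs_mul, ← sl_gRs_mul, G.haar_sl_gRs hG,
      G.haar_sl_gRs hG, he, one_mul]
    rfl
  · rw [lift_sl]
    change BL.sl G.φ (G.gR (ctmul b a)) = G.haar a • BL.sl G.φ (G.gR (ctmul b e))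
    refine G.eq_of_haar_mul_left fun x => ?_
    rw [mul_smul_comm, map_smul, ← sl_gR_mul, ← sl_gR_mul, G.haar_sl_gR,
      G.haar_sl_gR, he, one_mul]
    rfl
  · change G.φ (BL.sl G.φ (G.gRs (ctmul e z))) = _
    rw [G.haar_sl_gRs hG, he, one_mul]
  · change G.φ (BL.sl G.φ (G.gR (ctmul z e))) = _
    rw [G.haar_sl_gR, he, one_mul]

/-! ### The modular automorphism -/

/-- By strong left invariance the left side is `φ(dS⁻¹(z))` with `z = (ι ⊗ φ)((1 ⊗ y)Δ(x))`. On the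
right side, the formula for `Δ(S(x))` leads to `φ(S(zS(d)))`. Since `zS(d) = S(dS⁻¹(z))`, the two
agree by `φ ∘ S² = φ`. This is the source of the KMS property. -/
lemma haar_modular_aux (hG : G.HasTrivialScaling) (d y x : A) :
    G.φ (BL.sl G.φ (G.gLs (ctmul d y)) * x) =
      G.φ (BL.sl G.φ (G.gLs (ctmul y (G.S (G.S d)))) * G.S x) := by
  have key : ∀ d y x, G.φ (BL.sl G.φ (G.gLs (ctmul d y)) * x) =
      G.φ (d * G.Sinv (BL.sr G.φ (G.gR (ctmul y x)))) := by
    intro d y x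
    change (G.φ.comp (G.rm x)) (BL.sl G.φ (G.gLs (ctmul d y))) = _
    rw [BL.apply_sl]
    have h := BL.sr_tmap G.φ (BL.id A) (G.rm x) (G.gLs (ctmul d y))
    rw [← lm_left_gRs, BL.sr_tmap] at h
    change G.lm d (BL.sr G.φ _) = _ at h
    rw [BL.id_apply] at h
    rw [← h, ← sr_gRs_eq]
    rfl
  rw [key, key, gR_S, Sinv_S, BL.sr_swap, BL.sl_tmap, Sinv_S]
  change _ = (G.φ.comp (G.lm y)) _
  rw [BL.apply_sl, ← G.haar_S_S hG, S_mul, S_Sinv]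
  have h := BL.sr_tmap G.φ (G.rm (G.S d)) (BL.id A) (G.gR (ctmul y x))
  rw [← lm_right_gL, BL.sr_tmap] at h
  change BL.sr (G.φ.comp (G.lm y)) _ = BL.sr G.φ _ * G.S d at h
  rw [← h]
  rfl

/-- The KMS property: existence of the modular automorphism. -/
theorem exists_modular_automorphism (hG : G.HasTrivialScaling) :
    ∃ σ : BL A A, ∀ a x, G.φ (a * x) = G.φ (x * σ a) := by
  obtain ⟨δ, -, -, hδ⟩ := G.exists_modular hG
  obtain ⟨e, he⟩ := G.exists_haar_eq_one
  let δR : BL A A := ⟨δ.right, δ.bounded_right⟩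
  -- `U` is a bounded section: `a = (φ ⊗ ι)` of `gLs (U a)`. It is what makes the automorphism below
  -- a bounded linear map.
  let U : BL A (CTensor A A) := (BL.tmap G.S (BL.id A)).comp (G.gL.comp (BL.tr A (G.Sinv e)))
  let Q : BL (CTensor A A) A := (BL.sl G.φ).comp (G.gLs.comp ((BL.swap A A).comp
    (BL.tmap (G.S.comp G.S) (BL.id A))))
  have hU : ∀ a, BL.sl G.φ (G.gLs (U a)) = a := by
    intro a
    change BL.sl G.φ (G.gLs (BL.tmap G.S (BL.id A) (G.gL (ctmul a (G.Sinv e))))) = a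
    rw [gLs_inv, BL.sl_ctmul, he, one_smul]
  have hQ : ∀ u x, G.φ (BL.sl G.φ (G.gLs u) * x) = G.φ (Q u * G.S x) := fun u x =>
    BL.congr (f := G.φ.comp ((G.rm x).comp ((BL.sl G.φ).comp G.gLs)))
      (g := G.φ.comp ((G.rm (G.S x)).comp Q)) (fun d y => by
        simp only [BL.comp_apply, rm_apply, Q, BL.tmap_ctmul, BL.swap_ctmul, BL.id_apply]
        exact G.haar_modular_aux hG d y x) u
  -- Since `φ(ax) = φ(qS(x))` with `q = Q(U a)`, and `qS(x) = S(xS⁻¹(q))`, the identity `φ(S(z)) =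
  -- φ(zδ)` gives `σ(a) = S⁻¹(q)δ`.
  refine ⟨δR.comp (G.Sinv.comp (Q.comp U)), fun a x => ?_⟩
  have h := hQ (U a) x
  rw [hU] at h
  rw [h]
  change _ = G.φ (x * δ.right (G.Sinv (Q (U a))))
  rw [← δ.right_mul, hδ, S_mul, S_Sinv]

/-- The inverse of the modular automorphism. -/
theorem exists_modular_automorphism_inv (hG : G.HasTrivialScaling) :
    ∃ τ : BL A A, (∀ p x, G.φ (x * p) = G.φ (τ p * x)) ∧ Function.Surjective τ := by
  obtain ⟨σ, hσ⟩ := G.exists_modular_automorphism hG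
  let τ : BL A A :=
    { toFun := fun a => star (σ (star a))
      map_add' := fun u v => by simp
      map_smul' := fun z u => by simp
      bounded' := by
        intro s hs
        have := G.bounded_star _ (σ.bounded _ (G.bounded_star s hs))
        rwa [← Set.image_comp, ← Set.image_comp] at this }
  have hτ : ∀ p x, G.φ (x * p) = G.φ (τ p * x) := by
    intro p x
    change _ = G.φ (star (σ (star p)) * x)
    have h1 := G.haar_star (x * p)
    have h2 := G.haar_star (star x * σ (star p))
    rw [star_mul] at h1 h2
    rw [star_star] at h2
    rw [h2, ← hσ, h1, Complex.conj_conj]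
  -- Surjectivity: `τ(σ(a)) = a` by comparing the two exchange rules under the faithful `φ`.
  refine ⟨τ, hτ, fun a => ⟨σ a, G.eq_of_haar_mul_right fun x =>
    (hτ (σ a) x).symm.trans (hσ a x).symm⟩⟩

/-! ### Convolution -/

lemma conv_eq (x y : A) : G.conv x y = BL.sr G.φ (G.gR (ctmul (G.Sinv y) x)) := by
  rw [conv, lift_sr]
  rfl

/-- `φ(a (x * y)) = (φ ⊗ φ)(Δ(a) (x ⊗ y))`. -/
theorem haar_mul_conv (hG : G.HasTrivialScaling) (a x y : A) :
    G.φ (a * G.conv x y) = G.φ (BL.sr G.φ (G.dL a (ctmul x y))) := by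
  obtain ⟨c, rfl⟩ : ∃ c, y = G.S c := ⟨G.Sinv y, by simp⟩
  rw [conv_eq, Sinv_S, dL_ctmul, BL.sr_tmap]
  change G.φ (a * _) = G.φ (BL.sr G.φ (G.gRs (ctmul a (G.S c))) * x)
  -- For `y = S(c)`, the slice of `Δ(a)(1 ⊗ S(c))` is rewritten in terms of `Δ(c)`. Exchanging
  -- slices then exposes the slice of `Δ(c)(1 ⊗ x)`, whose image under `S` is `x * y`.
  have h0 : BL.sr G.φ (G.gRs (ctmul a (G.S c))) =
      BL.sl (G.φ.comp G.S) (G.gL (ctmul c (G.Sinv a))) := by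
    rw [sr_gRs_eq, gR_S, BL.sr_swap, BL.sl_tmap, Sinv_S]
  have h1 := BL.sr_tmap G.φ (G.rm (G.Sinv a)) (BL.id A) (G.gRs (ctmul c x))
  rw [← rm_right_gL, BL.sr_tmap] at h1
  change BL.sr (G.φ.comp (G.rm x)) _ = BL.sr G.φ _ * G.Sinv a at h1
  rw [h0]
  change _ = (G.φ.comp (G.rm x)) _
  rw [BL.apply_sl, h1, BL.comp_apply, S_mul, S_Sinv, S_sr_gRs]

/-- `φ(u x^*) = conj φ(star (S u) x)` for the convolution adjoint `x^*`. -/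
theorem haar_mul_convStar {δ : Multiplier A} (hδ : ∀ z, G.φ (δ.right z) = G.φ (G.S z)) (u x : A) :
    G.φ (u * G.convStar δ x) = starRingEnd ℂ (G.φ (star (G.S u) * x)) := by
  have : star (star (G.S u) * x) = G.S (u * star (G.S x)) := by
    rw [S_mul, S_star_S, star_mul, star_star]
  rw [← haar_star, this, ← hδ, δ.right_mul]
  rfl

end BornologicalQuantumGroup

end BornQG


namespace BornQG

/-! ### Amplifications -/

lemma apply_comm_of_commute {L : Type*} [NormedAddCommGroup L] [NormedSpace ℂ L]
    {S T : L →L[ℂ] L} (h : S * T = T * S) (v : L) : S (T v) = T (S v) :=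
  congrArg (fun R : L →L[ℂ] L => R v) h

section Amplification

variable {K L : Type*} [NormedAddCommGroup K] [InnerProductSpace ℂ K] [CompleteSpace K]
  [NormedAddCommGroup L] [InnerProductSpace ℂ L] [CompleteSpace L]

/-- A linear map `π : B(K) → B(L)` which intertwines the adjoints, together with a total family of
operators `J i : K → L` intertwining `x` and `π x`. -/
structure IsAmplification {I : Type*} (π : (K →L[ℂ] K) →ₗ[ℂ] (L →L[ℂ] L)) (J : I → K →L[ℂ] L) :
    Prop where
  map_star : ∀ x, π (star x) = star (π x)
  comm : ∀ x i w, π x (J i w) = J i (x w)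
  total : ∀ v, (∀ i w, ⟪J i w, v⟫_ℂ = 0) → v = 0

namespace IsAmplification

variable {I : Type*} {π : (K →L[ℂ] K) →ₗ[ℂ] (L →L[ℂ] L)} {J : I → K →L[ℂ] L}

lemma inner_apply (h : IsAmplification π J) (x : K →L[ℂ] K) (i : I) (w : K) (v : L) :
    ⟪J i w, π x v⟫_ℂ = ⟪J i (star x w), v⟫_ℂ := by
  rw [← h.comm, h.map_star, ContinuousLinearMap.star_eq_adjoint,
    ContinuousLinearMap.adjoint_inner_left]

lemma ext_inner (h : IsAmplification π J) {v v' : L}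
    (hv : ∀ i w, ⟪J i w, v⟫_ℂ = ⟪J i w, v'⟫_ℂ) : v = v' := by
  refine sub_eq_zero.1 (h.total _ fun i w => ?_)
  rw [inner_sub_right, hv, sub_self]

lemma map_mul_apply (h : IsAmplification π J) (x y : K →L[ℂ] K) (v : L) :
    π (x * y) v = π x (π y v) := by
  refine h.ext_inner fun i w => ?_
  rw [h.inner_apply, h.inner_apply, h.inner_apply, star_mul]
  rfl

/-- Two operators agreeing on the ranges of the `J i` are equal. -/
lemma ext_op (h : IsAmplification π J) {L' : Type*} [NormedAddCommGroup L']
    [InnerProductSpace ℂ L'] [CompleteSpace L'] {T T' : L →L[ℂ] L'}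
    (hT : ∀ i w, T (J i w) = T' (J i w)) : T = T' := by
  ext v
  refine ext_inner_left ℂ fun u => ?_
  rw [← ContinuousLinearMap.adjoint_inner_left, ← ContinuousLinearMap.adjoint_inner_left]
  congr 1
  refine h.ext_inner fun i w => ?_
  rw [ContinuousLinearMap.adjoint_inner_right, ContinuousLinearMap.adjoint_inner_right, hT]

/-- An operator commuting with the image of a `*`-closed set commutes with the image of the von
Neumann algebra generated by this set. -/
lemma commute_of_mem_vnGen (h : IsAmplification π J) {s : Set (K →L[ℂ] K)}
    (hs : ∀ x ∈ s, star x ∈ s) {T : L →L[ℂ] L} (hT : ∀ x ∈ s, T * π x = π x * T)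
    {x : K →L[ℂ] K} (hx : x ∈ vnGen s) : T * π x = π x * T := by
  refine h.ext_op fun j w => h.ext_inner fun i w' => ?_
  -- The matrix entries `J i* T J j` lie in the commutant of `s`, so they commute with `x`; as the
  -- family `J` is total, the entries determine the operator.
  let E : K →L[ℂ] K := (ContinuousLinearMap.adjoint (J i)).comp (T.comp (J j))
  have hE : ∀ v v', ⟪v, E v'⟫_ℂ = ⟪J i v, T (J j v')⟫_ℂ := fun v v' => by
    change ⟪v, ContinuousLinearMap.adjoint (J i) (T (J j v'))⟫_ℂ = _
    rw [ContinuousLinearMap.adjoint_inner_right]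
  have hcomm : ∀ y ∈ s, y * E = E * y := by
    intro y hy
    ext v
    refine ext_inner_left ℂ fun v' => ?_
    have h1 : ⟪v', (y * E) v⟫_ℂ = ⟪star y v', E v⟫_ℂ := by
      rw [ContinuousLinearMap.star_eq_adjoint, ContinuousLinearMap.adjoint_inner_left]
      rfl
    have h2 : (E * y) v = E (y v) := rfl
    have h3 : T (π y (J j v)) = π y (T (J j v)) := apply_comm_of_commute (hT y hy) (J j v)
    rw [h1, h2, hE, hE, ← h.comm y j v, h3, h.inner_apply]
  have hmem : E ∈ StarSubalgebra.centralizer ℂ s :=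
    (StarSubalgebra.mem_centralizer_iff ℂ).2 fun y hy => ⟨hcomm y hy, hcomm _ (hs y hy)⟩
  have hxE : E (x w) = x (E w) :=
    apply_comm_of_commute ((StarSubalgebra.mem_centralizer_iff ℂ).1 hx E hmem).1 w
  change ⟪J i w', T (π x (J j w))⟫_ℂ = ⟪J i w', π x (T (J j w))⟫_ℂ
  rw [h.comm, h.inner_apply, ← hE, ← hE, hxE, ContinuousLinearMap.star_eq_adjoint,
    ContinuousLinearMap.adjoint_inner_left]

/-- Ultraweak density of a nondegenerate `*`-algebra in the von Neumann algebra it generates. -/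
lemma inner_eq_zero_of_mem_vnGen (h : IsAmplification π J) {S : Submodule ℂ (K →L[ℂ] K)}
    (hstar : ∀ x ∈ S, star x ∈ S) (hmul : ∀ x ∈ S, ∀ y ∈ S, x * y ∈ S)
    (hnd : ∀ w, (∀ x ∈ S, x w = 0) → w = 0) {ξ η : L} (h0 : ∀ x ∈ S, ⟪ξ, π x η⟫_ℂ = 0)
    {x : K →L[ℂ] K} (hx : x ∈ vnGen (S : Set (K →L[ℂ] K))) : ⟪ξ, π x η⟫_ℂ = 0 := by
  let ev : (K →L[ℂ] K) →ₗ[ℂ] L := (ContinuousLinearMap.apply ℂ L η).toLinearMap.comp π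
  -- `N` is the closure of `π(S)η`. It reduces `π(S)`, so its projection commutes with `π(S)` and
  -- therefore with `π x`.
  let N : Submodule ℂ L := (S.map ev).topologicalClosure
  have hmem : ∀ y ∈ S, π y η ∈ N := fun y hy =>
    (S.map ev).le_topologicalClosure ⟨y, hy, rfl⟩
  have hinv : ∀ y ∈ S, ∀ v ∈ N, π y v ∈ N := by
    intro y hy v hv
    have hle : S.map ev ≤ N.comap (π y).toLinearMap := by
      rintro _ ⟨z, hz, rfl⟩
      change π y (π z η) ∈ N
      rw [← h.map_mul_apply]
      exact hmem _ (hmul y hy z hz)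
    exact Submodule.topologicalClosure_minimal _ hle
      ((S.map ev).isClosed_topologicalClosure.preimage (π y).continuous) hv
  have : CompleteSpace N := (S.map ev).isClosed_topologicalClosure.completeSpace_coe
  have hinv' : ∀ y ∈ S, ∀ v ∈ Nᗮ, π y v ∈ Nᗮ := by
    intro y hy v hv
    rw [Submodule.mem_orthogonal] at hv ⊢
    intro u hu
    rw [← ContinuousLinearMap.adjoint_inner_left, ← ContinuousLinearMap.star_eq_adjoint,
      ← h.map_star]
    exact hv _ (hinv _ (hstar y hy) u hu)
  have hP : ∀ y ∈ S, N.starProjection * π y = π y * N.starProjection := by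
    intro y hy
    ext v
    change N.starProjection (π y v) = π y (N.starProjection v)
    conv_lhs => rw [← add_sub_cancel (N.starProjection v) v]
    rw [map_add, map_add, Submodule.starProjection_eq_self_iff.2
      (hinv y hy _ (N.starProjection_apply_mem v)),
      (Submodule.starProjection_apply_eq_zero_iff N).2
      (hinv' y hy _ (N.sub_starProjection_mem_orthogonal v)), add_zero]
  -- Nondegeneracy: `π(S)` annihilates `Pη - η`, so `S` annihilates all components `J i*(Pη - η)`.
  have hη : N.starProjection η = η := by
    refine h.ext_inner fun i w => ?_
    rw [← sub_eq_zero, ← inner_sub_right]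
    have hz : ∀ y ∈ S, π y (N.starProjection η - η) = 0 := by
      intro y hy
      have h1 : N.starProjection (π y η) = π y (N.starProjection η) :=
        apply_comm_of_commute (hP y hy) η
      rw [map_sub, ← h1, Submodule.starProjection_eq_self_iff.2 (hmem y hy), sub_self]
    have hJ : ContinuousLinearMap.adjoint (J i) (N.starProjection η - η) = 0 := by
      refine hnd _ fun y hy => ext_inner_left ℂ fun w' => ?_
      rw [← star_star y, ContinuousLinearMap.star_eq_adjoint (star y),
        ContinuousLinearMap.adjoint_inner_right, ContinuousLinearMap.adjoint_inner_right,
        ← star_star (star y), ← h.inner_apply, hz _ (by simpa using hy), inner_zero_right,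
        inner_zero_right]
    rw [← ContinuousLinearMap.adjoint_inner_right, hJ, inner_zero_right]
  have hxN : π x η ∈ N := by
    have hc : N.starProjection * π x = π x * N.starProjection :=
      h.commute_of_mem_vnGen (s := (S : Set (K →L[ℂ] K))) hstar hP hx
    have h1 : N.starProjection (π x η) = π x (N.starProjection η) := apply_comm_of_commute hc η
    rw [hη] at h1
    rw [← h1]
    exact N.starProjection_apply_mem _
  have hle : N ≤ (ℂ ∙ ξ)ᗮ := by
    refine Submodule.topologicalClosure_minimal _ ?_ (Submodule.isClosed_orthogonal _)
    rintro _ ⟨z, hz, rfl⟩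
    exact Submodule.mem_orthogonal_singleton_iff_inner_right.2 (h0 z hz)
  exact Submodule.mem_orthogonal_singleton_iff_inner_right.1 (hle hxN)

/-- Amplifications can be composed. -/
lemma comp (h : IsAmplification π J) {L' : Type*} [NormedAddCommGroup L']
    [InnerProductSpace ℂ L'] [CompleteSpace L'] {I' : Type*}
    {π' : (L →L[ℂ] L) →ₗ[ℂ] (L' →L[ℂ] L')} {J' : I' → L →L[ℂ] L'} (h' : IsAmplification π' J') :
    IsAmplification (π' ∘ₗ π) (fun p : I' × I => (J' p.1).comp (J p.2)) where
  map_star x := by simp [h.map_star, h'.map_star]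
  comm x i w := by simp [h'.comm, h.comm]
  total v hv := by
    refine h'.total v fun i w => ?_
    have : ContinuousLinearMap.adjoint (J' i) v = 0 := by
      refine h.total _ fun j w => ?_
      rw [ContinuousLinearMap.adjoint_inner_right]
      exact hv (i, j) w
    rw [← ContinuousLinearMap.adjoint_inner_right, this, inner_zero_right]

end IsAmplification

end Amplification

/-! ### Amplification on `ℓ²` and normal functionals. -/

section Lp

variable {K : Type*} [NormedAddCommGroup K] [InnerProductSpace ℂ K]

/-- The amplification `x ↦ 1 ⊗ x` on `ℓ² ⊗ K`. -/
noncomputable def amp (I : Type*) :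
    (K →L[ℂ] K) →ₗ[ℂ] (lp (fun _ : I => K) 2 →L[ℂ] lp (fun _ : I => K) 2) where
  toFun T := lp.mapCLM 2 (fun _ => T) (norm_nonneg T) fun _ => le_rfl
  map_add' S T := by ext; rfl
  map_smul' z T := by ext; rfl

@[simp] lemma amp_apply {I : Type*} (T : K →L[ℂ] K) (x : lp (fun _ : I => K) 2) (i : I) :
    amp I T x i = T (x i) := rfl

lemma isAmplification_amp [CompleteSpace K] (I : Type*) [DecidableEq I] :
    IsAmplification (amp (K := K) I) fun i => lp.singleContinuousLinearMap ℂ (fun _ : I => K) 2 i where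
  map_star T := by
    rw [ContinuousLinearMap.star_eq_adjoint, ContinuousLinearMap.star_eq_adjoint,
      ContinuousLinearMap.eq_adjoint_iff]
    intro x y
    simp [lp.inner_eq_tsum, ContinuousLinearMap.adjoint_inner_left]
  comm T i w := by
    ext j
    rw [amp_apply]
    by_cases hj : j = i
    · subst hj
      simp
    · simp [hj]
  total v hv := by
    ext i
    refine ext_inner_left ℂ fun w => ?_
    have := hv i w
    simp only [lp.singleContinuousLinearMap_apply, lp.inner_single_left] at this
    simpa using this

/-- A square summable family of vectors. -/
noncomputable def mkl2 {I : Type*} (ξ : I → K) (h : Summable fun i => ‖ξ i‖ ^ 2) :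
    lp (fun _ : I => K) 2 :=
  ⟨ξ, memℓp_gen (by simpa using h)⟩

@[simp] lemma mkl2_apply {I : Type*} (ξ : I → K) (h : Summable fun i => ‖ξ i‖ ^ 2) (i : I) :
    mkl2 ξ h i = ξ i := rfl

lemma summable_sq {I : Type*} (ξ : lp (fun _ : I => K) 2) : Summable fun i => ‖ξ i‖ ^ 2 := by
  simpa using (lp.memℓp ξ).summable (by simp)

/-- Normal functionals on `B(K)`. -/
def IsNormal (f : (K →L[ℂ] K) → ℂ) : Prop :=
  ∃ ξ η : lp (fun _ : ℕ => K) 2, ∀ T, f T = ⟪ξ, amp ℕ T η⟫_ℂ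

/-- Only the indices with `ξ i ≠ 0` contribute, and there are countably many of them because `ξ` is
square summable. They are embedded in `ℕ`, with zeros elsewhere. -/
lemma isNormal_of_index {I : Type*} (ξ η : lp (fun _ : I => K) 2) :
    IsNormal fun T => ⟪ξ, amp I T η⟫_ℂ := by
  classical
  let s : Set I := {i | ξ i ≠ 0}
  have hs : s.Countable := by
    refine (summable_sq ξ).countable_support.mono fun i hi => ?_
    exact pow_ne_zero 2 (norm_ne_zero_iff.2 hi)
  have := hs.to_subtype
  obtain ⟨g, hg⟩ := exists_injective_nat s
  have key : ∀ ζ : lp (fun _ : I => K) 2,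
      Summable fun n => ‖Function.extend g (fun i : s => ζ i) 0 n‖ ^ 2 := by
    intro ζ
    have h1 : Summable fun i : s => ‖ζ i‖ ^ 2 := (summable_sq ζ).subtype s
    refine ((summable_extend_zero hg).2 h1).congr fun n => ?_
    by_cases hn : ∃ i, g i = n
    · obtain ⟨i, rfl⟩ := hn
      rw [hg.extend_apply, hg.extend_apply]
    · rw [Function.extend_apply' _ _ _ hn, Function.extend_apply' _ _ _ hn]
      simp
  refine ⟨mkl2 _ (key ξ), mkl2 _ (key η), fun T => ?_⟩
  beta_reduce
  rw [lp.inner_eq_tsum, lp.inner_eq_tsum]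
  rw [← tsum_subtype_eq_of_support_subset (s := s), ← tsum_extend_zero hg]
  · congr 1
    ext n
    simp only [amp_apply, mkl2_apply]
    by_cases hn : ∃ i, g i = n
    · obtain ⟨i, rfl⟩ := hn
      rw [hg.extend_apply, hg.extend_apply, hg.extend_apply]
    · rw [Function.extend_apply' _ _ _ hn, Function.extend_apply' _ _ _ hn]
      simp
  · intro i hi hξ
    have hξ : ξ i = 0 := hξ
    exact hi (by simp [hξ])

/-- The vector functional `T ↦ ⟪ξ, T η⟫`. -/
noncomputable def vecFun (ξ η : K) : StrongDual ℂ (K →L[ℂ] K) :=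
  (innerSL ℂ ξ).comp (ContinuousLinearMap.apply ℂ K η)

@[simp] lemma vecFun_apply (ξ η : K) (T : K →L[ℂ] K) : vecFun ξ η T = ⟪ξ, T η⟫_ℂ := rfl

lemma norm_vecFun_le (ξ η : K) : ‖vecFun ξ η‖ ≤ ‖ξ‖ * ‖η‖ := by
  refine ContinuousLinearMap.opNorm_le_bound _ (by positivity) fun T => ?_
  calc ‖⟪ξ, T η⟫_ℂ‖ ≤ ‖ξ‖ * (‖T‖ * ‖η‖) := (norm_inner_le_norm _ _).trans
        (mul_le_mul_of_nonneg_left (T.le_opNorm _) (norm_nonneg _))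
    _ = ‖ξ‖ * ‖η‖ * ‖T‖ := by ring

namespace IsNormal

lemma add {f g : (K →L[ℂ] K) → ℂ} (hf : IsNormal f) (hg : IsNormal g) :
    IsNormal fun T => f T + g T := by
  obtain ⟨ξ, η, h⟩ := hf
  obtain ⟨ξ', η', h'⟩ := hg
  have key : ∀ ζ ζ' : lp (fun _ : ℕ => K) 2,
      Summable fun i : ℕ ⊕ ℕ => ‖Sum.elim (⇑ζ) (⇑ζ') i‖ ^ 2 := fun ζ ζ' =>
    Summable.sum _ (summable_sq ζ) (summable_sq ζ')
  obtain ⟨a, b, hab⟩ := isNormal_of_index (mkl2 _ (key ξ ξ')) (mkl2 _ (key η η'))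
  refine ⟨a, b, fun T => ?_⟩
  rw [← hab]
  beta_reduce
  rw [h, h']
  have h1 := lp.hasSum_inner (𝕜 := ℂ) ξ (amp ℕ T η)
  have h2 := lp.hasSum_inner (𝕜 := ℂ) ξ' (amp ℕ T η')
  have h3 := lp.hasSum_inner (𝕜 := ℂ) (mkl2 _ (key ξ ξ')) (amp _ T (mkl2 _ (key η η')))
  simp only [amp_apply, mkl2_apply] at h1 h2 h3
  exact (HasSum.sum (f := fun i : ℕ ⊕ ℕ => ⟪Sum.elim (⇑ξ) (⇑ξ') i, T (Sum.elim (⇑η) (⇑η') i)⟫_ℂ)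
    h1 h2).unique h3

lemma smul (z : ℂ) {f : (K →L[ℂ] K) → ℂ} (hf : IsNormal f) : IsNormal fun T => z * f T := by
  obtain ⟨ξ, η, h⟩ := hf
  exact ⟨ξ, z • η, fun T => by beta_reduce; rw [h, map_smul, inner_smul_right]⟩

lemma sub {f g : (K →L[ℂ] K) → ℂ} (hf : IsNormal f) (hg : IsNormal g) :
    IsNormal fun T => f T - g T := by
  convert hf.add (hg.smul (-1)) using 2
  ring

lemma zero : IsNormal fun _ : K →L[ℂ] K => (0 : ℂ) := ⟨0, 0, fun T => by simp⟩

lemma vec (ξ η : K) : IsNormal (vecFun ξ η) := by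
  classical
  obtain ⟨a, b, h⟩ := isNormal_of_index (I := Unit) (mkl2 (fun _ => ξ) (.of_finite))
    (mkl2 (fun _ => η) (.of_finite))
  refine ⟨a, b, fun T => ?_⟩
  rw [← h]
  beta_reduce
  rw [lp.inner_eq_tsum]
  simp

/-- Conjugating a normal functional by an operator. -/
lemma conj [CompleteSpace K] {f : (K →L[ℂ] K) → ℂ} (hf : IsNormal f) (W : K →L[ℂ] K) :
    IsNormal fun T => f (star W * T * W) := by
  obtain ⟨ξ, η, h⟩ := hf
  refine ⟨amp ℕ W ξ, amp ℕ W η, fun T => ?_⟩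
  beta_reduce
  rw [h, lp.inner_eq_tsum, lp.inner_eq_tsum]
  congr 1
  ext n
  simp only [amp_apply, ContinuousLinearMap.star_eq_adjoint]
  change ⟪ξ n, ContinuousLinearMap.adjoint W (T (W (η n)))⟫_ℂ = _
  rw [ContinuousLinearMap.adjoint_inner_right]

/-- The functional `T ↦ conj (f (star T))`. -/
lemma star_conj [CompleteSpace K] {f : (K →L[ℂ] K) → ℂ} (hf : IsNormal f) :
    IsNormal fun T => starRingEnd ℂ (f (star T)) := by
  obtain ⟨ξ, η, h⟩ := hf
  refine ⟨η, ξ, fun T => ?_⟩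
  beta_reduce
  rw [h, inner_conj_symm, (isAmplification_amp ℕ).map_star, ContinuousLinearMap.star_eq_adjoint,
    ContinuousLinearMap.adjoint_inner_left]

lemma continuous_ultraweak {f : (K →L[ℂ] K) → ℂ} (hf : IsNormal f) :
    Continuous[ultraweak K, inferInstance] f := by
  obtain ⟨ξ, η, h⟩ := hf
  have : f = fun T => ∑' n, ⟪ξ n, T (η n)⟫_ℂ := by
    ext T
    rw [h, lp.inner_eq_tsum]
    rfl
  rw [this]
  exact continuous_iInf_dom (i := ⟨(ξ, η), summable_sq ξ, summable_sq η⟩) continuous_induced_dom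

lemma mem_predual [CompleteSpace K] {M : StarSubalgebra ℂ (K →L[ℂ] K)} {f : (K →L[ℂ] K) → ℂ}
    (hf : IsNormal f) {ω : StrongDual ℂ M} (h : ∀ x : M, ω x = f x) : ω ∈ predual M := by
  have h' : (fun x : M => ω x) = f ∘ fun x : M => (x : K →L[ℂ] K) := funext h
  change Continuous[(ultraweak K).induced (fun x : M => (x : K →L[ℂ] K)), inferInstance]
    fun x : M => ω x
  rw [h']
  exact @Continuous.comp _ _ _ (_) (ultraweak K) _ _ _ hf.continuous_ultraweak
    (@continuous_induced_dom _ _ _ (ultraweak K))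

end IsNormal

/-- The ultraweak topology is induced by a family of linear functionals, so a linear functional that
is continuous for it is a finite linear combination of members of the family; normal functionals
form a linear space. -/
lemma exists_isNormal_of_mem_predual [CompleteSpace K] {M : StarSubalgebra ℂ (K →L[ℂ] K)}
    {ω : StrongDual ℂ M} (hω : ω ∈ predual M) :
    ∃ f : (K →L[ℂ] K) → ℂ, IsNormal f ∧ ∀ x : M, ω x = f x := by
  let I := {p : (ℕ → K) × (ℕ → K) //
      (Summable fun n => ‖p.1 n‖ ^ 2) ∧ Summable fun n => ‖p.2 n‖ ^ 2}
  let f : I → M →ₗ[ℂ] ℂ := fun p =>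
    { toFun := fun x => ⟪mkl2 _ p.2.1, amp ℕ (x : K →L[ℂ] K) (mkl2 _ p.2.2)⟫_ℂ
      map_add' := fun x y => by simp [inner_add_right]
      map_smul' := fun z x => by simp [inner_smul_right] }
  have h : ω.toLinearMap ∈ Submodule.span ℂ (Set.range f) := by
    rw [LinearMap.mem_span_iff_continuous]
    have e : (ultraweak K).induced (fun x : M => (x : K →L[ℂ] K)) =
        ⨅ p : I, TopologicalSpace.induced (fun x => f p x) inferInstance := by
      rw [ultraweak, induced_iInf]
      refine iInf_congr fun p => ?_
      rw [induced_compose]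
      congr 1
    rw [← e]
    exact hω
  have key : ∀ φ ∈ Submodule.span ℂ (Set.range f),
      ∃ g : (K →L[ℂ] K) → ℂ, IsNormal g ∧ ∀ x : M, φ x = g x := by
    intro φ hφ
    induction hφ using Submodule.span_induction with
    | mem φ hφ =>
      obtain ⟨p, rfl⟩ := hφ
      exact ⟨_, ⟨_, _, fun T => rfl⟩, fun x => rfl⟩
    | zero => exact ⟨_, .zero, fun x => rfl⟩
    | add φ ψ _ _ hφ hψ =>
      obtain ⟨g, hg, h⟩ := hφ
      obtain ⟨g', hg', h'⟩ := hψ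
      exact ⟨_, hg.add hg', fun x => by rw [LinearMap.add_apply, h, h']⟩
    | smul z φ _ hφ =>
      obtain ⟨g, hg, h⟩ := hφ
      exact ⟨_, hg.smul z, fun x => by rw [LinearMap.smul_apply, h, smul_eq_mul]⟩
  exact key _ h

end Lp

end BornQG


namespace BornQG

/-! ### The Hilbert space tensor product -/

section HilbertTensor

variable {H : Type*} [NormedAddCommGroup H] [InnerProductSpace ℂ H]

/-- The elementary tensors as a continuous bilinear map. -/
noncomputable def htmulL (H : Type*) [NormedAddCommGroup H] [InnerProductSpace ℂ H] :
    H →L[ℂ] H →L[ℂ] HTensor H :=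
  (ContinuousLinearMap.compL ℂ H (H ⊗[ℂ] H) (HTensor H)
    (UniformSpace.Completion.toComplL (𝕜 := ℂ) (E := H ⊗[ℂ] H))).comp (TensorProduct.mkL ℂ H H)

lemma htmulL_apply (ξ η : H) : htmulL H ξ η = htmul ξ η := rfl

lemma continuous_htmul {X : Type*} [TopologicalSpace X] {f g : X → H} (hf : Continuous f)
    (hg : Continuous g) : Continuous fun x => htmul (f x) (g x) :=
  (htmulL H).continuous₂.comp (hf.prodMk hg)

lemma inner_htmul (ξ η ξ' η' : H) :
    ⟪htmul ξ η, htmul ξ' η'⟫_ℂ = ⟪ξ, ξ'⟫_ℂ * ⟪η, η'⟫_ℂ := by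
  rw [htmul, htmul, UniformSpace.Completion.inner_coe, TensorProduct.inner_tmul]

lemma norm_htmul (ξ η : H) : ‖htmul ξ η‖ = ‖ξ‖ * ‖η‖ := by
  rw [htmul, UniformSpace.Completion.norm_coe, TensorProduct.norm_tmul]

lemma opTensor_htmul (x y : H →L[ℂ] H) (ξ η : H) :
    opTensor x y (htmul ξ η) = htmul (x ξ) (y η) :=
  ContinuousLinearMap.completion_apply_coe _ _

lemma tensorRight_apply (ξ η : H) : tensorRight η ξ = htmul ξ η := rfl

lemma htmul_ext {E : Type*} [NormedAddCommGroup E] [NormedSpace ℂ E] {T T' : HTensor H →L[ℂ] E}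
    (h : ∀ ξ η, T (htmul ξ η) = T' (htmul ξ η)) : T = T' := by
  ext v
  induction v using UniformSpace.Completion.induction_on with
  | hp => exact isClosed_eq T.continuous T'.continuous
  | ih t =>
    induction t using TensorProduct.induction_on with
    | zero => rw [UniformSpace.Completion.coe_zero, map_zero, map_zero]
    | tmul ξ η => exact h ξ η
    | add s t hs ht => rw [UniformSpace.Completion.coe_add, map_add, map_add, hs, ht]

/-- Operators agreeing on the elementary tensors of vectors from a dense set are equal. -/
lemma htmul_ext_dense {E : Type*} [NormedAddCommGroup E] [NormedSpace ℂ E]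
    {T T' : HTensor H →L[ℂ] E} {X : Type*} {Λ : X → H} (hΛ : DenseRange Λ)
    (h : ∀ a b, T (htmul (Λ a) (Λ b)) = T' (htmul (Λ a) (Λ b))) : T = T' := by
  refine htmul_ext fun ξ η => ?_
  refine hΛ.induction_on (p := fun ξ => T (htmul ξ η) = T' (htmul ξ η)) ξ
    (isClosed_eq (T.continuous.comp (continuous_htmul continuous_id continuous_const))
      (T'.continuous.comp (continuous_htmul continuous_id continuous_const))) fun a => ?_
  exact hΛ.induction_on (p := fun η => T (htmul (Λ a) η) = T' (htmul (Λ a) η)) η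
    (isClosed_eq (T.continuous.comp (continuous_htmul continuous_const continuous_id))
      (T'.continuous.comp (continuous_htmul continuous_const continuous_id))) fun b => h a b

lemma eq_zero_of_inner_htmul {v : HTensor H} (h : ∀ ξ η, ⟪htmul ξ η, v⟫_ℂ = 0) : v = 0 := by
  have : innerSL ℂ v = 0 := htmul_ext fun ξ η => by
    rw [innerSL_apply_apply, ← inner_conj_symm, h]
    simp
  have h1 : innerSL ℂ v v = 0 := by rw [this]; rfl
  simpa using h1

variable [CompleteSpace H]

lemma star_opTensor (x y : H →L[ℂ] H) : star (opTensor x y) = opTensor (star x) (star y) := by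
  refine htmul_ext fun ξ η => ?_
  rw [← sub_eq_zero]
  refine eq_zero_of_inner_htmul fun ξ' η' => ?_
  rw [inner_sub_right, ContinuousLinearMap.star_eq_adjoint,
    ContinuousLinearMap.adjoint_inner_right, opTensor_htmul, opTensor_htmul, inner_htmul,
    inner_htmul, ContinuousLinearMap.star_eq_adjoint, ContinuousLinearMap.star_eq_adjoint,
    ContinuousLinearMap.adjoint_inner_right, ContinuousLinearMap.adjoint_inner_right, sub_self]

/-- `opTensor` as a bilinear map. -/
noncomputable def opTensorL (H : Type*) [NormedAddCommGroup H] [InnerProductSpace ℂ H] :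
    (H →L[ℂ] H) →ₗ[ℂ] (H →L[ℂ] H) →ₗ[ℂ] (HTensor H →L[ℂ] HTensor H) :=
  LinearMap.mk₂ ℂ opTensor
    (fun x x' y => htmul_ext fun ξ η => by
      change _ = opTensor x y _ + opTensor x' y _
      simp only [opTensor_htmul]
      simp only [← htmulL_apply, map_add, ContinuousLinearMap.add_apply])
    (fun z x y => htmul_ext fun ξ η => by
      change _ = z • opTensor x y _
      simp only [opTensor_htmul]
      simp only [← htmulL_apply, map_smul, ContinuousLinearMap.smul_apply])
    (fun x y y' => htmul_ext fun ξ η => by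
      change _ = opTensor x y _ + opTensor x y' _
      simp only [opTensor_htmul]
      simp only [← htmulL_apply, map_add, ContinuousLinearMap.add_apply])
    (fun z x y => htmul_ext fun ξ η => by
      change _ = z • opTensor x y _
      simp only [opTensor_htmul]
      simp only [← htmulL_apply, map_smul, ContinuousLinearMap.smul_apply])

@[simp] lemma opTensorL_apply (x y : H →L[ℂ] H) : opTensorL H x y = opTensor x y := rfl

lemma norm_opTensor_le (x y : H →L[ℂ] H) : ‖opTensor x y‖ ≤ ‖x‖ * ‖y‖ := by
  refine ContinuousLinearMap.opNorm_le_bound _ (by positivity) fun v => ?_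
  induction v using UniformSpace.Completion.induction_on with
  | hp => exact isClosed_le (opTensor x y).continuous.norm (continuous_const.mul continuous_norm)
  | ih t =>
    rw [opTensor, ContinuousLinearMap.completion_apply_coe, UniformSpace.Completion.norm_coe,
      UniformSpace.Completion.norm_coe]
    exact ((TensorProduct.mapL x y).le_opNorm t).trans
      (mul_le_mul_of_nonneg_right (TensorProduct.norm_mapL_le x y) (norm_nonneg _))

lemma isAmplification_opTensor : IsAmplification (opTensorL H 1) (htmulL H) where
  map_star x := by
    rw [opTensorL_apply, opTensorL_apply, star_opTensor, star_one]
  comm x i w := by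
    rw [opTensorL_apply, htmulL_apply, opTensor_htmul]
    rfl
  total v hv := eq_zero_of_inner_htmul hv

lemma inner_slice (ξ η v w : H) (T : HTensor H →L[ℂ] HTensor H) :
    ⟪v, slice ξ η T w⟫_ℂ = ⟪htmul v ξ, T (htmul w η)⟫_ℂ := by
  change ⟪v, ContinuousLinearMap.adjoint (tensorRight ξ) (T (htmul w η))⟫_ℂ = _
  rw [ContinuousLinearMap.adjoint_inner_right, tensorRight_apply]

lemma star_slice (ξ η : H) (T : HTensor H →L[ℂ] HTensor H) :
    star (slice ξ η T) = slice η ξ (star T) := by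
  ext w
  refine ext_inner_left ℂ fun v => ?_
  rw [inner_slice, ContinuousLinearMap.star_eq_adjoint, ContinuousLinearMap.star_eq_adjoint,
    ContinuousLinearMap.adjoint_inner_right, ContinuousLinearMap.adjoint_inner_right,
    ← inner_conj_symm, inner_slice, inner_conj_symm]

/-- The slices as a sesquilinear map. -/
noncomputable def sliceL (T : HTensor H →L[ℂ] HTensor H) : H →ₗ⋆[ℂ] H →ₗ[ℂ] (H →L[ℂ] H) :=
  LinearMap.mk₂'ₛₗ (starRingEnd ℂ) (RingHom.id ℂ) (fun ξ η => slice ξ η T)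
    (fun ξ ξ' η => by
      ext w
      refine ext_inner_left ℂ fun v => ?_
      change _ = ⟪v, slice ξ η T w + slice ξ' η T w⟫_ℂ
      simp only [inner_add_right, inner_slice, ← htmulL_apply, map_add, inner_add_left])
    (fun z ξ η => by
      ext w
      refine ext_inner_left ℂ fun v => ?_
      change _ = ⟪v, (starRingEnd ℂ z) • slice ξ η T w⟫_ℂ
      simp only [inner_smul_right, inner_slice, ← htmulL_apply, map_smul, inner_smul_left])
    (fun ξ η η' => by
      ext w
      refine ext_inner_left ℂ fun v => ?_
      change _ = ⟪v, slice ξ η T w + slice ξ η' T w⟫_ℂ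
      simp only [inner_add_right, inner_slice, ← htmulL_apply, map_add])
    (fun z ξ η => by
      ext w
      refine ext_inner_left ℂ fun v => ?_
      change _ = ⟪v, z • slice ξ η T w⟫_ℂ
      simp only [inner_smul_right, inner_slice, ← htmulL_apply, map_smul])

@[simp] lemma sliceL_apply (ξ η : H) (T : HTensor H →L[ℂ] HTensor H) :
    sliceL T ξ η = slice ξ η T := rfl

lemma norm_slice_le (ξ η : H) (T : HTensor H →L[ℂ] HTensor H) :
    ‖slice ξ η T‖ ≤ ‖T‖ * ‖ξ‖ * ‖η‖ := by
  refine ContinuousLinearMap.opNorm_le_bound _ (by positivity) fun w => ?_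
  by_cases h0 : slice ξ η T w = 0
  · rw [h0, norm_zero]
    positivity
  · have hpos : 0 < ‖slice ξ η T w‖ := norm_pos_iff.2 h0
    have h1 : ‖slice ξ η T w‖ * ‖slice ξ η T w‖ ≤
        ‖slice ξ η T w‖ * (‖T‖ * ‖ξ‖ * ‖η‖ * ‖w‖) := by
      calc ‖slice ξ η T w‖ * ‖slice ξ η T w‖ = ‖⟪slice ξ η T w, slice ξ η T w⟫_ℂ‖ := by
            rw [inner_self_eq_norm_sq_to_K, norm_pow, RCLike.norm_ofReal, abs_norm, sq]
        _ = ‖⟪htmul (slice ξ η T w) ξ, T (htmul w η)⟫_ℂ‖ := by rw [inner_slice]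
        _ ≤ ‖htmul (slice ξ η T w) ξ‖ * (‖T‖ * ‖htmul w η‖) := (norm_inner_le_norm _ _).trans
            (mul_le_mul_of_nonneg_left (T.le_opNorm _) (norm_nonneg _))
        _ = _ := by
            rw [norm_htmul, norm_htmul]
            ring
    exact le_of_mul_le_mul_left h1 hpos

lemma continuous_slice_left (η : H) (T : HTensor H →L[ℂ] HTensor H) :
    Continuous fun ξ => slice ξ η T :=
  AddMonoidHomClass.continuous_of_bound ((sliceL T).flip η) (‖T‖ * ‖η‖) fun ξ => by
    rw [LinearMap.flip_apply, sliceL_apply]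
    exact (norm_slice_le ξ η T).trans_eq (by ring)

lemma continuous_slice_right (ξ : H) (T : HTensor H →L[ℂ] HTensor H) :
    Continuous fun η => slice ξ η T :=
  AddMonoidHomClass.continuous_of_bound (sliceL T ξ) (‖T‖ * ‖ξ‖) fun η => by
    rw [sliceL_apply]
    exact norm_slice_le ξ η T

end HilbertTensor

/-! ### Normal functionals defined by tensors -/

section VecFun

variable {K : Type*} [NormedAddCommGroup K] [InnerProductSpace ℂ K]
  {V W : Type*} [AddCommGroup V] [Module ℂ V] [Bornology V]
  [AddCommGroup W] [Module ℂ W] [Bornology W]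

lemma exists_norm_le_of_isBoundedMap {E : Type*} [SeminormedAddCommGroup E] {f : V → E}
    (hf : IsBoundedMap f) {s : Set V} (hs : IsBounded s) : ∃ r, ∀ v ∈ s, ‖f v‖ ≤ r := by
  obtain ⟨r, hr⟩ := (hf s hs).exists_norm_le
  exact ⟨r, fun v hv => hr _ ⟨v, hv, rfl⟩⟩

instance completeBornological_clm {E F : Type*} [NormedAddCommGroup E] [NormedSpace ℂ E]
    [NormedAddCommGroup F] [NormedSpace ℂ F] [CompleteSpace F] :
    CompleteBornological (E →L[ℂ] F) :=
  completeBornological_of_banach (E := E →L[ℂ] F)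

/-- The evaluation of an operator valued map at a vector. -/
noncomputable def BL.eval {E F : Type*} [NormedAddCommGroup E] [NormedSpace ℂ E]
    [NormedAddCommGroup F] [NormedSpace ℂ F] (f : BL V (E →L[ℂ] F)) (e : E) : BL V F where
  toFun v := f v e
  map_add' v w := by rw [map_add, ContinuousLinearMap.add_apply]
  map_smul' z v := by rw [map_smul, ContinuousLinearMap.smul_apply, RingHom.id_apply]
  bounded' := by
    intro s hs
    obtain ⟨r, hr⟩ := exists_norm_le_of_isBoundedMap f.bounded hs
    refine isBounded_iff_forall_norm_le.2 ⟨r * ‖e‖, ?_⟩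
    rintro _ ⟨v, hv, rfl⟩
    exact (f v).le_of_opNorm_le (hr v hv) e

@[simp] lemma BL.eval_apply {E F : Type*} [NormedAddCommGroup E] [NormedSpace ℂ E]
    [NormedAddCommGroup F] [NormedSpace ℂ F] (f : BL V (E →L[ℂ] F)) (e : E) (v : V) :
    f.eval e v = f v e := rfl

/-- The map `v ⊗ w ↦ ⟪Q w, · (P v)⟫`. -/
noncomputable def vecFunT (P : V →ₗ[ℂ] K) (Q : W →ₗ⋆[ℂ] K) (hP : IsBoundedMap P)
    (hQ : IsBoundedMap Q) : BL (CTensor V W) (StrongDual ℂ (K →L[ℂ] K)) :=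
  BL.ofLift (LinearMap.mk₂ ℂ (fun v w => vecFun (Q w) (P v))
    (fun v v' w => by ext T; simp [inner_add_right])
    (fun z v w => by
      ext T
      rw [vecFun_apply, map_smul, map_smul, inner_smul_right]
      rfl)
    (fun v w w' => by ext T; simp [inner_add_left])
    (fun z v w => by ext T; simp [inner_smul_left, mul_comm])) (by
      intro s t hs ht
      obtain ⟨r, hr⟩ := exists_norm_le_of_isBoundedMap hP hs
      obtain ⟨r', hr'⟩ := exists_norm_le_of_isBoundedMap hQ ht
      refine isBounded_iff_forall_norm_le.2 ⟨r' * r, ?_⟩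
      rintro _ ⟨v, hv, w, hw, rfl⟩
      exact (norm_vecFun_le _ _).trans (mul_le_mul (hr' w hw) (hr v hv) (norm_nonneg _)
        ((norm_nonneg _).trans (hr' w hw))))

variable {P : V →ₗ[ℂ] K} {Q : W →ₗ⋆[ℂ] K} {hP : IsBoundedMap P} {hQ : IsBoundedMap Q}

lemma vecFunT_ctmul (v : V) (w : W) : vecFunT P Q hP hQ (ctmul v w) = vecFun (Q w) (P v) :=
  BL.ofLift_ctmul _ _ v w

/-- The evaluation of `vecFunT` at an operator. -/
noncomputable def vecFunE (P : V →ₗ[ℂ] K) (Q : W →ₗ⋆[ℂ] K) (hP : IsBoundedMap P)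
    (hQ : IsBoundedMap Q) (T : K →L[ℂ] K) : BL (CTensor V W) ℂ :=
  (vecFunT P Q hP hQ).eval T

lemma vecFunE_apply (T : K →L[ℂ] K) (u : CTensor V W) :
    vecFunE P Q hP hQ T u = vecFunT P Q hP hQ u T := rfl

lemma vecFunE_ctmul (T : K →L[ℂ] K) (v : V) (w : W) :
    vecFunE P Q hP hQ T (ctmul v w) = ⟪Q w, T (P v)⟫_ℂ := by
  rw [vecFunE_apply, vecFunT_ctmul, vecFun_apply]

/-- A coefficient `c` is split as `√|c| · (c / √|c|)`. Both families of vectors become square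
summable, since the vectors are bounded on the support of the series. -/
lemma isNormal_vecFunE (u : CTensor V W) : IsNormal fun T => vecFunE P Q hP hQ T u := by
  obtain ⟨c, rfl⟩ := Submodule.mkQ_surjective _ u
  obtain ⟨hc, s, t, hs, ht, hst⟩ := c.2
  obtain ⟨r, hr⟩ := exists_norm_le_of_isBoundedMap hP hs
  obtain ⟨r', hr'⟩ := exists_norm_le_of_isBoundedMap hQ ht
  have hsq : ∀ p, (√‖c.1 p‖ : ℝ) ^ 2 = ‖c.1 p‖ := fun p => Real.sq_sqrt (norm_nonneg _)
  have key : ∀ (ζ : V × W → K) (R : ℝ), (∀ p, c.1 p ≠ 0 → ‖ζ p‖ ≤ R) → ∀ d : V × W → ℂ,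
      (∀ p, ‖d p‖ = √‖c.1 p‖) → Summable fun p => ‖d p • ζ p‖ ^ 2 := by
    intro ζ R hR d hd
    refine Summable.of_nonneg_of_le (fun p => by positivity) (fun p => ?_) (hc.mul_right (R ^ 2))
    rw [norm_smul, mul_pow, hd, hsq]
    by_cases h0 : c.1 p = 0
    · rw [h0]
      simp
    · exact mul_le_mul_of_nonneg_left (pow_le_pow_left₀ (norm_nonneg _) (hR p h0) 2)
        (norm_nonneg _)
  have h1 := key (fun p => Q p.2) r' (fun p hp => hr' _ (hst p hp).2)
    (fun p => (√‖c.1 p‖ : ℝ)) (fun p => by simp [abs_of_nonneg])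
  have h2 := key (fun p => P p.1) r (fun p hp => hr _ (hst p hp).1)
    (fun p => c.1 p / (√‖c.1 p‖ : ℝ)) (fun p => by
      rw [norm_div, Complex.norm_real, Real.norm_of_nonneg (Real.sqrt_nonneg _)]
      exact Real.div_sqrt)
  obtain ⟨a, b, hab⟩ := isNormal_of_index (mkl2 _ h1) (mkl2 _ h2)
  refine ⟨a, b, fun T => ?_⟩
  rw [← hab]
  beta_reduce
  have h3 := hasSum_apply (vecFunE P Q hP hQ T) c
  have h4 := lp.hasSum_inner (𝕜 := ℂ) (mkl2 _ h1) (amp _ T (mkl2 _ h2))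
  simp only [amp_apply, mkl2_apply, map_smul, inner_smul_left, inner_smul_right] at h4
  refine h3.unique (h4.congr_fun fun p => ?_)
  rw [vecFunE_ctmul, smul_eq_mul, ← mul_assoc, Complex.conj_ofReal]
  congr 1
  by_cases h0 : c.1 p = 0
  · simp [h0]
  · have : ((√‖c.1 p‖ : ℝ) : ℂ) ≠ 0 := by
      simpa [Real.sqrt_eq_zero] using h0
    field_simp

end VecFun

end BornQG


namespace BornQG

namespace IsGNSPair

variable {A : Type*} [NonUnitalRing A] [Module ℂ A] [IsScalarTower ℂ A A] [SMulCommClass ℂ A A]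
  [StarRing A] [StarModule ℂ A] [Bornology A] [CompleteBornological A]
  {H : Type*} [NormedAddCommGroup H] [InnerProductSpace ℂ H] [CompleteSpace H]
  {G : BornologicalQuantumGroup A} {Λ : A →ₗ[ℂ] H} (hΛ : IsGNSPair G Λ)

/-! ### The GNS map and its tensor square -/

/-- `‖Λ(a)‖² = φ(a*a)`, and the product, the involution and `φ` are bounded. -/
lemma isBoundedMap_Λ (hΛ : IsGNSPair G Λ) : IsBoundedMap Λ := by
  intro s hs
  have h := G.φ.bounded _ (G.bounded_mul _ _ (G.bounded_star s hs) hs)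
  obtain ⟨r, hr⟩ := h.exists_norm_le
  refine isBounded_iff_forall_norm_le.2 ⟨√r, ?_⟩
  rintro _ ⟨a, ha, rfl⟩
  refine Real.le_sqrt_of_sq_le ?_
  have h1 := hr _ ⟨_, ⟨star a, ⟨a, ha, rfl⟩, a, ha, rfl⟩, rfl⟩
  beta_reduce at h1
  rw [G.φ_apply, ← hΛ.inner_eq, inner_self_eq_norm_sq_to_K, norm_pow, RCLike.norm_ofReal,
    abs_norm] at h1
  exact h1

/-- The GNS map. -/
def ΛB : BL A H := ⟨Λ, hΛ.isBoundedMap_Λ⟩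

lemma ΛB_apply (a : A) : hΛ.ΛB a = Λ a := rfl

lemma inner_Λ (hΛ : IsGNSPair G Λ) (f g : A) : ⟪Λ f, Λ g⟫_ℂ = G.φ (star f * g) := hΛ.inner_eq f g

/-- The map `Λ ⊗ Λ`. -/
noncomputable def Λ₂ : BL (CTensor A A) (HTensor H) :=
  BL.ofLift (LinearMap.mk₂ ℂ (fun a b => htmul (Λ a) (Λ b))
    (fun a a' b => by simp only [← htmulL_apply, map_add, ContinuousLinearMap.add_apply])
    (fun z a b => by simp only [← htmulL_apply, map_smul, ContinuousLinearMap.smul_apply])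
    (fun a b b' => by simp only [← htmulL_apply, map_add])
    (fun z a b => by simp only [← htmulL_apply, map_smul])) (by
      intro s t hs ht
      obtain ⟨r, hr⟩ := exists_norm_le_of_isBoundedMap hΛ.isBoundedMap_Λ hs
      obtain ⟨r', hr'⟩ := exists_norm_le_of_isBoundedMap hΛ.isBoundedMap_Λ ht
      refine isBounded_iff_forall_norm_le.2 ⟨r * r', ?_⟩
      rintro _ ⟨v, hv, w, hw, rfl⟩
      exact (norm_htmul _ _).trans_le (mul_le_mul (hr v hv) (hr' w hw) (norm_nonneg _)
        ((norm_nonneg _).trans (hr v hv))))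

@[simp] lemma Λ₂_ctmul (a b : A) : hΛ.Λ₂ (ctmul a b) = htmul (Λ a) (Λ b) :=
  BL.ofLift_ctmul _ _ a b

lemma denseRange_Λ₂ : DenseRange hΛ.Λ₂ := by
  have h : (LinearMap.range hΛ.Λ₂.toLinearMap).topologicalClosure = ⊤ := by
    rw [Submodule.topologicalClosure_eq_top_iff, Submodule.eq_bot_iff]
    intro v hv
    rw [Submodule.mem_orthogonal] at hv
    have : innerSL ℂ v = 0 := htmul_ext_dense hΛ.denseRange fun a b => by
      rw [innerSL_apply_apply, ← inner_conj_symm, ← hΛ.Λ₂_ctmul, show ⟪hΛ.Λ₂ (ctmul a b), v⟫_ℂ = 0 from hv _ ⟨_, rfl⟩, map_zero]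
      rfl
    have h1 : innerSL ℂ v v = 0 := by rw [this]; rfl
    simpa using h1
  have h2 := (Submodule.dense_iff_topologicalClosure_eq_top).2 h
  exact h2

/-- Operators agreeing on the range of `Λ₂` are equal. -/
lemma ext_Λ₂ {E : Type*} [NormedAddCommGroup E] [NormedSpace ℂ E] {T T' : HTensor H →L[ℂ] E}
    (h : ∀ u, T (hΛ.Λ₂ u) = T' (hΛ.Λ₂ u)) : T = T' :=
  htmul_ext_dense hΛ.denseRange fun a b => by
    rw [← hΛ.Λ₂_ctmul]
    exact h _

/-- Operators agreeing on the range of `Λ` are equal. -/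
lemma ext_Λ (hΛ : IsGNSPair G Λ) {E : Type*} [NormedAddCommGroup E] [NormedSpace ℂ E]
    {T T' : H →L[ℂ] E} (h : ∀ a, T (Λ a) = T' (Λ a)) : T = T' :=
  DFunLike.coe_injective (hΛ.denseRange.equalizer T.continuous T'.continuous (funext h))

lemma ext_inner_Λ (hΛ : IsGNSPair G Λ) {v w : H} (h : ∀ a, ⟪Λ a, v⟫_ℂ = ⟪Λ a, w⟫_ℂ) : v = w :=
  ext_inner_left ℂ fun ξ => hΛ.denseRange.induction_on (p := fun ξ => ⟪ξ, v⟫_ℂ = ⟪ξ, w⟫_ℂ) ξ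
    (isClosed_eq (continuous_id.inner continuous_const) (continuous_id.inner continuous_const)) h

/-- The inner product with a fixed vector. -/
noncomputable def innerB {V K : Type*} [AddCommGroup V] [Module ℂ V] [Bornology V]
    [NormedAddCommGroup K] [InnerProductSpace ℂ K] (ξ : K) (P : BL V K) : BL V ℂ :=
  (BL.ofCLM (innerSL ℂ ξ)).comp P

@[simp] lemma innerB_apply {V K : Type*} [AddCommGroup V] [Module ℂ V] [Bornology V]
    [NormedAddCommGroup K] [InnerProductSpace ℂ K] (ξ : K) (P : BL V K) (v : V) :
    innerB ξ P v = ⟪ξ, P v⟫_ℂ := rfl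

lemma inner_Λ₂_ctmul (a b : A) (w : CTensor A A) :
    ⟪hΛ.Λ₂ (ctmul a b), hΛ.Λ₂ w⟫_ℂ =
      G.φ (BL.sr G.φ (BL.tmap (G.lm (star a)) (G.lm (star b)) w)) :=
  BL.congr (f := innerB (hΛ.Λ₂ (ctmul a b)) hΛ.Λ₂) (g := G.φ.comp ((BL.sr G.φ).comp
    (BL.tmap (G.lm (star a)) (G.lm (star b))))) (fun x y => by
      simp only [innerB_apply, Λ₂_ctmul, inner_htmul, hΛ.inner_Λ, BL.comp_apply, BL.tmap_ctmul,
        BL.sr_ctmul, map_smul, smul_eq_mul, BornologicalQuantumGroup.lm_apply]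
      ring) w

/-! ### The multiplicative unitary -/

/-- The map `f ⊗ g ↦ Δ(g) (f ⊗ 1)`. -/
noncomputable def V₀ (G : BornologicalQuantumGroup A) : BL (CTensor A A) (CTensor A A) :=
  G.gL.comp (BL.swap A A)

lemma V₀_ctmul (G : BornologicalQuantumGroup A) (f g : A) :
    V₀ G (ctmul f g) = G.gL (ctmul g f) := by
  simp [V₀]

lemma V₀_surjective (G : BornologicalQuantumGroup A) (u : CTensor A A) : ∃ v, V₀ G v = u :=
  ⟨BL.swap A A (G.gLinv u), by simp [V₀, BL.swap_swap, G.gL_gLinv]⟩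

lemma inner_V₀_ctmul (f g a b : A) :
    ⟪hΛ.Λ₂ (V₀ G (ctmul f g)), hΛ.Λ₂ (ctmul a b)⟫_ℂ =
      G.φ (BL.sr G.φ (BL.tmap (G.lm (star f)) (BL.id A) (G.dL (star g) (ctmul a b)))) := by
  rw [← inner_conj_symm, inner_Λ₂_ctmul, V₀_ctmul, ← G.haar_star, G.star_sr,
    G.starT_tmap_lm_rm, star_star, star_star, ← G.tmap_rm_gLs, ← G.starT_starT (G.gLs _),
    G.starT_gLs, star_star, star_star]

/-- The inner product is `(φ ⊗ φ)((f* ⊗ 1)Δ(g*g')(f' ⊗ 1))`, and left invariance evaluates it as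
`φ(f*f')φ(g*g')`. -/
lemma inner_V₀ (f g f' g' : A) :
    ⟪hΛ.Λ₂ (V₀ G (ctmul f g)), hΛ.Λ₂ (V₀ G (ctmul f' g'))⟫_ℂ =
      ⟪hΛ.Λ₂ (ctmul f g), hΛ.Λ₂ (ctmul f' g')⟫_ℂ := by
  have h := BL.congr (f := innerB (hΛ.Λ₂ (V₀ G (ctmul f g))) hΛ.Λ₂)
    (g := G.φ.comp ((BL.sr G.φ).comp ((BL.tmap (G.lm (star f)) (BL.id A)).comp
      (G.dL (star g))))) (fun a b => hΛ.inner_V₀_ctmul f g a b) (V₀ G (ctmul f' g'))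
  rw [innerB_apply] at h
  rw [h, V₀_ctmul, BL.comp_apply, BL.comp_apply, BL.comp_apply, G.dL_gL, BL.sr_tmap, show G.φ.comp (BL.id A) = G.φ from rfl,
    G.sr_gL, Λ₂_ctmul, Λ₂_ctmul, inner_htmul, hΛ.inner_Λ, hΛ.inner_Λ, map_smul, map_smul, smul_eq_mul,
    mul_comm]
  rfl

lemma inner_V₀_V₀ (u v : CTensor A A) :
    ⟪hΛ.Λ₂ (V₀ G u), hΛ.Λ₂ (V₀ G v)⟫_ℂ = ⟪hΛ.Λ₂ u, hΛ.Λ₂ v⟫_ℂ := by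
  have h1 : ∀ f g v, ⟪hΛ.Λ₂ (V₀ G (ctmul f g)), hΛ.Λ₂ (V₀ G v)⟫_ℂ =
      ⟪hΛ.Λ₂ (ctmul f g), hΛ.Λ₂ v⟫_ℂ := fun f g v =>
    BL.congr (f := innerB (hΛ.Λ₂ (V₀ G (ctmul f g))) (hΛ.Λ₂.comp (V₀ G)))
      (g := innerB (hΛ.Λ₂ (ctmul f g)) hΛ.Λ₂) (fun f' g' => hΛ.inner_V₀ f g f' g') v
  rw [← inner_conj_symm, ← inner_conj_symm (hΛ.Λ₂ u)]
  congr 1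
  exact BL.congr (f := innerB (hΛ.Λ₂ (V₀ G v)) (hΛ.Λ₂.comp (V₀ G)))
      (g := innerB (hΛ.Λ₂ v) hΛ.Λ₂) (fun f' g' => by
        rw [innerB_apply, innerB_apply, ← inner_conj_symm, ← inner_conj_symm (hΛ.Λ₂ v)]
        exact congrArg _ (h1 f' g' v)) u

/-- The adjoint of the multiplicative unitary. -/
noncomputable def V : HTensor H →L[ℂ] HTensor H :=
  LinearMap.extendOfNorm (hΛ.Λ₂.comp (V₀ G)).toLinearMap hΛ.Λ₂.toLinearMap

lemma V_Λ₂ (u : CTensor A A) : hΛ.V (hΛ.Λ₂ u) = hΛ.Λ₂ (V₀ G u) := by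
  refine LinearMap.extendOfNorm_eq (f := (hΛ.Λ₂.comp (V₀ G)).toLinearMap)
    (e := hΛ.Λ₂.toLinearMap) hΛ.denseRange_Λ₂ ⟨1, fun u => ?_⟩ u
  rw [one_mul]
  have h := hΛ.inner_V₀_V₀ u u
  rw [inner_self_eq_norm_sq_to_K, inner_self_eq_norm_sq_to_K] at h
  have h2 : ‖hΛ.Λ₂ (V₀ G u)‖ ^ 2 = ‖hΛ.Λ₂ u‖ ^ 2 := by exact_mod_cast h
  exact ((sq_eq_sq₀ (norm_nonneg _) (norm_nonneg _)).1 h2).le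

lemma star_V_mul_V : star hΛ.V * hΛ.V = 1 := by
  refine hΛ.ext_Λ₂ fun u => ?_
  rw [← sub_eq_zero]
  have : innerSL ℂ ((star hΛ.V * hΛ.V) (hΛ.Λ₂ u) - (1 : HTensor H →L[ℂ] HTensor H) (hΛ.Λ₂ u)) = 0 :=
    hΛ.ext_Λ₂ fun v => by
      rw [innerSL_apply_apply, inner_sub_left, ContinuousLinearMap.star_eq_adjoint]
      change ⟪ContinuousLinearMap.adjoint hΛ.V (hΛ.V _), _⟫_ℂ - ⟪hΛ.Λ₂ u, _⟫_ℂ = 0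
      rw [ContinuousLinearMap.adjoint_inner_left, V_Λ₂, V_Λ₂, inner_V₀_V₀, sub_self]
  have h1 := congrArg (fun T : HTensor H →L[ℂ] ℂ => T ((star hΛ.V * hΛ.V) (hΛ.Λ₂ u) -
    (1 : HTensor H →L[ℂ] HTensor H) (hΛ.Λ₂ u))) this
  simpa only [innerSL_apply_apply, ContinuousLinearMap.zero_apply, inner_self_eq_zero] using h1

lemma star_V_Λ₂ (u : CTensor A A) : star hΛ.V (hΛ.Λ₂ (V₀ G u)) = hΛ.Λ₂ u := by
  rw [← V_Λ₂]
  exact congrArg (fun T : HTensor H →L[ℂ] HTensor H => T (hΛ.Λ₂ u)) hΛ.star_V_mul_V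

/-- The isometry is onto because the Galois map has a right inverse built from the antipode. -/
lemma V_mul_star_V : hΛ.V * star hΛ.V = 1 := by
  refine hΛ.ext_Λ₂ fun u => ?_
  obtain ⟨v, rfl⟩ := V₀_surjective G u
  change hΛ.V (star hΛ.V _) = hΛ.Λ₂ _
  rw [star_V_Λ₂, V_Λ₂]

lemma isMultiplicativeUnitary : IsMultiplicativeUnitary G Λ (star hΛ.V) := by
  refine ⟨Unitary.star_mem ⟨hΛ.star_V_mul_V, hΛ.V_mul_star_V⟩, fun f g => ?_⟩
  rw [BL.lift_eq hΛ.Λ₂ _ (fun a b => hΛ.Λ₂_ctmul a b), ← Λ₂_ctmul]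
  have := hΛ.star_V_Λ₂ (ctmul f g)
  rwa [V₀_ctmul] at this

/-! ### The regular representation -/

/-- The map `a ⊗ b ↦ (ι ⊗ ω)(W*)` with `ω = ⟪Λ(star a), · Λ(b)⟫`. -/
noncomputable def sliceB : BL (CTensor A A) (H →L[ℂ] H) :=
  BL.ofLift (LinearMap.mk₂ ℂ (fun a b => slice (Λ (star a)) (Λ b) hΛ.V)
    (fun a a' b => by simp only [← sliceL_apply, star_add, map_add, LinearMap.add_apply])
    (fun z a b => by
      simp only [← sliceL_apply, star_smul, map_smul, map_smulₛₗ, LinearMap.smul_apply]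
      congr 1
      exact Complex.conj_conj z)
    (fun a b b' => by simp only [← sliceL_apply, map_add])
    (fun z a b => by simp only [← sliceL_apply, map_smul])) (by
      intro s t hs ht
      obtain ⟨r, hr⟩ := exists_norm_le_of_isBoundedMap hΛ.isBoundedMap_Λ (G.bounded_star s hs)
      obtain ⟨r', hr'⟩ := exists_norm_le_of_isBoundedMap hΛ.isBoundedMap_Λ ht
      refine isBounded_iff_forall_norm_le.2 ⟨‖hΛ.V‖ * r * r', ?_⟩
      rintro _ ⟨v, hv, w, hw, rfl⟩
      refine (norm_slice_le _ _ _).trans ?_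
      have h1 := hr _ ⟨v, hv, rfl⟩
      have h2 := (norm_nonneg _).trans h1
      exact mul_le_mul (mul_le_mul_of_nonneg_left h1 hΛ.V.opNorm_nonneg) (hr' w hw)
        (norm_nonneg _) (mul_nonneg hΛ.V.opNorm_nonneg h2))

lemma sliceB_ctmul (a b : A) : hΛ.sliceB (ctmul a b) = slice (Λ (star a)) (Λ b) hΛ.V :=
  BL.ofLift_ctmul _ _ a b

/-- The slices of `V` are left multiplication operators, by the elements `(ι ⊗ φ)((1 ⊗ a)Δ(b))`.
Being slices of a bounded operator, they yield boundedness of the regular representation. -/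
lemma sliceB_Λ (u : CTensor A A) (g : A) :
    hΛ.sliceB u (Λ g) = Λ (BL.sr G.φ (G.gR u) * g) := by
  refine BL.congr (f := hΛ.sliceB.eval (Λ g)) (g := hΛ.ΛB.comp ((G.rm g).comp
    ((BL.sr G.φ).comp G.gR))) (fun a b => hΛ.ext_inner_Λ fun c => ?_) u
  rw [BL.eval_apply, sliceB_ctmul, inner_slice, ← hΛ.Λ₂_ctmul, ← hΛ.Λ₂_ctmul, V_Λ₂, V₀_ctmul,
    inner_Λ₂_ctmul, star_star]
  simp only [BL.comp_apply, ΛB_apply, hΛ.inner_Λ, BornologicalQuantumGroup.rm_apply]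
  have h : BL.tmap (G.lm (star c)) (G.lm a) (G.gL (ctmul b g)) =
      BL.tmap (G.lm (star c)) (BL.id A) (BL.tmap (BL.id A) (G.lm a) (G.gL (ctmul b g))) := by
    rw [BL.tmap_tmap]
    rfl
  rw [h, G.lm_right_gL, BL.sr_tmap, BL.sr_tmap]
  rfl

/-- The regular representation. -/
noncomputable def m : BL A (H →L[ℂ] H) := hΛ.sliceB.comp G.exists_section_sr_gR.choose

lemma m_Λ (a g : A) : hΛ.m a (Λ g) = Λ (a * g) := by
  rw [m, BL.comp_apply, sliceB_Λ, G.exists_section_sr_gR.choose_spec]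

lemma isRegularRep : IsRegularRep Λ hΛ.m.toLinearMap := hΛ.m_Λ

lemma sliceB_eq (u : CTensor A A) : hΛ.sliceB u = hΛ.m (BL.sr G.φ (G.gR u)) :=
  hΛ.ext_Λ fun g => by rw [sliceB_Λ, m_Λ]

lemma m_mul (a b : A) : hΛ.m (a * b) = hΛ.m a * hΛ.m b :=
  hΛ.ext_Λ fun g => by
    change _ = hΛ.m a (hΛ.m b (Λ g))
    rw [m_Λ, m_Λ, m_Λ, mul_assoc]

lemma m_star (a : A) : hΛ.m (star a) = star (hΛ.m a) :=
  hΛ.ext_Λ fun g => hΛ.ext_inner_Λ fun f => by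
    rw [ContinuousLinearMap.star_eq_adjoint, ContinuousLinearMap.adjoint_inner_right, m_Λ, m_Λ,
      hΛ.inner_Λ, hΛ.inner_Λ, star_mul, mul_assoc]

/-- Such a vector is orthogonal to `Λ(xy) = m(x)Λ(y)` for all `x`, `y`, and products span `A` in the
completed sense. -/
lemma eq_zero_of_m_apply {v : H} (h : ∀ a, hΛ.m a v = 0) : v = 0 := by
  have h1 : ∀ a, ⟪v, Λ a⟫_ℂ = 0 := by
    intro a
    obtain ⟨u, rfl⟩ := G.exists_mulT a
    refine BL.congr (f := innerB v (hΛ.ΛB.comp G.mulT)) (g := BL.zero _ _) (fun x y => ?_) u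
    rw [innerB_apply, BL.comp_apply, G.mulT_ctmul, ΛB_apply, ← hΛ.m_Λ, ← star_star x, m_star,
      ContinuousLinearMap.star_eq_adjoint, ContinuousLinearMap.adjoint_inner_right, h,
      inner_zero_left, BL.zero_apply]
  refine hΛ.ext_inner_Λ fun a => ?_
  rw [← inner_conj_symm, h1, inner_zero_right, map_zero]

lemma slice_V (a b : A) : slice (Λ a) (Λ b) hΛ.V = hΛ.m (BL.sr G.φ (G.gR (ctmul (star a) b))) := by
  rw [← sliceB_eq, sliceB_ctmul, star_star]

lemma slice_star_V (a b : A) :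
    slice (Λ a) (Λ b) (star hΛ.V) = hΛ.m (BL.sr G.φ (G.gRs (ctmul (star a) b))) := by
  rw [← star_slice, slice_V, ← m_star, G.star_sr, ← G.starT_starT (G.gRs _), G.starT_gRs,
    star_star]

/-- The span of the regular representation is a nondegenerate `*`-algebra; hence it is ultraweakly
dense in the von Neumann algebra that it generates. -/
lemma inner_eq_zero_of_mem_LInfty {L I : Type*} [NormedAddCommGroup L] [InnerProductSpace ℂ L]
    [CompleteSpace L] {π : (H →L[ℂ] H) →ₗ[ℂ] (L →L[ℂ] L)} {J : I → H →L[ℂ] L}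
    (h : IsAmplification π J) {ξ η : L} (h0 : ∀ a, ⟪ξ, π (hΛ.m a) η⟫_ℂ = 0) {x : H →L[ℂ] H}
    (hx : x ∈ LInfty hΛ.m.toLinearMap) : ⟪ξ, π x η⟫_ℂ = 0 := by
  refine h.inner_eq_zero_of_mem_vnGen (S := LinearMap.range hΛ.m.toLinearMap) ?_ ?_ ?_ ?_ hx
  · rintro _ ⟨a, rfl⟩
    exact ⟨star a, hΛ.m_star a⟩
  · rintro _ ⟨a, rfl⟩ _ ⟨b, rfl⟩
    exact ⟨a * b, hΛ.m_mul a b⟩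
  · exact fun w hw => hΛ.eq_zero_of_m_apply fun a => hw _ ⟨a, rfl⟩
  · rintro _ ⟨a, rfl⟩
    exact h0 a

/-- Normal functionals agreeing on the regular representation agree on `L^∞`. -/
lemma eq_of_isNormal {f g : (H →L[ℂ] H) → ℂ} (hf : IsNormal f) (hg : IsNormal g)
    (h : ∀ a, f (hΛ.m a) = g (hΛ.m a)) {x : H →L[ℂ] H} (hx : x ∈ LInfty hΛ.m.toLinearMap) :
    f x = g x := by
  obtain ⟨ξ, η, hfg⟩ := hf.sub hg
  rw [← sub_eq_zero]
  refine (hfg x).trans (hΛ.inner_eq_zero_of_mem_LInfty (isAmplification_amp ℕ) (fun a => ?_) hx)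
  rw [← hfg]
  beta_reduce
  rw [h, sub_self]

end IsGNSPair

end BornQG


namespace BornQG

/-! ### Density in the predual. -/

section Predual

variable {K : Type*} [NormedAddCommGroup K] [InnerProductSpace ℂ K]

/-- The inclusion of a von Neumann algebra. -/
noncomputable def inclL [CompleteSpace K] (M : StarSubalgebra ℂ (K →L[ℂ] K)) :
    M →L[ℂ] (K →L[ℂ] K) where
  toFun x := x
  map_add' _ _ := rfl
  map_smul' _ _ := rfl
  cont := continuous_subtype_val

lemma norm_comp_inclL_le [CompleteSpace K] (M : StarSubalgebra ℂ (K →L[ℂ] K))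
    (f : StrongDual ℂ (K →L[ℂ] K)) : ‖f.comp (inclL M)‖ ≤ ‖f‖ :=
  ContinuousLinearMap.opNorm_le_bound _ (norm_nonneg _) fun x => f.le_opNorm (x : K →L[ℂ] K)

/-- The restriction of a normal functional, as an element of the predual. -/
noncomputable def restrict [CompleteSpace K] (M : StarSubalgebra ℂ (K →L[ℂ] K))
    (f : StrongDual ℂ (K →L[ℂ] K)) (hf : IsNormal f) : predual M :=
  ⟨f.comp (inclL M), hf.mem_predual fun _ => rfl⟩

@[simp] lemma restrict_apply [CompleteSpace K] (M : StarSubalgebra ℂ (K →L[ℂ] K))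
    (f : StrongDual ℂ (K →L[ℂ] K)) (hf : IsNormal f) (x : M) :
    (restrict M f hf).1 x = f x := rfl

/-- The predual is the closed span of the vector functionals. -/
lemma mem_of_vecFun_mem [CompleteSpace K] {M : StarSubalgebra ℂ (K →L[ℂ] K)}
    {N : Submodule ℂ (predual M)} (hN : IsClosed (N : Set (predual M))) {X : Type*} {Λ : X → K}
    (hΛ : DenseRange Λ) (h : ∀ a b, restrict M (vecFun (Λ a) (Λ b)) (.vec _ _) ∈ N)
    (ω : predual M) : ω ∈ N := by
  have hcont : ∀ {f g : K → K}, Continuous f → Continuous g →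
      Continuous fun ξ => restrict M (vecFun (f ξ) (g ξ)) (.vec _ _) := by
    intro f g hf hg
    refine Continuous.subtype_mk ?_ _
    have h1 : Continuous fun ξ => vecFun (f ξ) (g ξ) := by
      have h2 : Continuous fun ξ => ContinuousLinearMap.apply ℂ K (g ξ) :=
        (ContinuousLinearMap.apply ℂ K).continuous.comp hg
      exact ((innerSL ℂ).continuous.comp hf).clm_comp h2
    exact h1.clm_comp continuous_const
  have h1 : ∀ ξ η, restrict M (vecFun ξ η) (.vec _ _) ∈ N := by
    intro ξ η
    refine hΛ.induction_on (p := fun ξ => restrict M (vecFun ξ η) (.vec _ _) ∈ N) ξ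
      (hN.preimage (hcont continuous_id continuous_const)) fun a => ?_
    exact hΛ.induction_on (p := fun η => restrict M (vecFun (Λ a) η) (.vec _ _) ∈ N) η
      (hN.preimage (hcont continuous_const continuous_id)) fun b => h a b
  obtain ⟨f, ⟨ξ, η, hf⟩, hω⟩ := exists_isNormal_of_mem_predual ω.2
  -- By the inequality of arithmetic and geometric means the series of vector functionals converges
  -- absolutely in norm, so its sum lies in a closed subspace containing the terms.
  have hsum : Summable fun n => ‖ξ n‖ * ‖η n‖ := by
    refine Summable.of_nonneg_of_le (fun n => by positivity) (fun n => ?_)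
      ((summable_sq ξ).add (summable_sq η))
    nlinarith [sq_nonneg (‖ξ n‖ - ‖η n‖), sq_nonneg (‖ξ n‖), sq_nonneg (‖η n‖)]
  have hs : Summable fun n => (vecFun (ξ n) (η n)).comp (inclL M) :=
    Summable.of_norm_bounded hsum fun n => (norm_comp_inclL_le M _).trans (norm_vecFun_le _ _)
  have hval : HasSum (fun n => (restrict M (vecFun (ξ n) (η n)) (.vec _ _)).1) ω.1 := by
    have : ∑' n, (vecFun (ξ n) (η n)).comp (inclL M) = ω.1 := by
      ext x
      have h2 := (ContinuousLinearMap.apply ℂ ℂ x).hasSum hs.hasSum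
      rw [hω, hf, lp.inner_eq_tsum]
      exact h2.tsum_eq.symm
    rw [← this]
    exact hs.hasSum
  have hval' : HasSum (fun n => restrict M (vecFun (ξ n) (η n)) (.vec _ _)) ω :=
    Topology.IsInducing.subtypeVal.hasSum_iff (g := (predual M).subtype) _ _ |>.1 hval
  exact hN.mem_of_tendsto hval' (.of_forall fun s => N.sum_mem fun n _ => h1 _ _)

end Predual

namespace IsGNSPair

variable {A : Type*} [NonUnitalRing A] [Module ℂ A] [IsScalarTower ℂ A A] [SMulCommClass ℂ A A]
  [StarRing A] [StarModule ℂ A] [Bornology A] [CompleteBornological A]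
  {H : Type*} [NormedAddCommGroup H] [InnerProductSpace ℂ H] [CompleteSpace H]
  {G : BornologicalQuantumGroup A} {Λ : A →ₗ[ℂ] H} (hΛ : IsGNSPair G Λ)

/-! ### The coproduct of `L^∞` -/

lemma comulOp_star_V (x : H →L[ℂ] H) :
    comulOp (star hΛ.V) x = hΛ.V * opTensor 1 x * star hΛ.V :=
  congrArg (fun R => R * opTensor 1 x * star hΛ.V) (star_star hΛ.V)

/-- On the dense range of the Galois map this is `Δ(a)Δ(g)(f ⊗ 1) = Δ(ag)(f ⊗ 1)`: the operator
coproduct extends left multiplication by `Δ(a)`. -/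
lemma comulOp_Λ₂ (a : A) (u : CTensor A A) :
    comulOp (star hΛ.V) (hΛ.m a) (hΛ.Λ₂ u) = hΛ.Λ₂ (G.dL a u) := by
  obtain ⟨v, rfl⟩ := V₀_surjective G u
  rw [comulOp_star_V]
  change hΛ.V (opTensor 1 (hΛ.m a) (star hΛ.V _)) = _
  rw [star_V_Λ₂]
  refine BL.congr (f := (BL.ofCLM (hΛ.V.comp (opTensor 1 (hΛ.m a)))).comp hΛ.Λ₂)
    (g := hΛ.Λ₂.comp ((G.dL a).comp (V₀ G))) (fun f g => ?_) v
  change hΛ.V (opTensor 1 (hΛ.m a) (hΛ.Λ₂ _)) = hΛ.Λ₂ (G.dL a (V₀ G _))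
  rw [Λ₂_ctmul, opTensor_htmul, m_Λ, ContinuousLinearMap.one_apply, ← hΛ.Λ₂_ctmul, V_Λ₂, V₀_ctmul,
    V₀_ctmul, G.dL_gL]

/-- The map `m ⊗ m`. -/
noncomputable def m₂ : BL (CTensor A A) (HTensor H →L[ℂ] HTensor H) :=
  BL.ofLift ((opTensorL H).compl₁₂ hΛ.m.toLinearMap hΛ.m.toLinearMap) (by
    intro s t hs ht
    obtain ⟨r, hr⟩ := exists_norm_le_of_isBoundedMap hΛ.m.bounded hs
    obtain ⟨r', hr'⟩ := exists_norm_le_of_isBoundedMap hΛ.m.bounded ht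
    refine isBounded_iff_forall_norm_le.2 ⟨r * r', ?_⟩
    rintro _ ⟨v, hv, w, hw, rfl⟩
    exact (norm_opTensor_le _ _).trans (mul_le_mul (hr v hv) (hr' w hw) (norm_nonneg _)
      ((norm_nonneg _).trans (hr v hv))))

lemma m₂_ctmul (a b : A) : hΛ.m₂ (ctmul a b) = opTensor (hΛ.m a) (hΛ.m b) :=
  BL.ofLift_ctmul _ _ a b

lemma m₂_Λ₂ (u : CTensor A A) (p q : A) :
    hΛ.m₂ u (hΛ.Λ₂ (ctmul p q)) = hΛ.Λ₂ (BL.tmap (G.rm p) (G.rm q) u) :=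
  BL.congr (f := hΛ.m₂.eval (hΛ.Λ₂ (ctmul p q))) (g := hΛ.Λ₂.comp (BL.tmap (G.rm p) (G.rm q)))
    (fun a b => by
      rw [BL.eval_apply, m₂_ctmul, Λ₂_ctmul, opTensor_htmul, m_Λ, m_Λ, BL.comp_apply,
        BL.tmap_ctmul, Λ₂_ctmul]
      rfl) u

lemma comulOp_mul_m₂ (a : A) (u : CTensor A A) :
    comulOp (star hΛ.V) (hΛ.m a) * hΛ.m₂ u = hΛ.m₂ (G.dL a u) := by
  refine htmul_ext_dense hΛ.denseRange fun p q => ?_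
  rw [← hΛ.Λ₂_ctmul]
  change comulOp (star hΛ.V) (hΛ.m a) (hΛ.m₂ u _) = _
  rw [m₂_Λ₂, m₂_Λ₂, comulOp_Λ₂, G.dL_tmap_rm]

/-- Nondegeneracy of `m ⊗ m`: products exhaust `A`, so the vectors `Λ(ap) ⊗ Λ(bq)` determine an
operator. -/
lemma eq_of_mul_m₂ {T T' : HTensor H →L[ℂ] HTensor H} (h : ∀ u, T * hΛ.m₂ u = T' * hΛ.m₂ u) :
    T = T' := by
  have h1 : ∀ a p b q, T (hΛ.Λ₂ (ctmul (a * p) (b * q))) = T' (hΛ.Λ₂ (ctmul (a * p) (b * q))) := by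
    intro a p b q
    have := congrArg (fun R : HTensor H →L[ℂ] HTensor H => R (hΛ.Λ₂ (ctmul p q))) (h (ctmul a b))
    change T (hΛ.m₂ _ _) = T' (hΛ.m₂ _ _) at this
    rwa [m₂_Λ₂, BL.tmap_ctmul] at this
  refine htmul_ext_dense hΛ.denseRange fun x y => ?_
  obtain ⟨u, rfl⟩ := G.exists_mulT x
  obtain ⟨v, rfl⟩ := G.exists_mulT y
  rw [← hΛ.Λ₂_ctmul]
  refine BL.congr (f := (BL.ofCLM T).comp (hΛ.Λ₂.comp ((BL.tr A (G.mulT v)).comp G.mulT)))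
    (g := (BL.ofCLM T').comp (hΛ.Λ₂.comp ((BL.tr A (G.mulT v)).comp G.mulT))) (fun a p => ?_) u
  exact BL.congr (f := (BL.ofCLM T).comp (hΛ.Λ₂.comp ((BL.tl A (G.mulT (ctmul a p))).comp G.mulT)))
    (g := (BL.ofCLM T').comp (hΛ.Λ₂.comp ((BL.tl A (G.mulT (ctmul a p))).comp G.mulT)))
    (fun b q => by simpa using h1 a p b q) v

/-- By the bicommutant description it suffices to commute with every `T` in the commutant of the
operators `x ⊗ y`. For `m(a)` this follows from `Δ(m(a)) m₂(u) = m₂(Δ(a)u)`. -/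
lemma comulOp_mem {x : H →L[ℂ] H} (hx : x ∈ LInfty hΛ.m.toLinearMap) :
    comulOp (star hΛ.V) x ∈ vnTensor (LInfty hΛ.m.toLinearMap) := by
  let s : Set (HTensor H →L[ℂ] HTensor H) :=
    {T | ∃ x ∈ LInfty hΛ.m.toLinearMap, ∃ y ∈ LInfty hΛ.m.toLinearMap, T = opTensor x y}
  have key : ∀ T ∈ StarSubalgebra.centralizer ℂ s,
      T * comulOp (star hΛ.V) x = comulOp (star hΛ.V) x * T := by
    intro T hT
    have h1 : ∀ u, T * hΛ.m₂ u = hΛ.m₂ u * T := by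
      intro u
      ext v
      refine BL.congr (f := (BL.ofCLM T).comp (hΛ.m₂.eval v)) (g := hΛ.m₂.eval (T v))
        (fun a b => ?_) u
      have h2 := ((StarSubalgebra.mem_centralizer_iff ℂ).1 hT (opTensor (hΛ.m a) (hΛ.m b))
        ⟨_, mem_LInfty _ a, _, mem_LInfty _ b, rfl⟩).1
      change T (hΛ.m₂ (ctmul a b) v) = hΛ.m₂ (ctmul a b) (T v)
      rw [m₂_ctmul]
      exact (apply_comm_of_commute h2 v).symm
    have h2 : ∀ a, T * comulOp (star hΛ.V) (hΛ.m a) = comulOp (star hΛ.V) (hΛ.m a) * T := by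
      intro a
      refine hΛ.eq_of_mul_m₂ fun u => ?_
      rw [mul_assoc, comulOp_mul_m₂, h1, mul_assoc, h1, ← mul_assoc, comulOp_mul_m₂]
    -- Conjugation by `V` turns the coproduct into the amplification `1 ⊗ x`, for which commutation
    -- passes from `m(A)` to its bicommutant.
    have h3 : (star hΛ.V * T * hΛ.V) * opTensorL H 1 x = opTensorL H 1 x * (star hΛ.V * T * hΛ.V) := by
      refine isAmplification_opTensor.commute_of_mem_vnGen (s := Set.range hΛ.m.toLinearMap) ?_ ?_ hx
      · rintro _ ⟨a, rfl⟩
        exact ⟨star a, hΛ.m_star a⟩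
      · rintro _ ⟨a, rfl⟩
        have h4 := congrArg (fun R => star hΛ.V * R * hΛ.V) (h2 a)
        simp only [comulOp_star_V] at h4
        simp only [mul_assoc, hΛ.star_V_mul_V, mul_one] at h4
        simp only [← mul_assoc, hΛ.star_V_mul_V, one_mul] at h4
        rw [← mul_assoc, ← mul_assoc]
        exact h4
    have h4 := congrArg (fun R => hΛ.V * R * star hΛ.V) h3
    simp only [mul_assoc, hΛ.V_mul_star_V, mul_one] at h4
    simp only [← mul_assoc, hΛ.V_mul_star_V, one_mul] at h4
    simp only [comulOp_star_V]
    exact h4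
  exact (StarSubalgebra.mem_centralizer_iff ℂ).2 fun T hT => ⟨key T hT, key _ (star_mem hT)⟩

end IsGNSPair

end BornQG


namespace BornQG

/-! ### Interchange of the middle tensor factors. -/

namespace BL

variable {V W V' W' X : Type*} [AddCommGroup V] [Module ℂ V] [Bornology V]
  [AddCommGroup W] [Module ℂ W] [Bornology W] [AddCommGroup V'] [Module ℂ V'] [Bornology V']
  [AddCommGroup W'] [Module ℂ W'] [Bornology W'] [AddCommGroup X] [Module ℂ X] [Bornology X]
  [CompleteBornological V] [CompleteBornological W] [CompleteBornological V']
  [CompleteBornological W'] [CompleteBornological X]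

/-- The map `(v ⊗ w) ⊗ (v' ⊗ w') ↦ (v ⊗ v') ⊗ (w ⊗ w')`. -/
noncomputable def mid (V W V' W' : Type*) [AddCommGroup V] [Module ℂ V] [Bornology V]
    [AddCommGroup W] [Module ℂ W] [Bornology W] [AddCommGroup V'] [Module ℂ V'] [Bornology V']
    [AddCommGroup W'] [Module ℂ W'] [Bornology W'] [CompleteBornological V]
    [CompleteBornological W] [CompleteBornological V'] [CompleteBornological W'] :
    BL (CTensor (CTensor V W) (CTensor V' W')) (CTensor (CTensor V V') (CTensor W W')) :=
  (assocL V V' (CTensor W W')).comp ((tmap (BL.id V) ((assocR V' W W').comp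
    ((tmap (swap W V') (BL.id W')).comp (assocL W V' W')))).comp (assocR V W (CTensor V' W')))

@[simp] lemma mid_ctmul (v : V) (w : W) (v' : V') (w' : W') :
    mid V W V' W' (ctmul (ctmul v w) (ctmul v' w')) = ctmul (ctmul v v') (ctmul w w') := by
  simp [mid]

lemma congr_congr {f g : BL (CTensor (CTensor V W) (CTensor V' W')) X}
    (h : ∀ v w v' w', f (ctmul (ctmul v w) (ctmul v' w')) = g (ctmul (ctmul v w) (ctmul v' w')))
    (u : CTensor (CTensor V W) (CTensor V' W')) : f u = g u :=
  BL.congr (fun r s => BL.congr (f := f.comp (tr _ s)) (g := g.comp (tr _ s)) (fun v w =>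
    BL.congr (f := f.comp (tl _ (ctmul v w))) (g := g.comp (tl _ (ctmul v w)))
      (fun v' w' => h v w v' w') s) r) u

end BL

instance continuousAdd_predual {K : Type*} [NormedAddCommGroup K] [InnerProductSpace ℂ K]
    [CompleteSpace K] (M : StarSubalgebra ℂ (K →L[ℂ] K)) : ContinuousAdd (predual M) :=
  (predual M).toAddSubmonoid.continuousAdd

namespace IsNormal

variable {H : Type*} [NormedAddCommGroup H] [InnerProductSpace ℂ H]

/-- A normal functional factors through the amplification `x ↦ 1 ⊗ x`. -/
lemma exists_opTensor [Nontrivial H] {f : (H →L[ℂ] H) → ℂ} (hf : IsNormal f) :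
    ∃ g : (HTensor H →L[ℂ] HTensor H) → ℂ, IsNormal g ∧ ∀ x, g (opTensor 1 x) = f x := by
  obtain ⟨ξ, η, h⟩ := hf
  -- A fixed unit vector `e` gives `⟪e ⊗ ξ, (1 ⊗ x)(e ⊗ η)⟫ = ⟪ξ, xη⟫`.
  obtain ⟨e, he⟩ := exists_norm_eq H (zero_le_one (α := ℝ))
  have key : ∀ ζ : lp (fun _ : ℕ => H) 2, Summable fun n => ‖htmul e (ζ n)‖ ^ 2 := by
    intro ζ
    simpa only [norm_htmul, he, one_mul] using summable_sq ζ
  refine ⟨_, ⟨mkl2 _ (key ξ), mkl2 _ (key η), fun T => rfl⟩, fun x => ?_⟩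
  rw [h, lp.inner_eq_tsum, lp.inner_eq_tsum]
  congr 1
  ext n
  simp only [amp_apply, mkl2_apply, opTensor_htmul, inner_htmul, ContinuousLinearMap.one_apply]
  rw [inner_self_eq_norm_sq_to_K, he]
  simp

end IsNormal

namespace IsGNSPair

variable {A : Type*} [NonUnitalRing A] [Module ℂ A] [IsScalarTower ℂ A A] [SMulCommClass ℂ A A]
  [StarRing A] [StarModule ℂ A] [Bornology A] [CompleteBornological A]
  {H : Type*} [NormedAddCommGroup H] [InnerProductSpace ℂ H] [CompleteSpace H]
  {G : BornologicalQuantumGroup A} {Λ : A →ₗ[ℂ] H} (hΛ : IsGNSPair G Λ)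

/-- Normal functionals `f` on `B(H)` and `g` on `B(H ⊗ H)` with `f x = g (1 ⊗ x)` for all `x` in the
image of the regular representation have this property for all `x` in `L^∞`. -/
lemma eq_of_isNormal_opTensor {f : (H →L[ℂ] H) → ℂ} {g : (HTensor H →L[ℂ] HTensor H) → ℂ}
    (hf : IsNormal f) (hg : IsNormal g) (h : ∀ a, f (hΛ.m a) = g (opTensor 1 (hΛ.m a)))
    {x : H →L[ℂ] H} (hx : x ∈ LInfty hΛ.m.toLinearMap) : f x = g (opTensor 1 x) := by
  rcases subsingleton_or_nontrivial H with hH | hH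
  · rw [show x = hΛ.m 0 from ContinuousLinearMap.ext fun v => Subsingleton.elim _ _, h]
  · obtain ⟨f', hf', hff'⟩ := hf.exists_opTensor
    obtain ⟨ξ, η, hfg⟩ := hf'.sub hg
    rw [← hff', ← sub_eq_zero]
    -- Both functionals now live on `B(H ⊗ H)`, and density is applied to the composed amplification
    -- of `x ↦ 1 ⊗ x` on `ℓ²`.
    refine (hfg _).trans (hΛ.inner_eq_zero_of_mem_LInfty
      (isAmplification_opTensor.comp (isAmplification_amp ℕ)) (fun a => ?_) hx)
    refine (hfg (opTensor 1 (hΛ.m a))).symm.trans ?_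
    beta_reduce
    rw [hff', h, sub_self]

/-! ### The functionals on `L^∞` -/

/-- The map `p ↦ Λ(star (τ p))`. -/
noncomputable def Q (_ : IsGNSPair G Λ) (τ : BL A A) : A →ₗ⋆[ℂ] H where
  toFun p := Λ (star (τ p))
  map_add' p q := by rw [map_add, star_add, map_add]
  map_smul' z p := by
    rw [map_smul, star_smul, map_smul]
    rfl

lemma Q_apply (τ : BL A A) (p : A) : hΛ.Q τ p = Λ (star (τ p)) := rfl

lemma isBoundedMap_Q (τ : BL A A) : IsBoundedMap (hΛ.Q τ) := by
  intro s hs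
  have h := hΛ.isBoundedMap_Λ _ (G.bounded_star _ (τ.bounded s hs))
  rwa [← Set.image_comp, ← Set.image_comp] at h

/-- The map `w ↦ (Λ ⊗ Λ)(star ((τ ⊗ τ) w))`. -/
noncomputable def Q₂ (τ : BL A A) : CTensor A A →ₗ⋆[ℂ] HTensor H where
  toFun w := hΛ.Λ₂ (starT (BL.tmap τ τ w))
  map_add' p q := by simp only [map_add]
  map_smul' z p := by simp only [map_smul, map_smulₛₗ, RingHom.id_apply]

lemma Q₂_apply (τ : BL A A) (w : CTensor A A) :
    hΛ.Q₂ τ w = hΛ.Λ₂ (starT (BL.tmap τ τ w)) := rfl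

lemma isBoundedMap_Q₂ (τ : BL A A) : IsBoundedMap (hΛ.Q₂ τ) := by
  intro s hs
  have h := hΛ.Λ₂.bounded _ (G.starT_bounded_spec.1 _ ((BL.tmap τ τ).bounded s hs))
  rwa [← Set.image_comp, ← Set.image_comp] at h

/-- The normal functionals `η ⊗ p ↦ ⟪Λ(star (τ p)), · Λ(η)⟫`. -/
noncomputable def dualT (τ : BL A A) : BL (CTensor A A) (StrongDual ℂ (H →L[ℂ] H)) :=
  vecFunT Λ (hΛ.Q τ) hΛ.isBoundedMap_Λ (hΛ.isBoundedMap_Q τ)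

lemma dualT_ctmul (τ : BL A A) (a p : A) :
    hΛ.dualT τ (ctmul a p) = vecFun (Λ (star (τ p))) (Λ a) := vecFunT_ctmul _ _

lemma isNormal_dualT (τ : BL A A) (u : CTensor A A) : IsNormal (hΛ.dualT τ u) :=
  isNormal_vecFunE u

/-- The tensor products of the functionals `dualT u` and `dualT v`. -/
noncomputable def dualT₂ (τ : BL A A) (D : HTensor H →L[ℂ] HTensor H) :
    BL (CTensor (CTensor A A) (CTensor A A)) ℂ :=
  (vecFunE hΛ.Λ₂.toLinearMap (hΛ.Q₂ τ) hΛ.Λ₂.bounded (hΛ.isBoundedMap_Q₂ τ) D).comp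
    (BL.mid A A A A)

lemma dualT₂_ctmul (τ : BL A A) (D : HTensor H →L[ℂ] HTensor H) (a p b q : A) :
    hΛ.dualT₂ τ D (ctmul (ctmul a p) (ctmul b q)) =
      ⟪hΛ.Λ₂ (ctmul (star (τ p)) (star (τ q))), D (hΛ.Λ₂ (ctmul a b))⟫_ℂ := by
  rw [dualT₂, BL.comp_apply, BL.mid_ctmul, vecFunE_ctmul, Q₂_apply, BL.tmap_ctmul, G.starT_ctmul]
  rfl

lemma dualT₂_opTensor (τ : BL A A) (x y : H →L[ℂ] H) (u v : CTensor A A) :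
    hΛ.dualT₂ τ (opTensor x y) (ctmul u v) = hΛ.dualT τ u x * hΛ.dualT τ v y := by
  have h1 : ∀ a p v, hΛ.dualT₂ τ (opTensor x y) (ctmul (ctmul a p) v) =
      hΛ.dualT τ (ctmul a p) x * hΛ.dualT τ v y := fun a p v =>
    BL.congr (f := (hΛ.dualT₂ τ (opTensor x y)).comp (BL.tl _ (ctmul a p)))
      (g := BL.smulc (hΛ.dualT τ (ctmul a p) x) ((hΛ.dualT τ).eval y)) (fun b q => by
        rw [BL.comp_apply, BL.tl_apply, dualT₂_ctmul, Λ₂_ctmul, Λ₂_ctmul, opTensor_htmul,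
          inner_htmul, BL.smulc_apply, BL.eval_apply, dualT_ctmul, dualT_ctmul]
        rfl) v
  rw [mul_comm]
  exact BL.congr (f := (hΛ.dualT₂ τ (opTensor x y)).comp (BL.tr _ v))
      (g := BL.smulc (hΛ.dualT τ v y) ((hΛ.dualT τ).eval x)) (fun a p => by
        rw [BL.comp_apply, BL.tr_apply, h1, mul_comm]
        rfl) u

variable {τ : BL A A}

/-- For `u = b ⊗ p` this is the KMS property: `φ(τ(p)ab) = φ(abp)`. -/
lemma dualT_m (hτ : ∀ p x, G.φ (x * p) = G.φ (τ p * x)) (a : A) (u : CTensor A A) :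
    hΛ.dualT τ u (hΛ.m a) = G.φ (a * G.mulT u) :=
  BL.congr (f := (hΛ.dualT τ).eval (hΛ.m a)) (g := G.φ.comp ((G.lm a).comp G.mulT))
    (fun b p => by
      rw [BL.eval_apply, dualT_ctmul, vecFun_apply, m_Λ, hΛ.inner_Λ, star_star, ← hτ]
      simp [mul_assoc]) u

/-- The KMS property in both legs moves `τ(p) ⊗ τ(q)` from the left of `Δ(a)(b ⊗ c)` to the right,
where it becomes multiplication by `p ⊗ q`. -/
lemma dualT₂_comulOp (hτ : ∀ p x, G.φ (x * p) = G.φ (τ p * x)) (a : A) (u v : CTensor A A) :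
    hΛ.dualT₂ τ (comulOp (star hΛ.V) (hΛ.m a)) (ctmul u v) =
      G.φ (BL.sr G.φ (G.dL a (ctmul (G.mulT u) (G.mulT v)))) := by
  refine BL.congr_congr (f := hΛ.dualT₂ τ (comulOp (star hΛ.V) (hΛ.m a)))
    (g := G.φ.comp ((BL.sr G.φ).comp ((G.dL a).comp (BL.tmap G.mulT G.mulT))))
    (fun b p c q => ?_) (ctmul u v) |>.trans ?_
  · rw [dualT₂_ctmul, comulOp_Λ₂, inner_Λ₂_ctmul, star_star, star_star]
    have h := BL.congr (f := G.φ.comp ((BL.sr G.φ).comp (BL.tmap (G.lm (τ p)) (G.lm (τ q)))))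
      (g := G.φ.comp ((BL.sr G.φ).comp (BL.tmap (G.rm p) (G.rm q)))) (fun x y => by
        simp only [BL.comp_apply, BL.tmap_ctmul, BornologicalQuantumGroup.lm_apply,
          BornologicalQuantumGroup.rm_apply, BL.sr_ctmul, map_smul]
        rw [hτ p x, hτ q y]) (G.dL a (ctmul b c))
    simp only [BL.comp_apply, BL.tmap_ctmul, G.mulT_ctmul] at h ⊢
    rw [h, ← G.dL_tmap_rm, BL.tmap_ctmul]
    rfl
  · simp

/-- Elements of the predual of `L^∞` are determined by their values on the regular
representation. -/
lemma predual_ext {ω ω' : predual (LInfty hΛ.m.toLinearMap)}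
    (h : ∀ a, ω.1 ⟨hΛ.m a, mem_LInfty hΛ.m.toLinearMap a⟩ =
      ω'.1 ⟨hΛ.m a, mem_LInfty hΛ.m.toLinearMap a⟩) : ω = ω' := by
  obtain ⟨f, hf, hω⟩ := exists_isNormal_of_mem_predual ω.2
  obtain ⟨f', hf', hω'⟩ := exists_isNormal_of_mem_predual ω'.2
  refine Subtype.ext (ContinuousLinearMap.ext fun x => ?_)
  rw [hω, hω']
  refine hΛ.eq_of_isNormal hf hf' (fun a => ?_) x.2
  have := h a
  rwa [hω, hω'] at this

/-- The map from the convolution algebra to the predual of `L^∞`. -/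
theorem exists_toPredual (hτ : ∀ p x, G.φ (x * p) = G.φ (τ p * x)) :
    ∃ F : A →ₗ[ℂ] predual (LInfty hΛ.m.toLinearMap),
      ∀ u, F (G.mulT u) = restrict _ (hΛ.dualT τ u) (hΛ.isNormal_dualT τ u) := by
  -- The preimages under multiplication are arbitrary and `s` need not be linear: the functional on
  -- `m(A)`, hence on `L^∞`, depends only on `x`.
  choose s hs using G.exists_mulT
  let F₀ : A → predual (LInfty hΛ.m.toLinearMap) := fun x =>
    restrict _ (hΛ.dualT τ (s x)) (hΛ.isNormal_dualT τ (s x))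
  have h : ∀ x a, (F₀ x).1 ⟨hΛ.m a, mem_LInfty hΛ.m.toLinearMap a⟩ = G.φ (a * x) := by
    intro x a
    rw [restrict_apply, hΛ.dualT_m hτ, hs]
  have hadd : ∀ x y, F₀ (x + y) = F₀ x + F₀ y := fun x y => hΛ.predual_ext fun a => by
    rw [Submodule.coe_add, ContinuousLinearMap.add_apply, h, h, h, mul_add, map_add]
  have hsmul : ∀ (z : ℂ) x, F₀ (z • x) = z • F₀ x := fun z x => hΛ.predual_ext fun a => by
    rw [Submodule.coe_smul, ContinuousLinearMap.smul_apply, h, h, mul_smul_comm, map_smul]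
  refine ⟨⟨⟨F₀, hadd⟩, hsmul⟩, fun u => hΛ.predual_ext fun a => (h _ a).trans ?_⟩
  rw [restrict_apply, hΛ.dualT_m hτ]

/-! ### Properties of the map into the predual. -/

section ToPredual

variable {F : A →ₗ[ℂ] predual (LInfty hΛ.m.toLinearMap)}

lemma toPredual_m (hτ : ∀ p x, G.φ (x * p) = G.φ (τ p * x))
    (hF : ∀ u, F (G.mulT u) = restrict _ (hΛ.dualT τ u) (hΛ.isNormal_dualT τ u)) (x a : A) :
    (F x).1 ⟨hΛ.m a, mem_LInfty hΛ.m.toLinearMap a⟩ = G.φ (a * x) := by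
  obtain ⟨u, rfl⟩ := G.exists_mulT x
  rw [hF, restrict_apply, hΛ.dualT_m hτ]

/-- Essentiality is needed in its uniform form: the elements of a bounded set have representatives
in one bounded set of `A ⊗ A`. -/
lemma isBoundedMap_toPredual
    (hF : ∀ u, F (G.mulT u) = restrict _ (hΛ.dualT τ u) (hΛ.isNormal_dualT τ u)) :
    IsBoundedMap F := by
  intro s hs
  obtain ⟨C, hC, hCs⟩ := G.essential s hs
  obtain ⟨r, hr⟩ := exists_norm_le_of_isBoundedMap (hΛ.dualT τ).bounded hC
  have h : ∀ ω ∈ F '' s, ‖ω‖ ≤ r := by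
    rintro _ ⟨x, hx, rfl⟩
    rw [← hCs] at hx
    obtain ⟨u, hu, rfl⟩ := hx
    rw [BL.lift_eq G.mulT _ (fun x y => G.mulT_ctmul x y), hF]
    exact (norm_comp_inclL_le _ _).trans (hr u hu)
  exact (isBounded_iff_forall_norm_le (E := predual (LInfty hΛ.m.toLinearMap))).2 ⟨r, h⟩

/-- The functional `x̂ ⊗ ŷ` is itself a series of vector functionals on `H ⊗ H`, obtained by
regrouping the tensor factors. Its composition with the coproduct is a normal functional of `1 ⊗ x`,
so agreement on `m(A)` suffices. -/
lemma isConvolution_toPredual (hG : G.HasTrivialScaling)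
    (hτ : ∀ p x, G.φ (x * p) = G.φ (τ p * x))
    (hF : ∀ u, F (G.mulT u) = restrict _ (hΛ.dualT τ u) (hΛ.isNormal_dualT τ u)) (x y : A) :
    IsConvolution (star hΛ.V) (F (G.conv x y)) (F x) (F y) := by
  obtain ⟨u, rfl⟩ := G.exists_mulT x
  obtain ⟨v, rfl⟩ := G.exists_mulT y
  have hN : IsNormal fun D => hΛ.dualT₂ τ D (ctmul u v) := isNormal_vecFunE _
  refine ⟨restrict _ (vecFunT hΛ.Λ₂.toLinearMap (hΛ.Q₂ τ) hΛ.Λ₂.bounded (hΛ.isBoundedMap_Q₂ τ)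
    (BL.mid A A A A (ctmul u v))) hN, fun x y => ?_, fun x => ⟨hΛ.comulOp_mem x.2, ?_⟩⟩
  · rw [hF, hF]
    exact hΛ.dualT₂_opTensor τ x y u v
  · obtain ⟨f, hf, hω⟩ := exists_isNormal_of_mem_predual (F (G.conv (G.mulT u) (G.mulT v))).2
    rw [hω]
    refine hΛ.eq_of_isNormal_opTensor hf (hN.conj (star hΛ.V)) (fun a => ?_) x.2
    refine (hω ⟨hΛ.m a, mem_LInfty hΛ.m.toLinearMap a⟩).symm.trans ?_
    rw [hΛ.toPredual_m hτ hF, G.haar_mul_conv hG]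
    exact (hΛ.dualT₂_comulOp hτ a u v).symm

lemma isConvolutionAdjoint_toPredual {δ : Multiplier A} (hδ : ∀ z, G.φ (δ.right z) = G.φ (G.S z))
    (hτ : ∀ p x, G.φ (x * p) = G.φ (τ p * x))
    (hF : ∀ u, F (G.mulT u) = restrict _ (hΛ.dualT τ u) (hΛ.isNormal_dualT τ u)) (x : A) :
    IsConvolutionAdjoint (star hΛ.V) (F (G.convStar δ x)) (F x) := by
  obtain ⟨u, hu⟩ := G.exists_mulT x
  obtain ⟨v, hv⟩ := G.exists_mulT (G.convStar δ x)
  have e1 : F x = restrict _ (hΛ.dualT τ u) (hΛ.isNormal_dualT τ u) := by rw [← hu, hF]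
  have e2 : F (G.convStar δ x) = restrict _ (hΛ.dualT τ v) (hΛ.isNormal_dualT τ v) := by
    rw [← hv, hF]
  intro y z hyz
  rw [e1, e2]
  change hΛ.dualT τ v y = starRingEnd ℂ (hΛ.dualT τ u (star (z : H →L[ℂ] H)))
  -- The set of pairs satisfying the adjoint relation is a subspace and ultraweakly closed, so only
  -- the slices of `W` have to be examined.
  let R : Submodule ℂ ((H →L[ℂ] H) × (H →L[ℂ] H)) :=
    { carrier := {p | hΛ.dualT τ v p.1 = starRingEnd ℂ (hΛ.dualT τ u (star p.2))}
      add_mem' := by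
        rintro p q (hp : _ = _) (hq : _ = _)
        change hΛ.dualT τ v (p.1 + q.1) = starRingEnd ℂ (hΛ.dualT τ u (star (p.2 + q.2)))
        rw [map_add, star_add, map_add, map_add, hp, hq]
      zero_mem' := by
        change hΛ.dualT τ v 0 = starRingEnd ℂ (hΛ.dualT τ u (star 0))
        rw [star_zero, map_zero, map_zero, map_zero]
      smul_mem' := by
        rintro c p (hp : _ = _)
        change hΛ.dualT τ v (c • p.1) = starRingEnd ℂ (hΛ.dualT τ u (star (c • p.2)))
        rw [map_smul, star_smul, map_smul, hp, smul_eq_mul, smul_eq_mul, map_mul]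
        congr 1
        exact (Complex.conj_conj c).symm }
  have hclosed : @IsClosed _ (@instTopologicalSpaceProd _ _ (ultraweak H) (ultraweak H))
      (R : Set ((H →L[ℂ] H) × (H →L[ℂ] H))) := by
    let _ := ultraweak H
    have h1 : Continuous fun T : H →L[ℂ] H => hΛ.dualT τ v T :=
      (hΛ.isNormal_dualT τ v).continuous_ultraweak
    have h2 : Continuous fun T : H →L[ℂ] H => starRingEnd ℂ (hΛ.dualT τ u (star T)) :=
      (hΛ.isNormal_dualT τ u).star_conj.continuous_ultraweak
    exact isClosed_eq (h1.comp continuous_fst) (h2.comp continuous_snd)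
  have hgen : ∀ ξ η, hΛ.dualT τ v (slice ξ η (star hΛ.V)) =
      starRingEnd ℂ (hΛ.dualT τ u (star (slice ξ η (star (star hΛ.V))))) := by
    -- For vectors in the range of `Λ`, the slices of `V*` and `V` are `m(z)` and `m(S(z))` with `z
    -- = (ι ⊗ φ)(Δ(a*)(1 ⊗ b))`, by strong left invariance. The claim becomes the formula for `φ(z
    -- x^*)`.
    have hΛΛ : ∀ a b, hΛ.dualT τ v (slice (Λ a) (Λ b) (star hΛ.V)) =
      starRingEnd ℂ (hΛ.dualT τ u (star (slice (Λ a) (Λ b) (star (star hΛ.V))))) := by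
      intro a b
      have h1 : star (slice (Λ a) (Λ b) (star (star hΛ.V))) =
          hΛ.m (star (G.S (BL.sr G.φ (G.gRs (ctmul (star a) b))))) := by
        rw [m_star, G.S_sr_gRs, ← slice_V]
        exact congrArg (fun T => star (slice (Λ a) (Λ b) T)) (star_star hΛ.V)
      rw [h1, slice_star_V, hΛ.dualT_m hτ, hΛ.dualT_m hτ, hu, hv, G.haar_mul_convStar hδ]
    have hc1 : ∀ η, Continuous fun ξ => hΛ.dualT τ v (slice ξ η (star hΛ.V)) := fun η =>
      (hΛ.dualT τ v).continuous.comp (continuous_slice_left η _)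
    have hc2 : ∀ ξ, Continuous fun η => hΛ.dualT τ v (slice ξ η (star hΛ.V)) := fun ξ =>
      (hΛ.dualT τ v).continuous.comp (continuous_slice_right ξ _)
    have hc3 : ∀ η, Continuous fun ξ =>
        starRingEnd ℂ (hΛ.dualT τ u (star (slice ξ η (star (star hΛ.V))))) := fun η =>
      Complex.continuous_conj.comp
        ((hΛ.dualT τ u).continuous.comp (continuous_slice_left η _).star)
    have hc4 : ∀ ξ, Continuous fun η =>
        starRingEnd ℂ (hΛ.dualT τ u (star (slice ξ η (star (star hΛ.V))))) := fun ξ =>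
      Complex.continuous_conj.comp
        ((hΛ.dualT τ u).continuous.comp (continuous_slice_right ξ _).star)
    intro ξ η
    refine hΛ.denseRange.induction_on (p := fun ξ => hΛ.dualT τ v (slice ξ η (star hΛ.V)) =
      starRingEnd ℂ (hΛ.dualT τ u (star (slice ξ η (star (star hΛ.V)))))) ξ
      (isClosed_eq (hc1 η) (hc3 η)) fun a => ?_
    exact hΛ.denseRange.induction_on (p := fun η => hΛ.dualT τ v (slice (Λ a) η (star hΛ.V)) =
      starRingEnd ℂ (hΛ.dualT τ u (star (slice (Λ a) η (star (star hΛ.V)))))) η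
      (isClosed_eq (hc2 _) (hc4 _)) fun b => hΛΛ a b
  have hle : Submodule.span ℂ {p : (H →L[ℂ] H) × (H →L[ℂ] H) |
      ∃ ξ η : H, p = (slice ξ η (star hΛ.V), slice ξ η (star (star hΛ.V)))} ≤ R := by
    refine Submodule.span_le.2 ?_
    rintro _ ⟨ξ, η, rfl⟩
    exact hgen ξ η
  have : ((y : H →L[ℂ] H), (z : H →L[ℂ] H)) ∈ (R : Set ((H →L[ℂ] H) × (H →L[ℂ] H))) :=
    (@closure_minimal _ (@instTopologicalSpaceProd _ _ (ultraweak H) (ultraweak H)) _ _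
      hle hclosed) hyz
  exact this

lemma denseRange_toPredual (hsurj : Function.Surjective τ)
    (hF : ∀ u, F (G.mulT u) = restrict _ (hΛ.dualT τ u) (hΛ.isNormal_dualT τ u)) :
    DenseRange F := by
  have h : ∀ ω, ω ∈ (LinearMap.range F).topologicalClosure := by
    refine mem_of_vecFun_mem (LinearMap.range F).isClosed_topologicalClosure hΛ.denseRange
      fun a b => (LinearMap.range F).le_topologicalClosure ?_
    -- With `τ(p) = a*`, the element `bp` is sent to the restriction of `⟪Λ(a), · Λ(b)⟫`.
    obtain ⟨p, hp⟩ := hsurj (star a)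
    refine ⟨G.mulT (ctmul b p), ?_⟩
    rw [hF]
    refine Subtype.ext ?_
    change (hΛ.dualT τ (ctmul b p)).comp _ = (vecFun (Λ a) (Λ b)).comp _
    rw [dualT_ctmul, hp, star_star]
  exact fun ω => h ω

end ToPredual

end IsGNSPair

end BornQG



/-! ### The main theorem. -/

set_option maxHeartbeats 2000000 in
theorem mainTheorem12 {A : Type*} [NonUnitalRing A] [Module ℂ A] [IsScalarTower ℂ A A]
    [SMulCommClass ℂ A A] [StarRing A] [StarModule ℂ A] [Bornology A]
    [BornQG.CompleteBornological A] (G : BornQG.BornologicalQuantumGroup A)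
    (hG : G.HasTrivialScaling)
    {H : Type*} [NormedAddCommGroup H] [InnerProductSpace ℂ H] [CompleteSpace H]
    (Λ : A →ₗ[ℂ] H) (hΛ : BornQG.IsGNSPair G Λ) :
    ∃ (δ : BornQG.Multiplier A) (m : A →ₗ[ℂ] (H →L[ℂ] H))
      (W : BornQG.HTensor H →L[ℂ] BornQG.HTensor H),
      G.IsModularElement δ ∧ BornQG.IsRegularRep Λ m ∧ BornQG.IsMultiplicativeUnitary G Λ W ∧
      ∃ F : A →ₗ[ℂ] BornQG.predual (BornQG.LInfty m),
        (∀ x a : A, (F x).1 ⟨m a, BornQG.mem_LInfty m a⟩ = G.haar (a * x)) ∧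
        (∀ (x : A) (ω : BornQG.predual (BornQG.LInfty m)),
          (∀ a : A, ω.1 ⟨m a, BornQG.mem_LInfty m a⟩ = G.haar (a * x)) → ω = F x) ∧
        BornQG.IsBoundedMap F ∧
        (∀ x y : A, BornQG.IsConvolution W (F (G.conv x y)) (F x) (F y)) ∧
        (∀ x : A, BornQG.IsConvolutionAdjoint W (F (G.convStar δ x)) (F x)) ∧
        DenseRange F := by
  obtain ⟨δ, hδ, -, hδ'⟩ := G.exists_modular hG
  obtain ⟨τ, hτ, hsurj⟩ := G.exists_modular_automorphism_inv hG
  obtain ⟨F, hF⟩ := hΛ.exists_toPredual hτ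
  have h₁ : ∀ x a : A, (F x).1 ⟨hΛ.m.toLinearMap a, BornQG.mem_LInfty hΛ.m.toLinearMap a⟩ =
      G.haar (a * x) := fun x a => hΛ.toPredual_m hτ hF x a
  have h₂ : ∀ (x : A) (ω : BornQG.predual (BornQG.LInfty hΛ.m.toLinearMap)),
      (∀ a : A, ω.1 ⟨hΛ.m.toLinearMap a, BornQG.mem_LInfty hΛ.m.toLinearMap a⟩ =
        G.haar (a * x)) → ω = F x :=
    fun x ω hω => hΛ.predual_ext fun a => (hω a).trans (h₁ x a).symm
  have h₃ := hΛ.isBoundedMap_toPredual hF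
  have h₄ := hΛ.isConvolution_toPredual hG hτ hF
  have h₅ := hΛ.isConvolutionAdjoint_toPredual hδ' hτ hF
  have h₆ := hΛ.denseRange_toPredual hsurj hF
  have h₀ := hΛ.isMultiplicativeUnitary
  have h₀' := hΛ.isRegularRep
  refine ⟨δ, hΛ.m.toLinearMap, star hΛ.V, hδ, ?_, ?_, F, ?_, ?_, ?_, ?_, ?_, ?_⟩
  · exact h₀'
  · exact h₀
  · exact h₁
  · exact h₂
  · exact h₃
  · exact h₄
  · exact h₅
  · exact h₆
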